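/- All graphs are finite and simple. For an edge $\{x,y\}$ of a finite connected graph with combinatorial distance $d$, let $m_x^\alpha$ ($0\le\alpha\le 1$) be the probability measure with mass $\alpha$ at $x$ and mass $(1-\alpha)/d_x$ at each of the $d_x$ neighbours of $x$, let $\kappa_\alpha(x,y)=1-W(m_x^\alpha,m_y^\alpha)$, where $W$ is the Wasserstein distance with respect to $d$, and let the Lin–Lu–Yau curvature be $\kappa_{LLY}(x,y)=\lim_{\alpha\to1^-}\kappa_\alpha(x,y)/(1-\alpha)$. A generalized Halin graph $H(T,C)$ is a graph obtained from a planar embedding of a finite tree $T$ with maximum degree at least $3$ by connecting all the leaves of $T$ with a cycle $C$, which passes through the leaves in the cyclic order in which they occur around the embedded tree. Named graphs: - $W_n$ is the wheel with $n$ vertices: a vertex $v_0$ joined to all vertices of a cycle $v_1\cdots v_{n-1}$. - $W_n'$ is $W_{n-1}$ with the edge $v_0v_1$ subdivided once. - $W_n''$ is $W_{n-2}$ with the two edges $v_0v_1$ and $v_0v_{\lceil (n-2)/2\rceil}$ each subdivided once. - $H_1$ and $H_2$ are obtained from the tree consisting of three paths with a common end vertex, of lengths $2,2,2$ and $3,1,1$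 respectively, by joining its three leaves by a triangle. - $H_3$ (the triangular prism) is obtained from the tree with two adjacent vertices $x,y$, two leaves $x_1,x_2$ at $x$ and two leaves $y_1,y_2$ at $y$, with the cycle $y_1y_2x_1x_2$. - $H_4$ is $H_3$ with the edge $yy_2$ subdivided once, and $H_5$ is $H_3$ with the edge $xy$ subdivided once. - $H_6$ is $W_5$ with the edges $v_0v_1$ and $v_0v_2$ each subdivided once. - $H_7$ is obtained from the tree in which a vertex $x$ is adjacent to three leaves $x_1,x_2,x_3$ and to a vertex $y$, which is adjacent to two further leaves $y_1,y_2$, with the cycle $y_1y_2x_1x_2x_3$. - $H_8$ is $H_7$ with the edge $xx_2$ subdivided once. **Theorem.** Let $G$ be a generalized Halin graph all of whose edges have positive Lin–Lu–Yau curvature. Then $|V(G)|\le 12$, and $G$ is isomorphic to one of the following graphs: $W_n$ ($4\le n\le 12$), $W_n'$ ($5\le n\le 9$), $W_n''$ ($6\le n\le 10$), $H_i$ ($1\le i\le 8$). -/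

import Mathlib

open Filter Topology

namespace SimpleGraph

section Curvature

variable {V : Type*} [Fintype V]

/-- The Wasserstein distance between two probability measures (given by their mass functions)
on a finite connected graph, with respect to the combinatorial distance. -/
noncomputable def wasserstein (G : SimpleGraph V) (m₁ m₂ : V → ℝ) : ℝ :=
  sInf {c : ℝ | ∃ π : V → V → ℝ,
    (∀ x y, 0 ≤ π x y ∧ π x y ≤ 1) ∧
    (∀ x, ∑ y, π x y = m₁ x) ∧
    (∀ y, ∑ x, π x y = m₂ y) ∧
    c = ∑ y, ∑ x, π x y * (G.dist x y : ℝ)}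

open Classical in
/-- The lazy random walk measure `m_x^α`: mass `α` at `x` and mass `(1 - α) / d_x` at each
neighbour of `x`. -/
noncomputable def lazyMeasure (G : SimpleGraph V) (α : ℝ) (x : V) : V → ℝ := fun v =>
  if v = x then α else if G.Adj x v then (1 - α) / (G.degree x : ℝ) else 0

/-- The `α`-Ollivier-Ricci curvature `κ_α(x, y) = 1 - W(m_x^α, m_y^α)` of an edge. -/
noncomputable def ollivierCurvature (G : SimpleGraph V) (α : ℝ) (x y : V) : ℝ :=
  1 - G.wasserstein (G.lazyMeasure α x) (G.lazyMeasure α y)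

/-- `κ` is the Lin-Lu-Yau curvature of the edge `xy`, that is, the limit of
`κ_α(x, y) / (1 - α)` as `α` tends to `1` from below. -/
def IsLLYCurvature (G : SimpleGraph V) (x y : V) (κ : ℝ) : Prop :=
  Tendsto (fun α : ℝ => G.ollivierCurvature α x y / (1 - α)) (𝓝[<] 1) (𝓝 κ)

/-- Every edge of the graph has positive Lin-Lu-Yau curvature. -/
def HasPositiveLLYCurvature (G : SimpleGraph V) : Prop :=
  ∀ x y, G.Adj x y → ∃ κ : ℝ, G.IsLLYCurvature x y κ ∧ 0 < κ

end Curvature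

section Halin

variable {V : Type*}

/-- A rotation system of a graph: for each vertex a cyclic order of the darts (oriented edges)
that leave it. This is the combinatorial form of an embedding into an oriented surface. For a
finite tree the number of faces is always one and the surface is always the sphere, so the
rotation systems of a finite tree are exactly its embeddings into the plane (up to
orientation-preserving homeomorphism). -/
structure RotationSystem (T : SimpleGraph V) where
  /-- The next dart, in the cyclic (say clockwise) order, around the initial vertex. -/
  rot : Equiv.Perm T.Dart
  fst_rot : ∀ d, (rot d).fst = d.fst
  sameCycle : ∀ d e : T.Dart, d.fst = e.fst → rot.SameCycle d e

/-- One step of the walk along the boundary of a face: after having traversed the dart `d`,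
leave its end vertex along the edge that follows the edge of `d` in the cyclic order there. -/
def RotationSystem.faceStep {T : SimpleGraph V} (R : T.RotationSystem) (d : T.Dart) : T.Dart :=
  R.rot d.symm

variable [Fintype V]

open Classical in
/-- A leaf is a vertex of degree one. -/
def IsLeaf (T : SimpleGraph V) (v : V) : Prop := T.degree v = 1

/-- `v` is the first leaf that one meets when one walks around the embedded tree `T`, along the
boundary of its face, starting from the leaf `u`. -/
def RotationSystem.NextLeaf {T : SimpleGraph V} (R : T.RotationSystem) (u v : V) : Prop :=
  T.IsLeaf u ∧ T.IsLeaf v ∧ ∃ d : T.Dart, d.fst = u ∧ ∃ k : ℕ,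
    (R.faceStep^[k] d).snd = v ∧ ∀ j < k, ¬ T.IsLeaf (R.faceStep^[j] d).snd

/-- The cycle `C` through the leaves of an embedded tree, in the order in which they occur around
the tree (the other vertices are isolated in this graph). -/
def RotationSystem.leafCycle {T : SimpleGraph V} (R : T.RotationSystem) : SimpleGraph V :=
  SimpleGraph.fromRel R.NextLeaf

open Classical in
/-- `G` is a generalized Halin graph `H(T, C)`: it arises from a planar embedding of a finite tree
`T` with maximum degree at least three by connecting all the leaves of `T` with a cycle `C`. -/
def IsGeneralizedHalin (G : SimpleGraph V) : Prop :=
  ∃ (T : SimpleGraph V) (R : T.RotationSystem),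
    T.IsTree ∧ 3 ≤ T.maxDegree ∧ G = T ⊔ R.leafCycle

end Halin

section Families

/-- Subdivision of the edge `e`: it is replaced by a path of length two through the new
vertex `none`. -/
def subdivide {V : Type*} (G : SimpleGraph V) (e : Sym2 V) : SimpleGraph (Option V) :=
  SimpleGraph.fromRel fun a b =>
    match a, b with
    | some u, some v => G.Adj u v ∧ s(u, v) ≠ e
    | none, some v => v ∈ e
    | _, none => False

/-- The wheel `W_n` with `n` vertices `v_0, …, v_{n-1}` (used for `n ≥ 4`): the vertex `v_0` is
joined to all vertices of the cycle `v_1 ⋯ v_{n-1}`. -/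
def wheel (n : ℕ) : SimpleGraph (Fin n) :=
  SimpleGraph.fromRel fun i j =>
    i.val = 0 ∨ j.val = i.val + 1 ∨ (i.val = 1 ∧ j.val = n - 1)

/-- The once-subdivided wheel `W'_n`: subdivide the edge `v_0 v_1` of `W_{n-1}`. -/
def wheel' (n : ℕ) (h : 5 ≤ n) : SimpleGraph (Option (Fin (n - 1))) :=
  (wheel (n - 1)).subdivide s(⟨0, by omega⟩, ⟨1, by omega⟩)

/-- The twice-subdivided wheel `W''_n`: subdivide the edges `v_0 v_1` and `v_0 v_k` of `W_{n-2}`,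
where `k = ⌈(n - 2) / 2⌉ = ⌊(n - 1) / 2⌋`. -/
def wheel'' (n : ℕ) (h : 6 ≤ n) : SimpleGraph (Option (Option (Fin (n - 2)))) :=
  ((wheel (n - 2)).subdivide s(⟨0, by omega⟩, ⟨1, by omega⟩)).subdivide
    s(some ⟨0, by omega⟩, some ⟨(n - 1) / 2, by omega⟩)

/-- The tree consists of three paths of length two from `0`; the cycle is `4 5 6`. -/
def halinH1 : SimpleGraph (Fin 7) :=
  SimpleGraph.fromEdgeSet
    {s(0, 1), s(0, 2), s(0, 3), s(1, 4), s(2, 5), s(3, 6), s(4, 5), s(5, 6), s(6, 4)}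

/-- The tree consists of paths of lengths three, one, one from `0`; the cycle is `3 4 5`. -/
def halinH2 : SimpleGraph (Fin 6) :=
  SimpleGraph.fromEdgeSet
    {s(0, 1), s(1, 2), s(2, 3), s(0, 4), s(0, 5), s(3, 4), s(4, 5), s(5, 3)}

/-- The tree consists of the edge `01`, two leaves at `1` and two leaves at `0`; the cycle is
`2 3 4 5`. This is the triangular prism. -/
def halinH3 : SimpleGraph (Fin 6) :=
  SimpleGraph.fromEdgeSet
    {s(0, 1), s(1, 2), s(1, 3), s(0, 4), s(0, 5), s(2, 3), s(3, 4), s(4, 5), s(5, 2)}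

/-- As `halinH3`, with the edge from a vertex of degree three of the tree to one leaf
subdivided. The cycle is `2 4 5 6`. -/
def halinH4 : SimpleGraph (Fin 7) :=
  SimpleGraph.fromEdgeSet
    {s(0, 1), s(1, 2), s(1, 3), s(3, 4), s(0, 5), s(0, 6),
      s(2, 4), s(4, 5), s(5, 6), s(6, 2)}

/-- As `halinH3`, with the edge between the two vertices of degree three of the tree
subdivided. The cycle is `3 4 5 6`. -/
def halinH5 : SimpleGraph (Fin 7) :=
  SimpleGraph.fromEdgeSet
    {s(0, 1), s(1, 2), s(2, 3), s(2, 4), s(0, 5), s(0, 6),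
      s(3, 4), s(4, 5), s(5, 6), s(6, 3)}

/-- The wheel with four spokes, with two consecutive spokes subdivided. The cycle is
`3 4 5 6`. -/
def halinH6 : SimpleGraph (Fin 7) :=
  SimpleGraph.fromEdgeSet
    {s(0, 1), s(0, 2), s(1, 3), s(2, 4), s(0, 5), s(0, 6),
      s(3, 4), s(4, 5), s(5, 6), s(6, 3)}

/-- The vertex `0` has the neighbours `1, 4, 5, 6` in the tree, and `1` has the two leaves
`2, 3`. The cycle is `2 3 4 5 6`. -/
def halinH7 : SimpleGraph (Fin 7) :=
  SimpleGraph.fromEdgeSet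
    {s(0, 1), s(1, 2), s(1, 3), s(0, 4), s(0, 5), s(0, 6),
      s(2, 3), s(3, 4), s(4, 5), s(5, 6), s(6, 2)}

/-- As `halinH7`, with the edge `05` subdivided by the vertex `7`. -/
def halinH8 : SimpleGraph (Fin 8) :=
  SimpleGraph.fromEdgeSet
    {s(0, 1), s(1, 2), s(1, 3), s(0, 4), s(0, 7), s(7, 5), s(0, 6),
      s(2, 3), s(3, 4), s(4, 5), s(5, 6), s(6, 2)}

end Families

end SimpleGraph

/-!
Only an upper bound for the curvature is ever needed, so only the easy half of Kantorovich duality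
enters: if every edge has positive curvature and the `1`-Lipschitz function `f` increases by one
from `x` to its neighbour `y`, the average of `f` over the neighbours of `y` is less than one plus
its average over those of `x` (`HasPositiveLLYCurvature.avg_lt`). The vertices involved are at
distance at most three, so the potentials are written with the truncated distance `dist3`, which
is described by adjacencies. Three consequences carry most of the argument. At an edge between
vertices of degree three, the other neighbours can be matched at total distance at most three
(`HasPositiveLLYCurvature.cubic`). At an edge from a vertex with just one other neighbour `z`, the
far neighbours are close to `z` (`dist3_other_le_two`) and the degree of the other end is small
unless it shares further neighbours with `z` (`card_lt`).

The embedding of the tree `T` enters through the permutation `σ` that sends a leaf to the next one.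
The boundary walk of a tree visits all darts and leaves a branch of the tree only through the edge
at its root. Hence `σ` is a single cycle on the leaves, and the leaves of each branch form an
interval of it (`IsGeneralizedHalin.exists_isHalin`). Each edge of `T` is therefore crossed by
exactly two edges of the leaf cycle when both its ends have degree at least three in `T`.

Call a vertex of `T` of degree at least three a branch vertex, and a leaf attached to a branch
vertex by a path of length one or two a leg. The classification distinguishes three situations.

* If two vertices of degree two are adjacent in `T`, or a vertex of degree two lies between two
  branch vertices, the conditions at its edges determine the graph: it is `halinH2` or `halinH5`.
  Otherwise each branch of `T` at a branch vertex is a leg or starts with another branch vertex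
  (`IsHalin.hasLegs_or`).
* If two branch vertices `x`, `y` are adjacent, the condition for cubic edges is applied to the two
  edges of the leaf cycle that cross `xy`. It leaves at most five leaves, and the graph is
  `halinH3`, `halinH4`, `halinH7` or `halinH8` (`IsHalin.nonempty_iso_of_adj`).
* Otherwise `T` consists of `k` legs at one branch vertex, and `G` is a wheel with `k` spokes, some
  of them subdivided. Without subdivided spokes `k < 12`. With one `k < 8`. Two consecutive
  subdivided spokes force `k ≤ 4`, and two with a single spoke between them `k ≤ 5`. Three
  consecutive ones force `k = 3`. Up to rotation this leaves one subdivided spoke, two as far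
  apart as possible, and the patterns of `halinH1` and `halinH6` (`exists_pattern`,
  `IsSpider.classification`).
-/

namespace SimpleGraph

/-! ### The truncated distance -/

section Duality

variable {V : Type*} {G : SimpleGraph V}

open Classical in
/-- The combinatorial distance truncated at `3`, described through adjacencies only. -/
noncomputable def dist3 (G : SimpleGraph V) (a b : V) : ℕ :=
  if a = b then 0 else if G.Adj a b then 1 else if ∃ w, G.Adj a w ∧ G.Adj w b then 2 else 3

lemma dist3_comm (a b : V) : G.dist3 a b = G.dist3 b a := by
  unfold dist3
  have h1 : (a = b) ↔ (b = a) := eq_comm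
  have h2 : (∃ w, G.Adj a w ∧ G.Adj w b) ↔ ∃ w, G.Adj b w ∧ G.Adj w a :=
    ⟨fun ⟨w, h, h'⟩ => ⟨w, h'.symm, h.symm⟩, fun ⟨w, h, h'⟩ => ⟨w, h'.symm, h.symm⟩⟩
  classical exact if_congr h1 rfl (if_congr (G.adj_comm a b) rfl (if_congr h2 rfl rfl))

lemma dist3_le_three (a b : V) : G.dist3 a b ≤ 3 := by
  unfold dist3; split_ifs <;> omega

lemma dist3_eq_zero {a b : V} : G.dist3 a b = 0 ↔ a = b := by
  unfold dist3; split_ifs <;> simp_all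

lemma dist3_self (a : V) : G.dist3 a a = 0 := dist3_eq_zero.2 rfl

lemma dist3_eq_one {a b : V} : G.dist3 a b = 1 ↔ G.Adj a b := by
  unfold dist3; split_ifs with h h1 h2
  · subst h; simp
  all_goals simp_all

lemma dist3_le_one {a b : V} : G.dist3 a b ≤ 1 ↔ a = b ∨ G.Adj a b := by
  rw [← dist3_eq_zero (G := G), ← dist3_eq_one]; omega

lemma dist3_le_two {a b : V} :
    G.dist3 a b ≤ 2 ↔ a = b ∨ G.Adj a b ∨ ∃ w, G.Adj a w ∧ G.Adj w b := by
  unfold dist3; split_ifs <;> simp_all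

lemma two_le_dist3 {a b : V} (h : a ≠ b) (h' : ¬ G.Adj a b) : 2 ≤ G.dist3 a b := by
  by_contra hc
  rcases dist3_le_one.1 (by omega : G.dist3 a b ≤ 1) with h1 | h1
  exacts [h h1, h' h1]

lemma one_le_dist3 {a b : V} (h : a ≠ b) : 1 ≤ G.dist3 a b :=
  Nat.one_le_iff_ne_zero.2 fun hc => h (dist3_eq_zero.1 hc)

lemma three_le_dist3 {a b : V} (h : a ≠ b) (h' : ¬ G.Adj a b)
    (h'' : ∀ w, G.Adj a w → ¬ G.Adj w b) : 3 ≤ G.dist3 a b := by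
  by_contra hc
  rcases dist3_le_two.1 (by omega : G.dist3 a b ≤ 2) with h1 | h1 | ⟨w, h1, h2⟩
  exacts [h h1, h' h1, h'' w h1 h2]

lemma dist3_le_add_one {a b c : V} (h : G.Adj b c) : G.dist3 a c ≤ G.dist3 a b + 1 := by
  rcases Nat.lt_or_ge (G.dist3 a b) 2 with h2 | h2
  · rcases dist3_le_one.1 (by omega : G.dist3 a b ≤ 1) with h1 | h1
    · subst h1; rw [dist3_self]; exact (dist3_eq_one.2 h).le
    · rw [dist3_eq_one.2 h1]; exact dist3_le_two.2 (Or.inr (Or.inr ⟨b, h1, h⟩))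
  · have := G.dist3_le_three a c; omega

lemma dist3_le_length {a b : V} (p : G.Walk a b) : G.dist3 a b ≤ p.length := by
  induction p with
  | nil => simp [dist3_self]
  | @cons u v w h p ih =>
    rw [dist3_comm] at ih ⊢
    have := dist3_le_add_one (a := w) h.symm
    simp only [Walk.length_cons]; omega

/-- Functions that are Lipschitz for `dist3` are Lipschitz for the combinatorial distance. -/
lemma Connected.dist3_le_dist (hG : G.Connected) (a b : V) : G.dist3 a b ≤ G.dist a b := by
  obtain ⟨p, hp⟩ := hG.exists_walk_length_eq_dist a b
  exact hp ▸ dist3_le_length p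

lemma dist3_triangle (a b c : V) : G.dist3 a c ≤ G.dist3 a b + G.dist3 b c := by
  rcases Nat.lt_or_ge (G.dist3 b c) 3 with h | h
  · rcases dist3_le_two.1 (by omega : G.dist3 b c ≤ 2) with rfl | h1 | ⟨w, h1, h2⟩
    · omega
    · rw [dist3_eq_one.2 h1]; exact dist3_le_add_one h1
    · by_cases hbc : G.dist3 b c ≤ 1
      · rcases dist3_le_one.1 hbc with rfl | h3
        · omega
        · rw [dist3_eq_one.2 h3]; exact dist3_le_add_one h3
      · have := dist3_le_add_one (a := a) h1
        have := dist3_le_add_one (a := a) h2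
        omega
  · have := G.dist3_le_three a c; omega

lemma dist3_eq_two {a b w : V} (h : a ≠ b) (h' : ¬ G.Adj a b) (h1 : G.Adj a w) (h2 : G.Adj w b) :
    G.dist3 a b = 2 :=
  le_antisymm (dist3_le_two.2 (Or.inr (Or.inr ⟨w, h1, h2⟩))) (two_le_dist3 h h')

/-! ### Kantorovich duality -/

variable [Fintype V]

open Classical in
lemma sum_lazyMeasure_mul (α : ℝ) (x : V) (X : Finset V) (hX : ∀ v, v ∈ X ↔ G.Adj x v)
    (f : V → ℝ) :
    ∑ v, G.lazyMeasure α x v * f v = α * f x + (1 - α) / (X.card : ℝ) * ∑ v ∈ X, f v := by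
  have hXe : X = G.neighborFinset x := by ext v; simp [hX]
  have hd : (G.degree x : ℝ) = X.card := by rw [hXe, card_neighborFinset_eq_degree]
  have : ∀ v, G.lazyMeasure α x v * f v =
      (if v = x then α * f v else 0) + (if v ∈ X then (1 - α) / (X.card : ℝ) * f v else 0) := by
    intro v
    unfold lazyMeasure
    by_cases hv : v = x
    · subst hv; simp [hX]
    · simp [hv, hX, hd]
  simp only [this, Finset.sum_add_distrib, Finset.sum_ite_eq', Finset.mem_univ, if_true,
    Finset.sum_ite_mem, Finset.univ_inter, Finset.mul_sum]

/-- The easy half of Kantorovich duality. The product coupling shows that the infimum that defines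
`wasserstein` is taken over a nonempty set. -/
lemma le_wasserstein {m₁ m₂ : V → ℝ} (h₁ : ∀ v, 0 ≤ m₁ v) (h₂ : ∀ v, 0 ≤ m₂ v)
    (s₁ : ∑ v, m₁ v = 1) (s₂ : ∑ v, m₂ v = 1) (f : V → ℝ)
    (hf : ∀ a b, f b - f a ≤ G.dist a b) :
    ∑ v, m₂ v * f v - ∑ v, m₁ v * f v ≤ G.wasserstein m₁ m₂ := by
  unfold wasserstein
  apply le_csInf
  · refine ⟨_, fun x y => m₁ x * m₂ y, ?_, ?_, ?_, rfl⟩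
    · intro x y
      have a1 : m₁ x ≤ 1 := s₁ ▸ Finset.single_le_sum (fun v _ => h₁ v) (Finset.mem_univ x)
      have a2 : m₂ y ≤ 1 := s₂ ▸ Finset.single_le_sum (fun v _ => h₂ v) (Finset.mem_univ y)
      exact ⟨mul_nonneg (h₁ x) (h₂ y), mul_le_one₀ a1 (h₂ y) a2⟩
    · intro x; rw [← Finset.mul_sum, s₂, mul_one]
    · intro y; rw [← Finset.sum_mul, s₁, one_mul]
  · rintro c ⟨π, h01, hπ₁, hπ₂, rfl⟩
    have e₁ : ∑ v, m₁ v * f v = ∑ y, ∑ x, π x y * f x := by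
      rw [Finset.sum_comm]; simp only [← hπ₁, Finset.sum_mul]
    have e₂ : ∑ v, m₂ v * f v = ∑ y, ∑ x, π x y * f y := by
      simp only [← hπ₂, Finset.sum_mul]
    rw [e₁, e₂, ← Finset.sum_sub_distrib]
    refine Finset.sum_le_sum fun y _ => ?_
    rw [← Finset.sum_sub_distrib]
    refine Finset.sum_le_sum fun x _ => ?_
    rw [← mul_sub]
    exact mul_le_mul_of_nonneg_left (hf x y) (h01 x y).1

/-- A function that increases by one along an edge of positive curvature and is `1`-Lipschitz has a
Laplacian that is larger at the lower end of the edge. -/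
lemma HasPositiveLLYCurvature.avg_lt (hpos : G.HasPositiveLLYCurvature) {x y : V}
    (hxy : G.Adj x y) {X Y : Finset V} (hX : ∀ v, v ∈ X ↔ G.Adj x v)
    (hY : ∀ v, v ∈ Y ↔ G.Adj y v) (f : V → ℝ) (hf : ∀ a b, f b - f a ≤ G.dist a b)
    (hfxy : f y = f x + 1) :
    (∑ v ∈ Y, f v) / (Y.card : ℝ) < 1 + (∑ v ∈ X, f v) / (X.card : ℝ) := by
  obtain ⟨κ, hκ, hκ0⟩ := hpos x y hxy
  by_contra hcon
  push Not at hcon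
  have hXc : (X.card : ℝ) ≠ 0 := by
    have : y ∈ X := (hX y).2 hxy
    exact_mod_cast (Finset.card_pos.2 ⟨y, this⟩).ne'
  have hYc : (Y.card : ℝ) ≠ 0 := by
    have : x ∈ Y := (hY x).2 hxy.symm
    exact_mod_cast (Finset.card_pos.2 ⟨x, this⟩).ne'
  -- If the claim fails, duality bounds the curvature `κ_α` by zero for all `α` in `(0, 1)`.
  have hev : ∀ᶠ α : ℝ in 𝓝[<] 1, G.ollivierCurvature α x y / (1 - α) ≤ 0 := by
    have h0 : ∀ᶠ α : ℝ in 𝓝[<] 1, α ∈ Set.Ioo (0 : ℝ) 1 :=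
      Ioo_mem_nhdsLT (by norm_num)
    filter_upwards [h0] with α hα
    have h1α : 0 < 1 - α := by linarith [hα.2]
    apply div_nonpos_of_nonpos_of_nonneg _ h1α.le
    have hnn : ∀ z v, 0 ≤ G.lazyMeasure α z v := by
      intro z v; unfold lazyMeasure; split_ifs
      · exact hα.1.le
      · exact div_nonneg h1α.le (Nat.cast_nonneg _)
      · exact le_rfl
    have hone : ∀ z (Z : Finset V), (∀ v, v ∈ Z ↔ G.Adj z v) → (Z.card : ℝ) ≠ 0 →
        ∑ v, G.lazyMeasure α z v = 1 := by
      intro z Z hZ hZc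
      have := sum_lazyMeasure_mul α z Z hZ (fun _ => 1)
      simp only [mul_one, Finset.sum_const, nsmul_eq_mul] at this
      rw [this, div_mul_cancel₀ _ hZc]; ring
    have key := le_wasserstein (hnn x) (hnn y) (hone x X hX hXc) (hone y Y hY hYc) f hf
    rw [sum_lazyMeasure_mul α x X hX, sum_lazyMeasure_mul α y Y hY] at key
    unfold ollivierCurvature
    have e1 : (1 - α) / (Y.card : ℝ) * ∑ v ∈ Y, f v = (1 - α) * ((∑ v ∈ Y, f v) / Y.card) := by
      ring
    have e2 : (1 - α) / (X.card : ℝ) * ∑ v ∈ X, f v = (1 - α) * ((∑ v ∈ X, f v) / X.card) := by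
      ring
    rw [e1, e2, hfxy] at key
    have := mul_le_mul_of_nonneg_left hcon h1α.le
    linarith
  exact absurd (le_of_tendsto hκ hev) (not_le.2 hκ0)

/-- The form of duality that is applied to concrete edges: it suffices to prescribe an integer
potential on the closed neighbourhoods of the two ends, Lipschitz for the truncated distance. -/
lemma HasPositiveLLYCurvature.sum_lt (hG : G.Connected) (hpos : G.HasPositiveLLYCurvature) {x y : V}
    (hxy : G.Adj x y) {X Y : Finset V} (hX : ∀ v, v ∈ X ↔ G.Adj x v)
    (hY : ∀ v, v ∈ Y ↔ G.Adj y v) (g : V → ℤ)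
    (hg : ∀ a b, (a ∈ X ∨ a ∈ Y) → (b ∈ X ∨ b ∈ Y) → g b - g a ≤ G.dist3 a b)
    (hgxy : g y = g x + 1) :
    (X.card : ℤ) * ∑ v ∈ Y, g v < X.card * Y.card + Y.card * ∑ v ∈ X, g v := by
  classical
  set S : Finset V := X ∪ Y with hS
  have hmem : ∀ a, a ∈ S ↔ (a ∈ X ∨ a ∈ Y) := fun a => Finset.mem_union
  have hyX : y ∈ X := (hX y).2 hxy
  have hxY : x ∈ Y := (hY x).2 hxy.symm
  have hSne : S.Nonempty := ⟨y, (hmem y).2 (Or.inl hyX)⟩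
  -- McShane's extension of `g` from `S` to all vertices.
  let F : V → ℤ := fun v => S.inf' hSne fun a => g a + G.dist a v
  have hF : ∀ a b, F b - F a ≤ G.dist a b := by
    intro a b
    obtain ⟨c, hc, hce⟩ := Finset.exists_mem_eq_inf' hSne fun c => g c + (G.dist c a : ℤ)
    have h1 : F b ≤ g c + G.dist c b := Finset.inf'_le _ hc
    have h2 : F a = g c + G.dist c a := hce
    have h3 : (G.dist c b : ℤ) ≤ G.dist c a + G.dist a b := by
      exact_mod_cast hG.dist_triangle
    omega
  have hFg : ∀ v ∈ S, F v = g v := by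
    intro v hv
    apply le_antisymm
    · have : F v ≤ g v + G.dist v v := Finset.inf'_le (fun a => g a + (G.dist a v : ℤ)) hv
      simpa using this
    · refine Finset.le_inf' hSne _ fun a ha => ?_
      have h1 := hg a v ((hmem a).1 ha) ((hmem v).1 hv)
      have h2 : (G.dist3 a v : ℤ) ≤ G.dist a v := by exact_mod_cast hG.dist3_le_dist a v
      omega
  have key := hpos.avg_lt hxy hX hY (fun v => (F v : ℝ))
    (fun a b => by exact_mod_cast hF a b)
    (by
      rw [hFg y ((hmem y).2 (Or.inl hyX)), hFg x ((hmem x).2 (Or.inr hxY)), hgxy]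
      push_cast; ring)
  have hXc : (0 : ℝ) < X.card := by exact_mod_cast Finset.card_pos.2 ⟨y, hyX⟩
  have hYc : (0 : ℝ) < Y.card := by exact_mod_cast Finset.card_pos.2 ⟨x, hxY⟩
  have sX : ∑ v ∈ X, (F v : ℝ) = ((∑ v ∈ X, g v : ℤ) : ℝ) := by
    push_cast
    exact Finset.sum_congr rfl fun v hv => by rw [hFg v ((hmem v).2 (Or.inl hv))]
  have sY : ∑ v ∈ Y, (F v : ℝ) = ((∑ v ∈ Y, g v : ℤ) : ℝ) := by
    push_cast
    exact Finset.sum_congr rfl fun v hv => by rw [hFg v ((hmem v).2 (Or.inr hv))]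
  rw [sX, sY, div_lt_iff₀ hYc] at key
  have e : (1 + ((∑ v ∈ X, g v : ℤ) : ℝ) / X.card) * Y.card * X.card =
      X.card * Y.card + Y.card * ((∑ v ∈ X, g v : ℤ) : ℝ) := by
    field_simp
  have := mul_lt_mul_of_pos_right key hXc
  rw [e, mul_comm] at this
  exact_mod_cast this

end Duality

/-! ### Curvature conditions on single edges -/

section EdgeConditions

variable {V : Type*} [Fintype V] {G : SimpleGraph V}

/-- Duality for potentials that are minima of two shifted distance functions. These are Lipschitz
without further conditions. -/
lemma HasPositiveLLYCurvature.sum_lt_min (hG : G.Connected) (hpos : G.HasPositiveLLYCurvature)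
    {x y : V} (hxy : G.Adj x y) {X Y : Finset V} (hX : ∀ v, v ∈ X ↔ G.Adj x v)
    (hY : ∀ v, v ∈ Y ↔ G.Adj y v) (p q : V) (s t : ℤ) (g : V → ℤ)
    (hg : ∀ v, g v = min ((G.dist3 p v : ℤ) + s) ((G.dist3 q v : ℤ) + t))
    (hgxy : g y = g x + 1) :
    (X.card : ℤ) * ∑ v ∈ Y, g v < X.card * Y.card + Y.card * ∑ v ∈ X, g v := by
  refine hpos.sum_lt hG hxy hX hY g (fun a b _ _ => ?_) hgxy
  have h1 := G.dist3_triangle p a b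
  have h2 := G.dist3_triangle q a b
  rw [hg a, hg b]
  omega

/-- If the end `x` of the edge `xy` has exactly one other neighbour `z`, the other neighbours of `y`
are on average at distance at most two from `z`. -/
lemma HasPositiveLLYCurvature.sum_dist3_lt (hG : G.Connected) (hpos : G.HasPositiveLLYCurvature)
    {x y z : V} (hx : ∀ v, G.Adj x v ↔ v = y ∨ v = z) (hzy : z ≠ y) (hnzy : ¬ G.Adj z y)
    {Y : Finset V} (hY : ∀ v, v ∈ Y ↔ G.Adj y v) :
    ∑ w ∈ Y, G.dist3 z w < 2 * Y.card := by
  classical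
  have hxy : G.Adj x y := (hx y).2 (Or.inl rfl)
  have hxz : G.Adj x z := (hx z).2 (Or.inr rfl)
  have hX : ∀ v, v ∈ ({y, z} : Finset V) ↔ G.Adj x v := fun v => by simp [hx]
  have d1 : G.dist3 z x = 1 := dist3_eq_one.2 hxz.symm
  have d2 : G.dist3 z y = 2 := dist3_eq_two hzy hnzy hxz.symm hxy
  have key := hpos.sum_lt_min hG hxy hX hY z z (-1) (-1) (fun v => (G.dist3 z v : ℤ) - 1)
    (fun v => by rw [min_self]; ring) (by simp only [d1, d2]; norm_num)
  rw [Finset.card_pair hzy.symm, Finset.sum_pair hzy.symm] at key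
  simp only [d2, dist3_self, Finset.sum_sub_distrib, Finset.sum_const, nsmul_eq_mul] at key
  zify
  push_cast at key
  linarith

/-- If moreover `y` and `z` share no neighbour besides `x`, then no neighbour of `y` is at distance
three from `z`, as it would raise the average above two. -/
lemma HasPositiveLLYCurvature.dist3_other_le_two (hG : G.Connected)
    (hpos : G.HasPositiveLLYCurvature) {x y z : V} (hx : ∀ v, G.Adj x v ↔ v = y ∨ v = z)
    (hzy : z ≠ y) (hnzy : ¬ G.Adj z y)
    (hn : ∀ v, G.Adj y v → v ≠ x → ¬ G.Adj z v) {w : V} (hw : G.Adj y w) (hwx : w ≠ x) :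
    G.dist3 z w ≤ 2 := by
  classical
  have hxy : G.Adj x y := (hx y).2 (Or.inl rfl)
  have hY : ∀ v, v ∈ Finset.univ.filter (G.Adj y) ↔ G.Adj y v := fun v => by simp
  set Y := Finset.univ.filter (G.Adj y)
  have key := hpos.sum_dist3_lt hG hx hzy hnzy hY
  by_contra hc
  have hlow : ∀ v ∈ Y, 2 + (if v = w then 1 else 0) ≤ G.dist3 z v + (if v = x then 1 else 0) := by
    intro v hv
    have hyv := (hY v).1 hv
    have hvz : z ≠ v := by rintro rfl; exact hnzy hyv.symm
    have e1 := one_le_dist3 (G := G) hvz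
    by_cases hvx : v = x
    · subst hvx
      simp only [hwx.symm, if_true, if_false]; omega
    · have e2 := two_le_dist3 hvz (hn v hyv hvx)
      by_cases hvw : v = w
      · subst hvw; simp only [if_true]; omega
      · simp only [hvw, if_false]; omega
  have hs := Finset.sum_le_sum hlow
  simp only [Finset.sum_add_distrib, Finset.sum_const, Finset.sum_ite_eq', (hY w).2 hw,
    (hY x).2 hxy.symm, if_true, smul_eq_mul] at hs
  omega

/-- If the end `x` of the edge `xy` has exactly one other neighbour `z`, the degree of `y` is
bounded through the number of neighbours that `y` and `z` share besides `x`. -/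
lemma HasPositiveLLYCurvature.card_lt (hG : G.Connected) (hpos : G.HasPositiveLLYCurvature)
    {x y z : V} (hx : ∀ v, G.Adj x v ↔ v = y ∨ v = z) (hzy : z ≠ y) (hnzy : ¬ G.Adj z y)
    {Y Z : Finset V} (hY : ∀ v, v ∈ Y ↔ G.Adj y v)
    (hZ : ∀ v, G.Adj y v → G.Adj z v → v ≠ x → v ∈ Z) :
    Y.card < 4 + 2 * Z.card := by
  classical
  have hxy : G.Adj x y := (hx y).2 (Or.inl rfl)
  have hxz : G.Adj x z := (hx z).2 (Or.inr rfl)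
  have hX : ∀ v, v ∈ ({y, z} : Finset V) ↔ G.Adj x v := fun v => by simp [hx]
  have d1 : G.dist3 x z = 1 := dist3_eq_one.2 hxz
  have d2 : G.dist3 z y = 2 := dist3_eq_two hzy hnzy hxz.symm hxy
  have d3 : G.dist3 x y = 1 := dist3_eq_one.2 hxy
  -- The potential is the distance to the edge `xz`.
  set g : V → ℤ := fun v => min ((G.dist3 x v : ℤ) + 0) ((G.dist3 z v : ℤ) + 0) with hg
  have gx : g x = 0 := by simp [hg, dist3_self]
  have gy : g y = 1 := by simp [hg, d2, d3]
  have gz : g z = 0 := by simp [hg, dist3_self]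
  have key := hpos.sum_lt_min hG hxy hX hY x z 0 0 g (fun v => rfl) (by rw [gx, gy]; norm_num)
  rw [Finset.card_pair hzy.symm, Finset.sum_pair hzy.symm, gy, gz] at key
  have hlow : ∀ v ∈ Y, (2 : ℤ) - (if v ∈ Z then 1 else 0) - (if v = x then 2 else 0) ≤ g v := by
    intro v hv
    have hyv := (hY v).1 hv
    by_cases hvx : v = x
    · subst hvx; rw [gx]; split_ifs <;> simp_all
    · have hvz : v ≠ z := by rintro rfl; exact hnzy hyv.symm
      have e1 : 2 ≤ G.dist3 x v := two_le_dist3 (Ne.symm hvx) (by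
        rw [hx]; rintro (rfl | rfl)
        · exact G.loopless.irrefl _ hyv
        · exact hvz rfl)
      have e2 : 1 ≤ G.dist3 z v := one_le_dist3 hvz.symm
      by_cases hzv : G.Adj z v
      · simp only [hZ v hyv hzv hvx, hvx, if_true, if_false, hg]; omega
      · have e3 := two_le_dist3 hvz.symm hzv
        simp only [hvx, if_false, hg]
        split_ifs <;> omega
  have hs := Finset.sum_le_sum hlow
  have hxY : x ∈ Y := (hY x).2 hxy.symm
  have hc : ∑ v ∈ Y, (if v ∈ Z then (1 : ℤ) else 0) ≤ Z.card := by
    rw [Finset.sum_boole]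
    exact_mod_cast Finset.card_le_card fun v hv => (Finset.mem_filter.1 hv).2
  simp only [Finset.sum_sub_distrib, Finset.sum_const, nsmul_eq_mul, Finset.sum_ite_eq', hxY,
    if_true] at hs
  push_cast at key
  omega

section Cubic

variable {x y a₁ a₂ b₁ b₂ : V}

/-- Duality at an edge between vertices of degree three. -/
lemma HasPositiveLLYCurvature.cubic_sum_lt (hG : G.Connected) (hpos : G.HasPositiveLLYCurvature)
    (hx : ∀ v, G.Adj x v ↔ v = y ∨ v = a₁ ∨ v = a₂) (hy : ∀ v, G.Adj y v ↔ v = x ∨ v = b₁ ∨ v = b₂)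
    (ha₁ : y ≠ a₁) (ha₂ : y ≠ a₂) (ha : a₁ ≠ a₂) (hb₁ : x ≠ b₁) (hb₂ : x ≠ b₂) (hb : b₁ ≠ b₂)
    (p q : V) (s t : ℤ) (g : V → ℤ)
    (hg : ∀ v, g v = min ((G.dist3 p v : ℤ) + s) ((G.dist3 q v : ℤ) + t))
    (hgxy : g y = g x + 1) : g b₁ + g b₂ < 4 + g a₁ + g a₂ := by
  classical
  have hX : ∀ v, v ∈ ({y, a₁, a₂} : Finset V) ↔ G.Adj x v := fun v => by simp [hx]
  have hY : ∀ v, v ∈ ({x, b₁, b₂} : Finset V) ↔ G.Adj y v := fun v => by simp [hy]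
  have key := hpos.sum_lt_min hG ((hx y).2 (Or.inl rfl)) hX hY p q s t g hg hgxy
  have cX : ({y, a₁, a₂} : Finset V).card = 3 := Finset.card_eq_three.2 ⟨_, _, _, ha₁, ha₂, ha, rfl⟩
  have cY : ({x, b₁, b₂} : Finset V).card = 3 := Finset.card_eq_three.2 ⟨_, _, _, hb₁, hb₂, hb, rfl⟩
  rw [cX, cY, Finset.sum_insert (by simp [hb₁, hb₂]), Finset.sum_pair hb,
    Finset.sum_insert (by simp [ha₁, ha₂]), Finset.sum_pair ha] at key
  push_cast at key
  omega

/-- The case of `HasPositiveLLYCurvature.cubic` in which some pair is adjacent. Both matchings cost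
at least four, so the other pair is at distance three; the potential is a minimum of shifted
distances to `a₁` and `a₂`, or the distance to `a₂` if `a₁` and `b₂` are adjacent. -/
lemma HasPositiveLLYCurvature.cubic_aux (hG : G.Connected) (hpos : G.HasPositiveLLYCurvature)
    (hx : ∀ v, G.Adj x v ↔ v = y ∨ v = a₁ ∨ v = a₂) (hy : ∀ v, G.Adj y v ↔ v = x ∨ v = b₁ ∨ v = b₂)
    (ha₁ : y ≠ a₁) (ha₂ : y ≠ a₂) (ha : a₁ ≠ a₂) (hb₁ : x ≠ b₁) (hb₂ : x ≠ b₂) (hb : b₁ ≠ b₂)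
    (h11 : G.dist3 a₁ b₁ = 1) (h22 : G.dist3 a₂ b₂ = 3)
    (h : 4 ≤ G.dist3 a₁ b₂ + G.dist3 a₂ b₁) : False := by
  have l1 := G.dist3_le_three a₁ b₂
  have l2 := G.dist3_le_three a₂ b₁
  have n : ∀ {a b}, 1 ≤ G.dist3 a b → a ≠ b := fun h e => by
    rw [dist3_eq_zero.2 e] at h; omega
  have nay : ∀ a, G.Adj x a → a ≠ b₁ → a ≠ b₂ → ¬ G.Adj a y := fun a h1 h2 h3 h4 => by
    rcases (hy a).1 h4.symm with rfl | rfl | rfl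
    · exact G.loopless.irrefl _ h1
    · exact h2 rfl
    · exact h3 rfl
  have adjxy : G.Adj x y := (hx y).2 (Or.inl rfl)
  have adj1 : G.Adj x a₁ := (hx a₁).2 (by simp)
  have adj2 : G.Adj x a₂ := (hx a₂).2 (by simp)
  have d1x : G.dist3 a₁ x = 1 := dist3_eq_one.2 adj1.symm
  have d2x : G.dist3 a₂ x = 1 := dist3_eq_one.2 adj2.symm
  have d1y : G.dist3 a₁ y = 2 := dist3_eq_two ha₁.symm
    (nay a₁ adj1 (n (by omega)) (n (by omega))) adj1.symm adjxy
  have d2y : G.dist3 a₂ y = 2 := dist3_eq_two ha₂.symm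
    (nay a₂ adj2 (n (by omega)) (n (by omega))) adj2.symm adjxy
  have s1 := G.dist3_self a₁
  have s2 := G.dist3_self a₂
  have c := G.dist3_comm a₁ a₂
  have p1 : 1 ≤ G.dist3 a₁ a₂ := one_le_dist3 ha
  have p2 : G.dist3 a₁ a₂ ≤ 2 := dist3_le_two.2 (Or.inr (Or.inr ⟨x, adj1.symm, adj2⟩))
  have t1 := G.dist3_triangle a₂ a₁ b₂
  by_cases hA : 2 ≤ G.dist3 a₁ b₂ ∧ 2 ≤ G.dist3 a₂ b₁
  · have := hpos.cubic_sum_lt hG hx hy ha₁ ha₂ ha hb₁ hb₂ hb a₁ a₂ 0 (-1) _ (fun v => rfl)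
      (by omega)
    omega
  by_cases hB : G.dist3 a₁ b₂ ≤ 1
  · have := hpos.cubic_sum_lt hG hx hy ha₁ ha₂ ha hb₁ hb₂ hb a₂ a₂ (-1) (-1) _ (fun v => rfl)
      (by omega)
    omega
  · have := hpos.cubic_sum_lt hG hx hy ha₁ ha₂ ha hb₁ hb₂ hb a₁ a₂ (-1) (-1) _ (fun v => rfl)
      (by omega)
    omega

/-- Along an edge of positive curvature between two vertices of degree three, the remaining
neighbours can be matched at total cost at most three. -/
lemma HasPositiveLLYCurvature.cubic (hG : G.Connected) (hpos : G.HasPositiveLLYCurvature)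
    (hx : ∀ v, G.Adj x v ↔ v = y ∨ v = a₁ ∨ v = a₂) (hy : ∀ v, G.Adj y v ↔ v = x ∨ v = b₁ ∨ v = b₂)
    (ha₁ : y ≠ a₁) (ha₂ : y ≠ a₂) (ha : a₁ ≠ a₂) (hb₁ : x ≠ b₁) (hb₂ : x ≠ b₂) (hb : b₁ ≠ b₂) :
    G.dist3 a₁ b₁ + G.dist3 a₂ b₂ ≤ 3 ∨ G.dist3 a₁ b₂ + G.dist3 a₂ b₁ ≤ 3 := by
  by_contra hcon
  push Not at hcon
  obtain ⟨h1, h2⟩ := hcon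
  have l11 := G.dist3_le_three a₁ b₁
  have l12 := G.dist3_le_three a₁ b₂
  have l21 := G.dist3_le_three a₂ b₁
  have l22 := G.dist3_le_three a₂ b₂
  have hx' : ∀ v, G.Adj x v ↔ v = y ∨ v = a₂ ∨ v = a₁ := fun v => by rw [hx]; tauto
  have hy' : ∀ v, G.Adj y v ↔ v = x ∨ v = b₂ ∨ v = b₁ := fun v => by rw [hy]; tauto
  by_cases e11 : G.dist3 a₁ b₁ = 1
  · exact hpos.cubic_aux hG hx hy ha₁ ha₂ ha hb₁ hb₂ hb e11 (by omega) (by omega)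
  by_cases e22 : G.dist3 a₂ b₂ = 1
  · exact hpos.cubic_aux hG hx' hy' ha₂ ha₁ ha.symm hb₂ hb₁ hb.symm e22 (by omega) (by omega)
  by_cases e12 : G.dist3 a₁ b₂ = 1
  · exact hpos.cubic_aux hG hx hy' ha₁ ha₂ ha hb₂ hb₁ hb.symm e12 (by omega) (by omega)
  by_cases e21 : G.dist3 a₂ b₁ = 1
  · exact hpos.cubic_aux hG hx' hy ha₂ ha₁ ha.symm hb₁ hb₂ hb e21 (by omega) (by omega)
  have n : ∀ {a b}, 1 ≤ G.dist3 a b → a ≠ b := fun h e => by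
    rw [dist3_eq_zero.2 e] at h; omega
  have nay : ∀ a, G.Adj x a → a ≠ b₁ → a ≠ b₂ → ¬ G.Adj a y := fun a h1 h2 h3 h4 => by
    rcases (hy a).1 h4.symm with rfl | rfl | rfl
    · exact G.loopless.irrefl _ h1
    · exact h2 rfl
    · exact h3 rfl
  have adjxy : G.Adj x y := (hx y).2 (Or.inl rfl)
  have adj1 : G.Adj x a₁ := (hx a₁).2 (by simp)
  have adj2 : G.Adj x a₂ := (hx a₂).2 (by simp)
  have d1x : G.dist3 a₁ x = 1 := dist3_eq_one.2 adj1.symm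
  have d2x : G.dist3 a₂ x = 1 := dist3_eq_one.2 adj2.symm
  have d1y : G.dist3 a₁ y = 2 := dist3_eq_two ha₁.symm
    (nay a₁ adj1 (n (by omega)) (n (by omega))) adj1.symm adjxy
  have d2y : G.dist3 a₂ y = 2 := dist3_eq_two ha₂.symm
    (nay a₂ adj2 (n (by omega)) (n (by omega))) adj2.symm adjxy
  have s1 := G.dist3_self a₁
  have s2 := G.dist3_self a₂
  -- No pair is adjacent, so both `b₁` and `b₂` are at distance at least two from `{a₁, a₂}`.
  have := hpos.cubic_sum_lt hG hx hy ha₁ ha₂ ha hb₁ hb₂ hb a₁ a₂ (-1) (-1) _ (fun v => rfl)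
    (by omega)
  omega

end Cubic

end EdgeConditions

/-! ### Branches and leaves of trees -/

section Branches

variable {V : Type*} {T : SimpleGraph V}

/-- The first step of the path from `x` to `v` is unique. -/
lemma IsTree.closer_unique (hT : T.IsTree) {x v w w' : V} (h : T.Adj x w) (h' : T.Adj x w')
    (hd : T.dist v x = T.dist v w + 1) (hd' : T.dist v x = T.dist v w' + 1) : w = w' := by
  obtain ⟨p, hp⟩ := hT.1.exists_walk_length_eq_dist w v
  obtain ⟨p', hp'⟩ := hT.1.exists_walk_length_eq_dist w' v
  have i : (Walk.cons h p).IsPath := Walk.isPath_of_length_eq_dist _ (by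
    rw [Walk.length_cons, hp, dist_comm, ← hd, dist_comm])
  have i' : (Walk.cons h' p').IsPath := Walk.isPath_of_length_eq_dist _ (by
    rw [Walk.length_cons, hp', dist_comm, ← hd', dist_comm])
  have e := congrArg Subtype.val ((hT.2.subsingleton_path x v).elim ⟨_, i⟩ ⟨_, i'⟩)
  simp only [Walk.cons.injEq] at e
  exact e.1

lemma Connected.exists_closer (hT : T.Connected) {x v : V} (h : x ≠ v) :
    ∃ w, T.Adj x w ∧ T.dist v x = T.dist v w + 1 := by
  obtain ⟨p, hp⟩ := hT.exists_walk_length_eq_dist x v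
  cases p with
  | nil => exact absurd rfl h
  | @cons _ w _ hxw p =>
    refine ⟨w, hxw, ?_⟩
    rw [Walk.length_cons] at hp
    have h1 := dist_le p
    have h2 : T.dist v x ≤ T.dist v w + T.dist w x := hT.dist_triangle
    rw [dist_eq_one_iff_adj.2 hxw.symm] at h2
    have h3 := T.dist_comm (u := x) (v := v)
    have h4 := T.dist_comm (u := w) (v := v)
    omega

/-- A tree is bipartite. -/
lemma IsTree.dist_adj (hT : T.IsTree) {x y : V} (h : T.Adj x y) (v : V) :
    T.dist v x = T.dist v y + 1 ∨ T.dist v y = T.dist v x + 1 := by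
  have h1 : T.dist v x ≤ T.dist v y + T.dist y x := hT.1.dist_triangle
  have h2 : T.dist v y ≤ T.dist v x + T.dist x y := hT.1.dist_triangle
  rw [dist_eq_one_iff_adj.2 h] at h2
  rw [dist_eq_one_iff_adj.2 h.symm] at h1
  by_contra hcon
  have he : T.dist v x = T.dist v y := by omega
  have hxv : x ≠ v := by
    rintro rfl
    rw [dist_self, eq_comm, dist_eq_one_iff_adj.2 h] at he
    omega
  -- The predecessor of `x` on the way to `v` is closer to `v` than `x`, and so is that of `y`.
  -- This gives two different paths from `x` to `v`.
  obtain ⟨w, hw, hdw⟩ := hT.1.exists_closer hxv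
  obtain ⟨p, hp⟩ := hT.1.exists_walk_length_eq_dist x v
  obtain ⟨q, hq⟩ := hT.1.exists_walk_length_eq_dist y v
  have ip := Walk.isPath_of_length_eq_dist p hp
  have iq := Walk.isPath_of_length_eq_dist q hq
  have hx : x ∉ q.support := by
    intro hx
    classical
    have h3 := dist_le (q.dropUntil x hx)
    have h4 : (q.takeUntil x hx).length + (q.dropUntil x hx).length = q.length := by
      rw [← Walk.length_append, Walk.take_spec]
    have h5 : (q.takeUntil x hx).length ≠ 0 := fun h0 => h.ne (Walk.eq_of_length_eq_zero h0).symm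
    have h6 := T.dist_comm (u := x) (v := v)
    have h7 := T.dist_comm (u := y) (v := v)
    omega
  have e := congrArg (fun r => r.1.length)
    ((hT.2.subsingleton_path x v).elim ⟨p, ip⟩ ⟨_, (Walk.cons_isPath_iff h q).2 ⟨iq, hx⟩⟩)
  simp only [Walk.length_cons] at e
  have h6 := T.dist_comm (u := x) (v := v)
  have h7 := T.dist_comm (u := y) (v := v)
  omega

/-- The branch of a tree `T` behind the edge from `x` to `y`: the vertices that are closer to `y`
than to `x`, that is, the component of `y` after removal of the edge. -/
def branch (T : SimpleGraph V) (x y : V) : Set V := {v | T.dist v x = T.dist v y + 1}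

lemma right_mem_branch {x y : V} (h : T.Adj x y) : y ∈ T.branch x y := by
  simp [branch, dist_eq_one_iff_adj.2 h.symm]

lemma left_notMem_branch {x y : V} : x ∉ T.branch x y := by
  simp [branch]

lemma IsTree.mem_branch_swap (hT : T.IsTree) {x y : V} (h : T.Adj x y) {v : V} :
    v ∈ T.branch y x ↔ v ∉ T.branch x y := by
  have := hT.dist_adj h v
  simp only [branch, Set.mem_ofPred_eq]; omega

lemma IsTree.branch_disjoint (hT : T.IsTree) {x w w' v : V} (h : T.Adj x w) (h' : T.Adj x w')
    (hv : v ∈ T.branch x w) (hv' : v ∈ T.branch x w') : w = w' :=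
  hT.closer_unique h h' hv hv'

lemma Connected.exists_mem_branch (hT : T.Connected) {x v : V} (h : x ≠ v) :
    ∃ w, T.Adj x w ∧ v ∈ T.branch x w := hT.exists_closer h

/-- The edge between `x` and `y` is the only one that leaves the branch behind it. -/
lemma IsTree.eq_of_leave_branch (hT : T.IsTree) {x y u v : V} (h : T.Adj x y) (huv : T.Adj u v)
    (hu : u ∈ T.branch x y) (hv : v ∉ T.branch x y) : u = y ∧ v = x := by
  have hv' := (hT.mem_branch_swap h).2 hv
  simp only [branch, Set.mem_ofPred_eq] at hu hv'
  have a1 := hT.dist_adj huv x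
  have a2 := hT.dist_adj huv y
  have c1 := T.dist_comm (u := x) (v := u)
  have c2 := T.dist_comm (u := x) (v := v)
  have c3 := T.dist_comm (u := y) (v := u)
  have c4 := T.dist_comm (u := y) (v := v)
  have hvu : T.dist v x = T.dist u y := by omega
  by_cases h0 : v = x
  · subst h0
    rw [dist_self, eq_comm] at hvu
    exact ⟨(hT.1.dist_eq_zero_iff).1 hvu, rfl⟩
  · exfalso
    obtain ⟨w, hw, hd⟩ := hT.1.exists_closer h0
    have b1 := hT.dist_adj hw y
    have b2 : T.dist y w ≤ T.dist y x + T.dist x w := hT.1.dist_triangle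
    rw [dist_eq_one_iff_adj.2 h.symm] at b2
    have : w = u := hT.closer_unique (v := y) hw huv.symm (by omega) (by omega)
    subst this
    omega

lemma IsTree.branch_subset (hT : T.IsTree) {x y w : V} (h : T.Adj x y) (hw : T.Adj y w)
    (hwx : w ≠ x) : T.branch y w ⊆ T.branch x y := by
  intro v hv
  by_contra hc
  exact hwx (hT.branch_disjoint hw h.symm hv ((hT.mem_branch_swap h).2 hc))

/-- A vertex set closed under adjacency is everything in a connected graph. -/
lemma Connected.forall_mem (hT : T.Connected) {S : Set V} {x : V} (hx : x ∈ S)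
    (hS : ∀ u ∈ S, ∀ v, T.Adj u v → v ∈ S) (v : V) : v ∈ S := by
  obtain ⟨p⟩ := hT.preconnected x v
  induction p with
  | nil => exact hx
  | cons h p ih => exact ih (hS _ hx _ h)

variable [Fintype V]

open Classical in
lemma isLeaf_iff {v : V} : T.IsLeaf v ↔ ∃ w, ∀ u, T.Adj v u ↔ u = w := by
  unfold IsLeaf
  rw [degree_eq_one_iff_existsUnique_adj]
  constructor
  · rintro ⟨w, hw, hu⟩
    exact ⟨w, fun u => ⟨hu u, fun e => e ▸ hw⟩⟩
  · rintro ⟨w, hw⟩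
    exact ⟨w, (hw w).2 rfl, fun u hu => (hw u).1 hu⟩

lemma IsLeaf.eq {v u w : V} (h : T.IsLeaf v) (hu : T.Adj v u) (hw : T.Adj v w) : u = w := by
  obtain ⟨z, hz⟩ := isLeaf_iff.1 h
  rw [(hz u).1 hu, (hz w).1 hw]

lemma exists_adj_ne {x y : V} (h : T.Adj x y) (hx : ¬ T.IsLeaf x) :
    ∃ w, T.Adj x w ∧ w ≠ y := by
  by_contra hcon
  push Not at hcon
  exact hx (isLeaf_iff.2 ⟨y, fun u => ⟨hcon u, fun e => e ▸ h⟩⟩)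

/-- Every branch contains a leaf: a vertex at maximal distance from its root. -/
lemma IsTree.exists_leaf_mem_branch (hT : T.IsTree) {x y : V} (h : T.Adj x y) :
    ∃ v ∈ T.branch x y, T.IsLeaf v := by
  obtain ⟨v, hv, hmax⟩ := Set.exists_max_image (T.branch x y) (fun v => T.dist x v)
    (Set.toFinite _) ⟨y, right_mem_branch h⟩
  refine ⟨v, hv, ?_⟩
  by_contra hl
  have hvx : v ≠ x := fun e => left_notMem_branch (e ▸ hv)
  obtain ⟨w, hw, hd⟩ := hT.1.exists_closer hvx
  obtain ⟨w', hw', hne⟩ := exists_adj_ne hw hl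
  have h1 : T.dist x w' = T.dist x v + 1 := by
    rcases hT.dist_adj hw' x with h2 | h2
    · exact absurd (hT.closer_unique hw' hw h2 hd) hne
    · exact h2
  by_cases hmem : w' ∈ T.branch x y
  · have := hmax w' hmem
    omega
  · obtain ⟨rfl, rfl⟩ := hT.eq_of_leave_branch h hw' hv hmem
    simp at h1

end Branches

/-! ### The boundary walk of an embedded tree -/

section FaceWalk

variable {V : Type*} {T : SimpleGraph V}

namespace RotationSystem

variable (R : T.RotationSystem)

lemma fst_faceStep (d : T.Dart) : (R.faceStep d).fst = d.snd := by
  rw [faceStep, R.fst_rot]; rfl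

lemma faceStep_injective : Function.Injective R.faceStep :=
  R.rot.injective.comp Dart.symm_involutive.injective

lemma fst_iterate_faceStep (d : T.Dart) (j : ℕ) :
    (R.faceStep^[j + 1] d).fst = (R.faceStep^[j] d).snd := by
  rw [Function.iterate_succ_apply', fst_faceStep]

lemma exists_iterate_faceStep [Finite V] (d : T.Dart) : ∃ n, R.faceStep^[n + 1] d = d := by
  have : Finite T.Dart := Finite.of_injective (fun d => d.toProd) fun a b h => Dart.ext _ _ h
  let φ : Equiv.Perm T.Dart :=
    Equiv.ofBijective _ (Finite.injective_iff_bijective.1 R.faceStep_injective)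
  have hpos := orderOf_pos φ
  refine ⟨orderOf φ - 1, ?_⟩
  have h : (φ ^ orderOf φ) d = d := by rw [pow_orderOf_eq_one]; rfl
  rw [Nat.sub_add_cancel hpos]
  rw [← Equiv.Perm.iterate_eq_pow] at h
  exact h

/-- The walk cannot leave a branch except through its edge. -/
lemma exists_leave (hT : T.IsTree) {x y : V} (h : T.Adj x y) (d : T.Dart) (k : ℕ)
    (hd : d.fst ∈ T.branch x y) (hk : (R.faceStep^[k] d).snd ∉ T.branch x y) :
    ∃ j ≤ k, R.faceStep^[j] d = ⟨(y, x), h.symm⟩ := by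
  induction k generalizing d with
  | zero =>
    refine ⟨0, le_rfl, ?_⟩
    obtain ⟨h1, h2⟩ := hT.eq_of_leave_branch h d.adj hd hk
    exact Dart.ext _ _ (Prod.ext h1 h2)
  | succ k ih =>
    by_cases h1 : d.snd ∈ T.branch x y
    · obtain ⟨j, hj, e⟩ := ih (R.faceStep d) (by rw [fst_faceStep]; exact h1) hk
      exact ⟨j + 1, by omega, e⟩
    · obtain ⟨h2, h3⟩ := hT.eq_of_leave_branch h d.adj hd h1
      exact ⟨0, by omega, Dart.ext _ _ (Prod.ext h2 h3)⟩

/-- The walk returns along each dart: it enters the branch behind `d` and has to leave it again in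
order to be periodic. -/
lemma exists_iterate_eq_symm [Finite V] (hT : T.IsTree) (d : T.Dart) :
    ∃ j, R.faceStep^[j] d = d.symm := by
  obtain ⟨n, hn⟩ := R.exists_iterate_faceStep d
  have hl : (R.faceStep^[n] d).snd ∉ T.branch d.fst d.snd := by
    rw [← fst_iterate_faceStep, hn]; exact left_notMem_branch
  cases n with
  | zero => exact absurd (right_mem_branch d.adj) hl
  | succ n =>
    obtain ⟨j, -, e⟩ := R.exists_leave hT d.adj (R.faceStep d) n
      (by rw [fst_faceStep]; exact right_mem_branch d.adj) hl
    exact ⟨j + 1, e⟩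

/-- A tree has a single face: its boundary walk runs through all darts. -/
lemma exists_iterate_eq [Finite V] (hT : T.IsTree) (d e : T.Dart) :
    ∃ j, R.faceStep^[j] d = e := by
  have trans : ∀ {a b c : T.Dart}, (∃ j, R.faceStep^[j] a = b) → (∃ j, R.faceStep^[j] b = c) →
      ∃ j, R.faceStep^[j] a = c := by
    rintro a b c ⟨j, rfl⟩ ⟨k, rfl⟩
    exact ⟨k + j, Function.iterate_add_apply _ _ _ _⟩
  have rot : ∀ a b : T.Dart, a.fst = b.fst → ∃ j, R.faceStep^[j] a = b := by
    intro a b hab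
    have : Finite T.Dart := Finite.of_injective (fun d => d.toProd) fun a b h => Dart.ext _ _ h
    obtain ⟨n, -, rfl⟩ := (R.sameCycle a b hab).exists_pow_eq'
    clear hab
    induction n with
    | zero => exact ⟨0, rfl⟩
    | succ n ih =>
      refine trans ih (trans (R.exists_iterate_eq_symm hT _) ⟨1, ?_⟩)
      rw [pow_succ', Equiv.Perm.mul_apply, Function.iterate_one, faceStep, Dart.symm_symm]
  have hall : ∀ v, ∀ e : T.Dart, e.fst = v → ∃ j, R.faceStep^[j] d = e := by
    refine hT.1.forall_mem (S := {v | ∀ e : T.Dart, e.fst = v → ∃ j, R.faceStep^[j] d = e})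
      (x := d.fst) (fun e he => rot d e he.symm) ?_
    intro u hu v huv e he
    exact trans (hu ⟨(u, v), huv⟩ rfl) (trans (R.exists_iterate_eq_symm hT _) (rot _ _ he.symm))
  exact hall e.fst e rfl

variable [Fintype V]

lemma dart_ext_of_isLeaf {d e : T.Dart} (hd : T.IsLeaf d.fst) (h : d.fst = e.fst) : d = e :=
  Dart.ext _ _ (Prod.ext h (hd.eq d.adj (h ▸ e.adj)))

/-- The stretches of the boundary walk between consecutive leaves are disjoint. -/
lemma eq_of_iterate_eq {d d' : T.Dart} {k k' j j' : ℕ} (hd : T.IsLeaf d.fst)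
    (hd' : T.IsLeaf d'.fst) (hk : ∀ i < k, ¬ T.IsLeaf (R.faceStep^[i] d).snd)
    (hk' : ∀ i < k', ¬ T.IsLeaf (R.faceStep^[i] d').snd) (hj : j ≤ k) (hj' : j' ≤ k')
    (h : R.faceStep^[j] d = R.faceStep^[j'] d') : d = d' := by
  wlog hjj : j ≤ j' generalizing d d' k k' j j'
  · exact (this hd' hd hk' hk hj' hj h.symm (by omega)).symm
  obtain ⟨m, rfl⟩ := Nat.exists_eq_add_of_le hjj
  rw [Function.iterate_add_apply] at h
  have h := R.faceStep_injective.iterate j h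
  cases m with
  | zero => exact h
  | succ m =>
    refine absurd ?_ (hk' m (by omega))
    rw [← fst_iterate_faceStep, ← h]; exact hd

lemma exists_nextLeaf {u : V} (hu : T.IsLeaf u) : ∃ v, R.NextLeaf u v := by
  classical
  obtain ⟨w, hw⟩ := isLeaf_iff.1 hu
  let d : T.Dart := ⟨(u, w), (hw w).2 rfl⟩
  obtain ⟨n, hn⟩ := R.exists_iterate_faceStep d
  have hex : ∃ k, T.IsLeaf (R.faceStep^[k] d).snd :=
    ⟨n, by rw [← fst_iterate_faceStep, hn]; exact hu⟩
  exact ⟨_, hu, Nat.find_spec hex, d, rfl, Nat.find hex, rfl, fun j hj => Nat.find_min hex hj⟩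

lemma NextLeaf.unique {R : T.RotationSystem} {u v v' : V} (h : R.NextLeaf u v)
    (h' : R.NextLeaf u v') : v = v' := by
  obtain ⟨hu, hv, d, rfl, k, rfl, hk⟩ := h
  obtain ⟨-, hv', d', hd', k', rfl, hk'⟩ := h'
  obtain rfl := dart_ext_of_isLeaf hu hd'.symm
  rcases lt_trichotomy k k' with h | rfl | h
  · exact absurd hv (hk' _ h)
  · rfl
  · exact absurd hv' (hk _ h)

lemma NextLeaf.injective {R : T.RotationSystem} {u u' v : V} (h : R.NextLeaf u v)
    (h' : R.NextLeaf u' v) : u = u' := by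
  obtain ⟨hu, hv, d, rfl, k, rfl, hk⟩ := h
  obtain ⟨hu', -, d', rfl, k', he, hk'⟩ := h'
  have hs : (R.faceStep^[k] d).symm = (R.faceStep^[k'] d').symm :=
    dart_ext_of_isLeaf hv he.symm
  rw [R.eq_of_iterate_eq hu hu' hk hk' le_rfl le_rfl (Dart.symm_involutive.injective hs)]

/-- At most one leaf of a branch has its successor outside. -/
lemma NextLeaf.eq_of_leave {R : T.RotationSystem} (hT : T.IsTree) {x y u u' v v' : V}
    (hxy : T.Adj x y) (h : R.NextLeaf u v) (h' : R.NextLeaf u' v') (hu : u ∈ T.branch x y)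
    (hu' : u' ∈ T.branch x y) (hv : v ∉ T.branch x y) (hv' : v' ∉ T.branch x y) : u = u' := by
  obtain ⟨lu, -, d, rfl, k, rfl, hk⟩ := h
  obtain ⟨lu', -, d', rfl, k', rfl, hk'⟩ := h'
  obtain ⟨j, hj, e⟩ := R.exists_leave hT hxy d k hu hv
  obtain ⟨j', hj', e'⟩ := R.exists_leave hT hxy d' k' hu' hv'
  rw [R.eq_of_iterate_eq lu lu' hk hk' hj hj' (e.trans e'.symm)]

/-- All leaves are reached from one leaf by repeated passage to the next leaf. -/
lemma forall_mem_of_nextLeaf (hT : T.IsTree) {S : Set V}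
    (hS : ∀ u v, R.NextLeaf u v → u ∈ S → v ∈ S) {u v : V} (hu : T.IsLeaf u) (hv : T.IsLeaf v)
    (h : u ∈ S) : v ∈ S := by
  obtain ⟨a, ha⟩ := isLeaf_iff.1 hu
  obtain ⟨b, hb⟩ := isLeaf_iff.1 hv
  have key : ∀ n, ∀ d e : T.Dart, T.IsLeaf d.fst → T.IsLeaf e.fst → d.fst ∈ S →
      R.faceStep^[n] d = e → e.fst ∈ S := by
    intro n
    induction n using Nat.strong_induction_on with
    | _ n ih =>
      intro d e hd he hdS hn
      obtain ⟨w, hw⟩ := R.exists_nextLeaf hd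
      have hwS := hS _ _ hw hdS
      obtain ⟨-, lw, d', hd', k, rfl, hk⟩ := hw
      obtain rfl := dart_ext_of_isLeaf hd hd'.symm
      rcases Nat.lt_or_ge k n with h1 | h1
      · obtain ⟨m, rfl⟩ := Nat.exists_eq_add_of_lt h1
        refine ih m (by omega) (R.faceStep^[k + 1] d) e ?_ he ?_ ?_
        · rwa [fst_iterate_faceStep]
        · rwa [fst_iterate_faceStep]
        · rw [← Function.iterate_add_apply, ← hn]; congr 1; omega
      · cases n with
        | zero => subst hn; exact hdS
        | succ n =>
          refine absurd ?_ (hk n (by omega))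
          rw [← fst_iterate_faceStep, hn]; exact he
  obtain ⟨n, hn⟩ := R.exists_iterate_eq hT ⟨(u, a), (ha a).2 rfl⟩ ⟨(v, b), (hb b).2 rfl⟩
  exact key n _ _ hu hv h hn

end RotationSystem

/-! ### Halin graphs in terms of the leaf permutation -/

/-- The vertex `c` has at least three neighbours. -/
def IsBranchVertex (T : SimpleGraph V) (c : V) : Prop := ∀ x y, ∃ z, T.Adj c z ∧ z ≠ x ∧ z ≠ y

/-- `G` is the tree `T` together with the cycle through the leaves of `T` that is given by the
permutation `σ`. That the cyclic order comes from a planar embedding is recorded as the condition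
that the leaves of every branch form an interval. -/
structure IsHalin (G T : SimpleGraph V) [Fintype V] (σ : Equiv.Perm V) : Prop where
  isTree : T.IsTree
  exists_isBranchVertex : ∃ c, T.IsBranchVertex c
  apply_isLeaf : ∀ u, T.IsLeaf u → T.IsLeaf (σ u)
  forall_mem : ∀ S : Set V, (∀ u ∈ S, T.IsLeaf u → σ u ∈ S) → ∀ u ∈ S, T.IsLeaf u →
    ∀ v, T.IsLeaf v → v ∈ S
  eq_of_leave : ∀ x y, T.Adj x y → ∀ u ∈ T.branch x y, ∀ u' ∈ T.branch x y, T.IsLeaf u →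
    T.IsLeaf u' → σ u ∉ T.branch x y → σ u' ∉ T.branch x y → u = u'
  adj_iff : ∀ a b, G.Adj a b ↔
    T.Adj a b ∨ (a ≠ b ∧ T.IsLeaf a ∧ T.IsLeaf b ∧ (σ a = b ∨ σ b = a))

variable [Fintype V]

open Classical in
lemma IsGeneralizedHalin.exists_isHalin {G : SimpleGraph V} (hG : G.IsGeneralizedHalin) :
    ∃ (T : SimpleGraph V) (σ : Equiv.Perm V), IsHalin G T σ := by
  obtain ⟨T, R, hT, hdeg, rfl⟩ := hG
  have hex : ∀ u, ∃ v, (T.IsLeaf u → R.NextLeaf u v) ∧ (¬ T.IsLeaf u → v = u) := by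
    intro u
    by_cases h : T.IsLeaf u
    · obtain ⟨v, hv⟩ := R.exists_nextLeaf h
      exact ⟨v, fun _ => hv, fun h' => absurd h h'⟩
    · exact ⟨u, fun h' => absurd h' h, fun _ => rfl⟩
  choose f hf hf' using hex
  have hinj : Function.Injective f := by
    intro u u' h
    by_cases hu : T.IsLeaf u <;> by_cases hu' : T.IsLeaf u'
    · exact (hf u hu).injective (h ▸ hf u' hu')
    · rw [hf' u' hu'] at h; exact absurd (h ▸ (hf u hu).2.1) hu'
    · rw [hf' u hu] at h; exact absurd (h ▸ (hf u' hu').2.1) hu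
    · rwa [hf' u hu, hf' u' hu'] at h
  have hnext : ∀ u v, R.NextLeaf u v ↔ T.IsLeaf u ∧ f u = v := fun u v =>
    ⟨fun h => ⟨h.1, (hf u h.1).unique h⟩, fun h => h.2 ▸ hf u h.1⟩
  refine ⟨T, Equiv.ofBijective f (Finite.injective_iff_bijective.1 hinj), hT, ?_,
    fun u hu => (hf u hu).2.1, ?_, ?_, ?_⟩
  · have : Nonempty V := hT.1.nonempty
    obtain ⟨c, hc⟩ := T.exists_maximal_degree_vertex
    refine ⟨c, fun x y => ?_⟩
    rw [hc, ← card_neighborFinset_eq_degree] at hdeg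
    have hlt : ({x, y} : Finset V).card < (T.neighborFinset c).card :=
      lt_of_le_of_lt Finset.card_le_two (by omega)
    obtain ⟨z, hz, hz'⟩ := Finset.exists_mem_notMem_of_card_lt_card hlt
    simp only [Finset.mem_insert, Finset.mem_singleton, not_or] at hz'
    exact ⟨z, by simpa using hz, hz'⟩
  · intro S hS u hu lu v lv
    refine R.forall_mem_of_nextLeaf hT (fun a b hab ha => ?_) lu lv hu
    have := (hnext a b).1 hab
    exact this.2 ▸ hS a ha this.1
  · intro x y hxy u hu u' hu' lu lu' hv hv'
    exact (hf u lu).eq_of_leave hT hxy (hf u' lu') hu hu' hv hv'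
  · intro a b
    simp only [sup_adj, RotationSystem.leafCycle, fromRel_adj, Equiv.ofBijective_apply, hnext]
    constructor
    · rintro (h | ⟨h, ⟨h1, h2⟩ | ⟨h1, h2⟩⟩)
      · exact Or.inl h
      · exact Or.inr ⟨h, h1, h2 ▸ (hf a h1).2.1, Or.inl h2⟩
      · exact Or.inr ⟨h, h2 ▸ (hf b h1).2.1, h1, Or.inr h2⟩
    · rintro (h | ⟨h, h1, h2, h3 | h3⟩)
      · exact Or.inl h
      · exact Or.inr ⟨h, Or.inl ⟨h1, h3⟩⟩
      · exact Or.inr ⟨h, Or.inr ⟨h2, h3⟩⟩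

end FaceWalk

/-! ### Isomorphisms onto the exceptional graphs -/

section Isomorphism

variable {V : Type*} {G : SimpleGraph V}

/-- An injective map that matches the neighbourhoods of corresponding vertices is an isomorphism
onto a connected graph; surjectivity need not be checked. -/
lemma Connected.nonempty_iso {W : Type*} {H : SimpleGraph W} (hG : G.Connected) (φ : W → V)
    (i₀ : W) (hφ : Function.Injective φ)
    (h : ∀ i w, G.Adj (φ i) w ↔ ∃ j, H.Adj i j ∧ w = φ j) : Nonempty (G ≃g H) := by
  have hsurj : Function.Surjective φ := fun v => by
    refine hG.forall_mem (S := Set.range φ) ⟨i₀, rfl⟩ ?_ v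
    rintro _ ⟨i, rfl⟩ w hw
    obtain ⟨j, -, rfl⟩ := (h i w).1 hw
    exact ⟨j, rfl⟩
  refine ⟨Iso.symm ⟨Equiv.ofBijective φ ⟨hφ, hsurj⟩, ?_⟩⟩
  intro i j
  change G.Adj (φ i) (φ j) ↔ H.Adj i j
  rw [h]
  constructor
  · rintro ⟨k, hk, e⟩
    rwa [hφ e]
  · exact fun hij => ⟨j, hij, rfl⟩

lemma Connected.nonempty_iso_list {l : List V} {H : SimpleGraph (Fin l.length)}
    (hG : G.Connected) (i₀ : Fin l.length) (hl : l.Nodup)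
    (h : ∀ i w, G.Adj (l.get i) w ↔ ∃ j, H.Adj i j ∧ w = l.get j) : Nonempty (G ≃g H) :=
  hG.nonempty_iso l.get i₀ (List.nodup_iff_injective_get.1 hl) h

lemma Connected.nonempty_iso_halinH1 (hG : G.Connected) {a b c d e f g : V}
    (hl : [a, b, c, d, e, f, g].Nodup)
    (ha : ∀ w, G.Adj a w ↔ w = b ∨ w = c ∨ w = d) (hb : ∀ w, G.Adj b w ↔ w = a ∨ w = e)
    (hc : ∀ w, G.Adj c w ↔ w = a ∨ w = f) (hd : ∀ w, G.Adj d w ↔ w = a ∨ w = g)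
    (he : ∀ w, G.Adj e w ↔ w = b ∨ w = f ∨ w = g) (hf : ∀ w, G.Adj f w ↔ w = c ∨ w = e ∨ w = g)
    (hg : ∀ w, G.Adj g w ↔ w = d ∨ w = e ∨ w = f) :
    Nonempty (G ≃g halinH1) := by
  refine hG.nonempty_iso_list (l := [a, b, c, d, e, f, g]) (H := halinH1) (0 : Fin 7) hl ?_
  intro i w
  change Fin 7 at i
  fin_cases i <;> simp [halinH1, Fin.exists_fin_succ, ha, hb, hc, hd, he, hf, hg]

lemma Connected.nonempty_iso_halinH2 (hG : G.Connected) {a b c d e f : V}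
    (hl : [a, b, c, d, e, f].Nodup)
    (ha : ∀ w, G.Adj a w ↔ w = b ∨ w = e ∨ w = f) (hb : ∀ w, G.Adj b w ↔ w = a ∨ w = c)
    (hc : ∀ w, G.Adj c w ↔ w = b ∨ w = d) (hd : ∀ w, G.Adj d w ↔ w = c ∨ w = e ∨ w = f)
    (he : ∀ w, G.Adj e w ↔ w = a ∨ w = d ∨ w = f) (hf : ∀ w, G.Adj f w ↔ w = a ∨ w = d ∨ w = e) :
    Nonempty (G ≃g halinH2) := by
  refine hG.nonempty_iso_list (l := [a, b, c, d, e, f]) (H := halinH2) (0 : Fin 6) hl ?_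
  intro i w
  change Fin 6 at i
  fin_cases i <;> simp [halinH2, Fin.exists_fin_succ, ha, hb, hc, hd, he, hf]

lemma Connected.nonempty_iso_halinH3 (hG : G.Connected) {a b c d e f : V}
    (hl : [a, b, c, d, e, f].Nodup)
    (ha : ∀ w, G.Adj a w ↔ w = b ∨ w = e ∨ w = f) (hb : ∀ w, G.Adj b w ↔ w = a ∨ w = c ∨ w = d)
    (hc : ∀ w, G.Adj c w ↔ w = b ∨ w = d ∨ w = f) (hd : ∀ w, G.Adj d w ↔ w = b ∨ w = c ∨ w = e)
    (he : ∀ w, G.Adj e w ↔ w = a ∨ w = d ∨ w = f) (hf : ∀ w, G.Adj f w ↔ w = a ∨ w = c ∨ w = e) :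
    Nonempty (G ≃g halinH3) := by
  refine hG.nonempty_iso_list (l := [a, b, c, d, e, f]) (H := halinH3) (0 : Fin 6) hl ?_
  intro i w
  change Fin 6 at i
  fin_cases i <;> simp [halinH3, Fin.exists_fin_succ, ha, hb, hc, hd, he, hf]

lemma Connected.nonempty_iso_halinH4 (hG : G.Connected) {a b c d e f g : V}
    (hl : [a, b, d, c, e, f, g].Nodup)
    (ha : ∀ w, G.Adj a w ↔ w = b ∨ w = f ∨ w = g) (hb : ∀ w, G.Adj b w ↔ w = a ∨ w = c ∨ w = d)
    (hc : ∀ w, G.Adj c w ↔ w = b ∨ w = e ∨ w = g) (hd : ∀ w, G.Adj d w ↔ w = b ∨ w = e)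
    (he : ∀ w, G.Adj e w ↔ w = c ∨ w = d ∨ w = f) (hf : ∀ w, G.Adj f w ↔ w = a ∨ w = e ∨ w = g)
    (hg : ∀ w, G.Adj g w ↔ w = a ∨ w = c ∨ w = f) :
    Nonempty (G ≃g halinH4) := by
  have hl : [a, b, c, d, e, f, g].Nodup :=
    (((List.Perm.swap c d _).cons b).cons a).nodup_iff.1 hl
  refine hG.nonempty_iso_list (l := [a, b, c, d, e, f, g]) (H := halinH4) (0 : Fin 7) hl ?_
  intro i w
  change Fin 7 at i
  fin_cases i <;> simp [halinH4, Fin.exists_fin_succ, ha, hb, hc, hd, he, hf, hg]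

lemma Connected.nonempty_iso_halinH5 (hG : G.Connected) {a b c d e f g : V}
    (hl : [a, b, c, d, e, f, g].Nodup)
    (ha : ∀ w, G.Adj a w ↔ w = b ∨ w = f ∨ w = g) (hb : ∀ w, G.Adj b w ↔ w = a ∨ w = c)
    (hc : ∀ w, G.Adj c w ↔ w = b ∨ w = d ∨ w = e) (hd : ∀ w, G.Adj d w ↔ w = c ∨ w = e ∨ w = g)
    (he : ∀ w, G.Adj e w ↔ w = c ∨ w = d ∨ w = f) (hf : ∀ w, G.Adj f w ↔ w = a ∨ w = e ∨ w = g)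
    (hg : ∀ w, G.Adj g w ↔ w = a ∨ w = d ∨ w = f) :
    Nonempty (G ≃g halinH5) := by
  refine hG.nonempty_iso_list (l := [a, b, c, d, e, f, g]) (H := halinH5) (0 : Fin 7) hl ?_
  intro i w
  change Fin 7 at i
  fin_cases i <;> simp [halinH5, Fin.exists_fin_succ, ha, hb, hc, hd, he, hf, hg]

lemma Connected.nonempty_iso_halinH6 (hG : G.Connected) {a b c d e f g : V}
    (hl : [a, b, c, d, e, f, g].Nodup)
    (ha : ∀ w, G.Adj a w ↔ w = b ∨ w = c ∨ w = f ∨ w = g) (hb : ∀ w, G.Adj b w ↔ w = a ∨ w = d)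
    (hc : ∀ w, G.Adj c w ↔ w = a ∨ w = e) (hd : ∀ w, G.Adj d w ↔ w = b ∨ w = e ∨ w = g)
    (he : ∀ w, G.Adj e w ↔ w = c ∨ w = d ∨ w = f) (hf : ∀ w, G.Adj f w ↔ w = a ∨ w = e ∨ w = g)
    (hg : ∀ w, G.Adj g w ↔ w = a ∨ w = d ∨ w = f) :
    Nonempty (G ≃g halinH6) := by
  refine hG.nonempty_iso_list (l := [a, b, c, d, e, f, g]) (H := halinH6) (0 : Fin 7) hl ?_
  intro i w
  change Fin 7 at i
  fin_cases i <;> simp [halinH6, Fin.exists_fin_succ, ha, hb, hc, hd, he, hf, hg]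

lemma Connected.nonempty_iso_halinH7 (hG : G.Connected) {a b c d e f g : V}
    (hl : [a, b, c, d, e, f, g].Nodup)
    (ha : ∀ w, G.Adj a w ↔ w = b ∨ w = e ∨ w = f ∨ w = g)
    (hb : ∀ w, G.Adj b w ↔ w = a ∨ w = c ∨ w = d) (hc : ∀ w, G.Adj c w ↔ w = b ∨ w = d ∨ w = g)
    (hd : ∀ w, G.Adj d w ↔ w = b ∨ w = c ∨ w = e) (he : ∀ w, G.Adj e w ↔ w = a ∨ w = d ∨ w = f)
    (hf : ∀ w, G.Adj f w ↔ w = a ∨ w = e ∨ w = g) (hg : ∀ w, G.Adj g w ↔ w = a ∨ w = c ∨ w = f) :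
    Nonempty (G ≃g halinH7) := by
  refine hG.nonempty_iso_list (l := [a, b, c, d, e, f, g]) (H := halinH7) (0 : Fin 7) hl ?_
  intro i w
  change Fin 7 at i
  fin_cases i <;> simp [halinH7, Fin.exists_fin_succ, ha, hb, hc, hd, he, hf, hg]

lemma Connected.nonempty_iso_halinH8 (hG : G.Connected) {a b c d e f g h : V}
    (hl : [a, b, h, c, d, e, f, g].Nodup)
    (ha : ∀ w, G.Adj a w ↔ w = b ∨ w = e ∨ w = g ∨ w = h)
    (hb : ∀ w, G.Adj b w ↔ w = a ∨ w = c ∨ w = d) (hc : ∀ w, G.Adj c w ↔ w = b ∨ w = d ∨ w = g)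
    (hd : ∀ w, G.Adj d w ↔ w = b ∨ w = c ∨ w = e) (he : ∀ w, G.Adj e w ↔ w = a ∨ w = d ∨ w = f)
    (hf : ∀ w, G.Adj f w ↔ w = e ∨ w = g ∨ w = h) (hg : ∀ w, G.Adj g w ↔ w = a ∨ w = c ∨ w = f)
    (hh : ∀ w, G.Adj h w ↔ w = a ∨ w = f) :
    Nonempty (G ≃g halinH8) := by
  have hl : [a, b, c, d, e, f, g, h].Nodup :=
    (((List.perm_append_comm (l₁ := [h]) (l₂ := [c, d, e, f, g])).cons b).cons a).nodup_iff.1 hl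
  refine hG.nonempty_iso_list (l := [a, b, c, d, e, f, g, h]) (H := halinH8) (0 : Fin 8) hl ?_
  intro i w
  change Fin 8 at i
  fin_cases i <;> simp [halinH8, Fin.exists_fin_succ, ha, hb, hc, hd, he, hf, hg, hh]

end Isomorphism

/-! ### Leaves and adjacency in Halin graphs -/

section HalinBasics

variable {V : Type*} [Fintype V] {G T : SimpleGraph V} {σ : Equiv.Perm V}

lemma IsBranchVertex.not_isLeaf {c : V} (h : T.IsBranchVertex c) : ¬ T.IsLeaf c := fun hl => by
  obtain ⟨a, ha, -⟩ := h c c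
  obtain ⟨b, hb, hne, -⟩ := h a a
  exact hne (hl.eq hb ha)

/-- A vertex is a leaf, or has exactly two neighbours, or has at least three. -/
lemma isLeaf_or {c z : V} (hz : T.Adj c z) :
    T.IsLeaf c ∨ (∃ a b, a ≠ b ∧ ∀ w, T.Adj c w ↔ w = a ∨ w = b) ∨ T.IsBranchVertex c := by
  by_cases hl : T.IsLeaf c
  · exact Or.inl hl
  obtain ⟨w, hw, hne⟩ := exists_adj_ne hz hl
  by_cases h : ∃ u, T.Adj c u ∧ u ≠ z ∧ u ≠ w
  · obtain ⟨u, hu, huz, huw⟩ := h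
    refine Or.inr (Or.inr fun x y => ?_)
    by_cases hx : z ≠ x ∧ z ≠ y
    · exact ⟨z, hz, hx⟩
    by_cases hx' : w ≠ x ∧ w ≠ y
    · exact ⟨w, hw, hx'⟩
    refine ⟨u, hu, ?_, ?_⟩ <;> rintro rfl <;> grind
  · refine Or.inr (Or.inl ⟨z, w, hne.symm, fun v => ⟨fun hv => ?_, ?_⟩⟩)
    · by_contra hc; push Not at hc; exact h ⟨v, hv, hc⟩
    · rintro (rfl | rfl) <;> assumption

/-- Besides any two vertices a tree with a vertex of degree at least three has another leaf. -/
lemma IsTree.exists_leaf_ne (hT : T.IsTree) {c : V} (hc : T.IsBranchVertex c) (u v : V) :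
    ∃ w, T.IsLeaf w ∧ w ≠ u ∧ w ≠ v := by
  have h : ∀ u, ∃ a, ∀ z, T.Adj c z → u ∈ T.branch c z → z = a := by
    intro u
    by_cases hu : c = u
    · subst hu; exact ⟨c, fun z _ h => absurd h left_notMem_branch⟩
    · obtain ⟨a, ha, hau⟩ := hT.1.exists_mem_branch hu
      exact ⟨a, fun z hz hzu => hT.branch_disjoint hz ha hzu hau⟩
  obtain ⟨a, ha⟩ := h u
  obtain ⟨b, hb⟩ := h v
  obtain ⟨z, hz, hza, hzb⟩ := hc a b
  obtain ⟨w, hw, hl⟩ := hT.exists_leaf_mem_branch hz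
  exact ⟨w, hl, fun e => hza (ha z hz (e ▸ hw)), fun e => hzb (hb z hz (e ▸ hw))⟩

/-- The branch at a vertex of degree at least three contains a leaf besides any given vertex. -/
lemma IsTree.exists_leaf_mem_branch_ne (hT : T.IsTree) {x y : V} (h : T.Adj x y)
    (hy : T.IsBranchVertex y) (u : V) : ∃ w ∈ T.branch x y, T.IsLeaf w ∧ w ≠ u := by
  obtain ⟨z, hz, hzx, -⟩ := hy x x
  obtain ⟨z', hz', hzx', hzz⟩ := hy x z
  obtain ⟨w, hw, hl⟩ := hT.exists_leaf_mem_branch hz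
  obtain ⟨w', hw', hl'⟩ := hT.exists_leaf_mem_branch hz'
  by_cases hwu : w = u
  · refine ⟨w', hT.branch_subset h hz' hzx' hw', hl', ?_⟩
    rintro rfl
    subst hwu
    exact hzz (hT.branch_disjoint hz' hz hw' hw)
  · exact ⟨w, hT.branch_subset h hz hzx hw, hl, hwu⟩

lemma nodup_append_of_isLeaf {l l' : List V} (h : l.Nodup) (h' : l'.Nodup)
    (hl : ∀ v ∈ l, ¬ T.IsLeaf v) (hl' : ∀ v ∈ l', T.IsLeaf v) : (l ++ l').Nodup :=
  h.append h' fun v hv hv' => hl v hv (hl' v hv')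

namespace IsHalin

variable (H : IsHalin G T σ)
include H

lemma le : T ≤ G := fun a b h => (H.adj_iff a b).2 (Or.inl h)

lemma connected : G.Connected := H.isTree.1.mono H.le

lemma isLeaf_symm {u : V} (hu : T.IsLeaf u) : T.IsLeaf (σ.symm u) := by
  obtain ⟨w, hw, rfl⟩ : ∃ w, T.IsLeaf w ∧ σ w = u :=
    H.forall_mem {v | ∃ w, T.IsLeaf w ∧ σ w = v} (fun v _ hv => ⟨v, hv, rfl⟩) (σ u)
      ⟨u, hu, rfl⟩ (H.apply_isLeaf u hu) u hu
  simpa using hw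

lemma apply_ne {u : V} (hu : T.IsLeaf u) : σ u ≠ u := fun h => by
  obtain ⟨c, hc⟩ := H.exists_isBranchVertex
  obtain ⟨w, hw, hne, -⟩ := H.isTree.exists_leaf_ne hc u u
  refine hne (H.forall_mem {u} ?_ u rfl hu w hw)
  rintro _ rfl _
  exact h

lemma apply_apply_ne {u : V} (hu : T.IsLeaf u) : σ (σ u) ≠ u := fun h => by
  obtain ⟨c, hc⟩ := H.exists_isBranchVertex
  obtain ⟨w, hw, hne, hne'⟩ := H.isTree.exists_leaf_ne hc u (σ u)
  have := H.forall_mem {u, σ u} ?_ u (by simp) hu w hw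
  · rcases this with h1 | h1
    exacts [hne h1, hne' h1]
  · rintro _ (rfl | rfl) _
    · simp
    · rw [h]; simp

lemma apply_ne_symm {u : V} (hu : T.IsLeaf u) : σ u ≠ σ.symm u := fun h =>
  H.apply_apply_ne hu (by rw [h, Equiv.apply_symm_apply])

lemma symm_ne {u : V} (hu : T.IsLeaf u) : σ.symm u ≠ u := fun h =>
  H.apply_ne hu (by conv_lhs => rw [← h]; rw [Equiv.apply_symm_apply])

lemma adj_of_not_isLeaf {v : V} (hv : ¬ T.IsLeaf v) (w : V) : G.Adj v w ↔ T.Adj v w := by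
  rw [H.adj_iff]; tauto

lemma adj_of_isLeaf {u p : V} (hu : T.IsLeaf u) (hp : T.Adj u p) (w : V) :
    G.Adj u w ↔ w = p ∨ w = σ u ∨ w = σ.symm u := by
  rw [H.adj_iff]
  constructor
  · rintro (h | ⟨-, -, -, h | h⟩)
    · exact Or.inl (hu.eq h hp)
    · exact Or.inr (Or.inl h.symm)
    · exact Or.inr (Or.inr (by rw [← h, Equiv.symm_apply_apply]))
  · rintro (rfl | rfl | rfl)
    · exact Or.inl hp
    · exact Or.inr ⟨(H.apply_ne hu).symm, hu, H.apply_isLeaf u hu, Or.inl rfl⟩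
    · exact Or.inr ⟨(H.symm_ne hu).symm, hu, H.isLeaf_symm hu, Or.inr (by simp)⟩

/-- The parent of a leaf is not a leaf. -/
lemma not_isLeaf_of_adj {u p : V} (hu : T.IsLeaf u) (hp : T.Adj u p) : ¬ T.IsLeaf p := fun hl => by
  obtain ⟨c, hc⟩ := H.exists_isBranchVertex
  obtain ⟨w, hw, hne, hne'⟩ := H.isTree.exists_leaf_ne hc u p
  have := H.isTree.1.forall_mem (S := {u, p}) (x := u) (by simp) ?_ w
  · rcases this with h1 | h1
    exacts [hne h1, hne' h1]
  · rintro _ (rfl | rfl) v hv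
    · exact Or.inr (hu.eq hv hp)
    · exact Or.inl (hl.eq hv hp.symm)

/-- The tree has no triangles. -/
lemma not_adj_of_adj {x y z : V} (hy : T.Adj x y) (hz : T.Adj x z) : ¬ T.Adj y z := fun h => by
  have h1 := H.isTree.dist_adj h x
  rw [dist_eq_one_iff_adj.2 hy, dist_eq_one_iff_adj.2 hz] at h1
  omega

/-- If there are only four leaves, the leaf cycle is determined by one successor up to the order of
the other two leaves. -/
lemma apply_of_four {a b c d : V} (la : T.IsLeaf a) (lb : T.IsLeaf b) (lc : T.IsLeaf c)
    (ld : T.IsLeaf d) (hac : a ≠ c) (had : a ≠ d) (hbc : b ≠ c) (hbd : b ≠ d) (hcd : c ≠ d)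
    (hleaf : ∀ v, T.IsLeaf v → v = a ∨ v = b ∨ v = c ∨ v = d) (h : σ a = b) :
    (σ b = c ∧ σ c = d ∧ σ d = a) ∨ (σ b = d ∧ σ d = c ∧ σ c = a) := by
  have sb := hleaf _ (H.apply_isLeaf b lb)
  have sc := hleaf _ (H.apply_isLeaf c lc)
  have sd := hleaf _ (H.apply_isLeaf d ld)
  have fb := H.apply_ne lb
  have fc := H.apply_ne lc
  have fd := H.apply_ne ld
  have ta := H.apply_apply_ne la
  have tc := H.apply_apply_ne lc
  have icd := σ.injective.ne hcd
  have ibc : σ b = σ c → b = c := fun h => σ.injective h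
  have ibd : σ b = σ d → b = d := fun h => σ.injective h
  have iac : σ a = σ c → a = c := fun h => σ.injective h
  have iad : σ a = σ d → a = d := fun h => σ.injective h
  clear hleaf H
  grind

end IsHalin

end HalinBasics

/-! ### Vertices of degree two -/

section DegreeTwo

variable {V : Type*} {G T : SimpleGraph V} {σ : Equiv.Perm V}

/-- A branch vertex with fewer than four neighbours has exactly three. -/
lemma IsBranchVertex.eq_of_card_lt {x y : V} (hy : T.IsBranchVertex y) (hyx : T.Adj y x)
    {Y : Finset V} (hY : ∀ v, v ∈ Y ↔ T.Adj y v) (hc : Y.card < 4) :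
    ∃ a b, a ≠ x ∧ b ≠ x ∧ b ≠ a ∧ ∀ v, T.Adj y v ↔ v = x ∨ v = a ∨ v = b := by
  classical
  obtain ⟨a, ha, hax, -⟩ := hy x x
  obtain ⟨b, hb, hbx, hba⟩ := hy x a
  refine ⟨a, b, hax, hbx, hba, fun v => ⟨fun hv => ?_, ?_⟩⟩
  · by_contra hcon
    push Not at hcon
    have hsub : ({v, x, a, b} : Finset V) ⊆ Y := by
      intro u hu
      simp only [Finset.mem_insert, Finset.mem_singleton] at hu
      rw [hY]
      rcases hu with rfl | rfl | rfl | rfl <;> assumption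
    have h4 : ({v, x, a, b} : Finset V).card = 4 := by
      rw [Finset.card_insert_of_notMem (by simp [hcon]), Finset.card_insert_of_notMem
        (by simp [hax.symm, hbx.symm]), Finset.card_pair hba.symm]
    have := Finset.card_le_card hsub
    omega
  · rintro (rfl | rfl | rfl) <;> assumption

variable [Fintype V]

lemma not_isLeaf_of_adj_iff {x a b : V} (hab : a ≠ b) (hx : ∀ v, T.Adj x v ↔ v = a ∨ v = b) :
    ¬ T.IsLeaf x := fun h =>
  hab (h.eq ((hx a).2 (Or.inl rfl)) ((hx b).2 (Or.inr rfl)))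

namespace IsHalin

variable (H : IsHalin G T σ)
include H

lemma adj_iff_of_two {x a b : V} (hab : a ≠ b) (hx : ∀ v, T.Adj x v ↔ v = a ∨ v = b) (v : V) :
    G.Adj x v ↔ v = a ∨ v = b := by
  rw [H.adj_of_not_isLeaf (not_isLeaf_of_adj_iff hab hx), hx]

/-- The path `x₀ x y y₀` ends in a leaf on one side only. Each further neighbour of `x₀` is close to
`y`, hence adjacent to `y₀` along the leaf cycle. -/
lemma nonempty_iso_halinH2_aux (hpos : G.HasPositiveLLYCurvature) {x y x₀ y₀ : V} (hx₀ : x₀ ≠ y)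
    (hy₀ : y₀ ≠ x) (hx : ∀ v, T.Adj x v ↔ v = y ∨ v = x₀) (hy : ∀ v, T.Adj y v ↔ v = x ∨ v = y₀)
    (lx₀ : ¬ T.IsLeaf x₀) (ly₀ : T.IsLeaf y₀) : Nonempty (G ≃g halinH2) := by
  have hxy : T.Adj x y := (hx y).2 (Or.inl rfl)
  have hxx₀ : T.Adj x x₀ := (hx x₀).2 (Or.inr rfl)
  have hyy₀ : T.Adj y y₀ := (hy y₀).2 (Or.inr rfl)
  have lx := not_isLeaf_of_adj_iff hx₀.symm hx
  have ly := not_isLeaf_of_adj_iff hy₀.symm hy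
  have gx := H.adj_iff_of_two hx₀.symm hx
  have gy := H.adj_iff_of_two hy₀.symm hy
  have gx₀ := H.adj_of_not_isLeaf lx₀
  have gy₀ := H.adj_of_isLeaf ly₀ hyy₀.symm
  have nyx₀ : ¬ T.Adj y x₀ := H.not_adj_of_adj hxy hxx₀
  have nx₀y₀ : ¬ T.Adj x₀ y₀ := fun h => hx₀ (ly₀.eq h.symm hyy₀.symm)
  have hnb : ∀ w, T.Adj x₀ w → w ≠ x → w = σ y₀ ∨ w = σ.symm y₀ := by
    intro w hw hwx
    have hwy : w ≠ y := fun h => nyx₀ (h ▸ hw.symm)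
    have h2 := hpos.dist3_other_le_two H.connected (x := x) (y := x₀) (z := y)
      (fun v => by rw [gx]; tauto) hx₀.symm (by rw [gy, ← hy]; exact nyx₀)
      (fun v hv hvx => by
        rw [gy]; rintro (rfl | rfl)
        · exact hvx rfl
        · exact nx₀y₀ ((gx₀ _).1 hv)) ((gx₀ w).2 hw) hwx
    rcases dist3_le_two.1 h2 with h3 | h3 | ⟨v, h3, h4⟩
    · exact absurd h3.symm hwy
    · rcases (gy w).1 h3 with rfl | rfl
      · exact absurd rfl hwx
      · exact absurd hw nx₀y₀
    · rcases (gy v).1 h3 with rfl | rfl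
      · rcases (gx w).1 h4 with rfl | rfl
        · exact absurd rfl hwy
        · exact absurd hw (T.loopless.irrefl _)
      · exact ((gy₀ w).1 h4).resolve_left hwy
  have hall : ∀ v, v = x₀ ∨ v = x ∨ v = y ∨ v = y₀ ∨
      ((v = σ y₀ ∨ v = σ.symm y₀) ∧ T.Adj x₀ v) := by
    refine H.isTree.1.forall_mem (S := {v | v = x₀ ∨ v = x ∨ v = y ∨ v = y₀ ∨
      ((v = σ y₀ ∨ v = σ.symm y₀) ∧ T.Adj x₀ v)}) (x := x₀) (Or.inl rfl) ?_
    rintro u (rfl | rfl | rfl | rfl | ⟨hu, hau⟩) v huv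
    · by_cases hvx : v = x
      · exact Or.inr (Or.inl hvx)
      · exact Or.inr (Or.inr (Or.inr (Or.inr ⟨hnb v huv hvx, huv⟩)))
    · rcases (hx v).1 huv with rfl | rfl <;> simp
    · rcases (hy v).1 huv with rfl | rfl <;> simp
    · rw [ly₀.eq huv hyy₀.symm]; simp
    · have lu : T.IsLeaf u := by
        rcases hu with rfl | rfl
        exacts [H.apply_isLeaf _ ly₀, H.isLeaf_symm ly₀]
      exact Or.inl (lu.eq huv hau.symm)
  have l₁ := H.apply_isLeaf _ ly₀
  have l₂ := H.isLeaf_symm ly₀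
  have h₁ : T.Adj x₀ (σ y₀) := by
    rcases hall (σ y₀) with h | h | h | h | h
    · exact absurd (h ▸ l₁) lx₀
    · exact absurd (h ▸ l₁) lx
    · exact absurd (h ▸ l₁) ly
    · exact absurd h (H.apply_ne ly₀)
    · exact h.2
  have h₂ : T.Adj x₀ (σ.symm y₀) := by
    rcases hall (σ.symm y₀) with h | h | h | h | h
    · exact absurd (h ▸ l₂) lx₀
    · exact absurd (h ▸ l₂) lx
    · exact absurd (h ▸ l₂) ly
    · exact absurd h (H.symm_ne ly₀)
    · exact h.2
  have h₁₂ : σ (σ y₀) = σ.symm y₀ := by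
    have l₃ := H.apply_isLeaf _ l₁
    rcases hall (σ (σ y₀)) with h | h | h | h | ⟨h | h, -⟩
    · exact absurd (h ▸ l₃) lx₀
    · exact absurd (h ▸ l₃) lx
    · exact absurd (h ▸ l₃) ly
    · exact absurd h (H.apply_apply_ne ly₀)
    · exact absurd h (H.apply_ne l₁)
    · exact h
  have g₁ := H.adj_of_isLeaf l₁ h₁.symm
  have g₂ := H.adj_of_isLeaf l₂ h₂.symm
  have h₂₁ : σ.symm (σ.symm y₀) = σ y₀ := by rw [← h₁₂, Equiv.symm_apply_apply]
  rw [h₁₂, Equiv.symm_apply_apply] at g₁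
  rw [h₂₁, Equiv.apply_symm_apply] at g₂
  have n1 := H.apply_ne ly₀
  have n2 := H.symm_ne ly₀
  have n3 := H.apply_ne_symm ly₀
  refine H.connected.nonempty_iso_halinH2 (a := x₀) (b := x) (c := y) (d := y₀) (e := σ y₀)
    (f := σ.symm y₀) ?_ ?_ ?_ ?_ ?_ ?_ ?_
  · exact nodup_append_of_isLeaf (T := T) (l := [x₀, x, y]) (l' := [y₀, σ y₀, σ.symm y₀])
      (by simp [hxx₀.ne', hxy.ne, hx₀]) (by simp [n1.symm, n2.symm, n3])
      (by simp [lx₀, lx, ly]) (by simp [ly₀, l₁, l₂])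
  · intro w
    rw [gx₀]
    refine ⟨fun h => ?_, ?_⟩
    · by_cases hwx : w = x
      · exact Or.inl hwx
      · exact Or.inr (hnb w h hwx)
    · rintro (rfl | rfl | rfl)
      exacts [hxx₀.symm, h₁, h₂]
  · intro w; rw [gx]; tauto
  · intro w; rw [gy]
  · exact gy₀
  · intro w; rw [g₁]; tauto
  · intro w; rw [g₂]

/-- Two adjacent vertices of degree two occur only in `H₂`. -/
lemma nonempty_iso_halinH2 (hpos : G.HasPositiveLLYCurvature) {x y x₀ y₀ : V} (hx₀ : x₀ ≠ y)
    (hy₀ : y₀ ≠ x) (hx : ∀ v, T.Adj x v ↔ v = y ∨ v = x₀) (hy : ∀ v, T.Adj y v ↔ v = x ∨ v = y₀) :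
    Nonempty (G ≃g halinH2) := by
  by_cases lx₀ : T.IsLeaf x₀ <;> by_cases ly₀ : T.IsLeaf y₀
  · exfalso
    obtain ⟨c, hc⟩ := H.exists_isBranchVertex
    obtain ⟨w, lw, hwx, hwy⟩ := H.isTree.exists_leaf_ne hc x₀ y₀
    have hxx₀ : T.Adj x x₀ := (hx x₀).2 (Or.inr rfl)
    have hyy₀ : T.Adj y y₀ := (hy y₀).2 (Or.inr rfl)
    have := H.isTree.1.forall_mem (S := {v | v = x₀ ∨ v = x ∨ v = y ∨ v = y₀}) (x := x₀)
      (Or.inl rfl) (by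
        rintro u (rfl | rfl | rfl | rfl) v huv
        · exact Or.inr (Or.inl (lx₀.eq huv hxx₀.symm))
        · rcases (hx v).1 huv with rfl | rfl <;> simp
        · rcases (hy v).1 huv with rfl | rfl <;> simp
        · exact Or.inr (Or.inr (Or.inl (ly₀.eq huv hyy₀.symm)))) w
    rcases this with rfl | rfl | rfl | rfl
    · exact hwx rfl
    · exact not_isLeaf_of_adj_iff hx₀.symm hx lw
    · exact not_isLeaf_of_adj_iff hy₀.symm hy lw
    · exact hwy rfl
  · exact H.nonempty_iso_halinH2_aux hpos hy₀ hx₀ hy hx ly₀ lx₀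
  · exact H.nonempty_iso_halinH2_aux hpos hx₀ hy₀ hx hy lx₀ ly₀
  · exfalso
    have hxy : T.Adj x y := (hx y).2 (Or.inl rfl)
    have hxx₀ : T.Adj x x₀ := (hx x₀).2 (Or.inr rfl)
    have hyy₀ : T.Adj y y₀ := (hy y₀).2 (Or.inr rfl)
    have gx := H.adj_iff_of_two hx₀.symm hx
    have gy := H.adj_iff_of_two hy₀.symm hy
    have gx₀ := H.adj_of_not_isLeaf lx₀
    have gy₀ := H.adj_of_not_isLeaf ly₀
    have by₀ : y₀ ∈ T.branch x y := H.isTree.branch_subset hxy hyy₀ hy₀ (right_mem_branch hyy₀)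
    have bx₀ : x₀ ∉ T.branch x y := (H.isTree.mem_branch_swap hxy).1
      (H.isTree.branch_subset hxy.symm hxx₀ hx₀ (right_mem_branch hxx₀))
    have nx₀y₀ : ¬ T.Adj x₀ y₀ := fun h =>
      hyy₀.ne (H.isTree.eq_of_leave_branch hxy h.symm by₀ bx₀).1.symm
    have h2 := hpos.dist3_other_le_two H.connected gx hx₀
      (by rw [gx₀]; exact fun h => H.not_adj_of_adj hxx₀ hxy h)
      (fun v hv hvx h => by
        rcases (gy v).1 hv with rfl | rfl
        · exact hvx rfl
        · exact nx₀y₀ ((gx₀ _).1 h)) ((gy y₀).2 (Or.inr rfl)) hy₀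
    rcases dist3_le_two.1 h2 with h3 | h3 | ⟨z, h3, h4⟩
    · exact bx₀ (h3 ▸ by₀)
    · exact nx₀y₀ ((gx₀ _).1 h3)
    · rw [gx₀] at h3
      rw [G.adj_comm, gy₀] at h4
      by_cases hz : z ∈ T.branch x y
      · exact hxx₀.ne (H.isTree.eq_of_leave_branch hxy h3.symm hz bx₀).2.symm
      · exact hyy₀.ne (H.isTree.eq_of_leave_branch hxy h4 by₀ hz).1.symm

/-- A branch vertex next to a vertex of degree two whose other neighbour is not a leaf has two
leaves as its other neighbours: it shares no further neighbour with the vertex beyond. -/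
lemma exists_of_subdivided (hpos : G.HasPositiveLLYCurvature) {x y z : V} (hyz : y ≠ z)
    (hx : ∀ v, T.Adj x v ↔ v = y ∨ v = z) (hy : T.IsBranchVertex y) (lz : ¬ T.IsLeaf z) :
    ∃ a b, a ≠ x ∧ b ≠ x ∧ b ≠ a ∧ (∀ v, T.Adj y v ↔ v = x ∨ v = a ∨ v = b) ∧
      T.IsLeaf a ∧ T.IsLeaf b := by
  classical
  have hxy : T.Adj x y := (hx y).2 (Or.inl rfl)
  have hxz : T.Adj x z := (hx z).2 (Or.inr rfl)
  have gx := H.adj_iff_of_two hyz hx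
  have gy := H.adj_of_not_isLeaf hy.not_isLeaf
  have gz := H.adj_of_not_isLeaf lz
  have hY : ∀ v, v ∈ Finset.univ.filter (G.Adj y) ↔ G.Adj y v := fun v => by simp
  have hzy : ¬ G.Adj z y := by rw [gz]; exact H.not_adj_of_adj hxz hxy
  have bz : z ∉ T.branch x y := (H.isTree.mem_branch_swap hxy).1
      (H.isTree.branch_subset hxy.symm hxz hyz.symm (right_mem_branch hxz))
  have bin : ∀ v, T.Adj y v → v ≠ x → v ∈ T.branch x y := fun v hv hvx =>
    H.isTree.branch_subset hxy hv hvx (right_mem_branch hv)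
  have hn : ∀ v, G.Adj y v → v ≠ x → ¬ G.Adj z v := fun v hv hvx h => by
    rw [gy] at hv; rw [gz] at h
    exact hxz.ne (H.isTree.eq_of_leave_branch hxy h.symm (bin v hv hvx) bz).2.symm
  have hc := hpos.card_lt H.connected gx hyz.symm hzy hY (Z := ∅)
    (fun v hv hzv hvx => absurd hzv (hn v hv hvx))
  obtain ⟨a, b, hax, hbx, hba, hN⟩ := hy.eq_of_card_lt hxy.symm
    (fun v => by rw [hY, gy]) (by simpa using hc)
  have hleaf : ∀ w, T.Adj y w → w ≠ x → T.IsLeaf w := by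
    intro w hw hwx
    have h2 := hpos.dist3_other_le_two H.connected gx hyz.symm hzy hn ((gy w).2 hw) hwx
    rcases dist3_le_two.1 h2 with h3 | h3 | ⟨v, h3, h4⟩
    · exact absurd (h3 ▸ bin w hw hwx) bz
    · exact absurd h3 (hn w ((gy w).2 hw) hwx)
    · rw [gz] at h3
      rcases (H.adj_iff v w).1 h4 with h5 | h5
      · exfalso
        by_cases hv : v ∈ T.branch x y
        · exact hxz.ne (H.isTree.eq_of_leave_branch hxy h3.symm hv bz).2.symm
        · exact hw.ne (H.isTree.eq_of_leave_branch hxy h5.symm (bin w hw hwx) hv).1.symm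
      · exact h5.2.2.1
  exact ⟨a, b, hax, hbx, hba, hN, hleaf a ((hN a).2 (by simp)) hax,
    hleaf b ((hN b).2 (by simp)) hbx⟩

lemma nonempty_iso_halinH5_aux {x y z a b c d : V} (hyz : y ≠ z)
    (hx : ∀ v, T.Adj x v ↔ v = y ∨ v = z) (hy : ∀ v, T.Adj y v ↔ v = x ∨ v = a ∨ v = b)
    (hz : ∀ v, T.Adj z v ↔ v = x ∨ v = c ∨ v = d) (la : T.IsLeaf a) (lb : T.IsLeaf b)
    (lc : T.IsLeaf c) (ld : T.IsLeaf d) (ly : ¬ T.IsLeaf y) (lz : ¬ T.IsLeaf z)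
    (hnd : [a, b, c, d].Nodup) (h1 : σ a = b) (h2 : σ b = c) (h3 : σ c = d) (h4 : σ d = a) :
    Nonempty (G ≃g halinH5) := by
  have gx := H.adj_iff_of_two hyz hx
  have lx := not_isLeaf_of_adj_iff hyz hx
  have s1 : σ.symm b = a := by rw [← h1, Equiv.symm_apply_apply]
  have s2 : σ.symm c = b := by rw [← h2, Equiv.symm_apply_apply]
  have s3 : σ.symm d = c := by rw [← h3, Equiv.symm_apply_apply]
  have s4 : σ.symm a = d := by rw [← h4, Equiv.symm_apply_apply]
  have gy := H.adj_of_not_isLeaf ly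
  have gz := H.adj_of_not_isLeaf lz
  have ga := H.adj_of_isLeaf la (p := y) ((hy a).2 (by simp)).symm
  have gb := H.adj_of_isLeaf lb (p := y) ((hy b).2 (by simp)).symm
  have gc := H.adj_of_isLeaf lc (p := z) ((hz c).2 (by simp)).symm
  have gd := H.adj_of_isLeaf ld (p := z) ((hz d).2 (by simp)).symm
  refine H.connected.nonempty_iso_halinH5 (a := z) (b := x) (c := y) (d := a) (e := b)
    (f := c) (g := d) ?_ ?_ ?_ ?_ ?_ ?_ ?_ ?_
  · have m1 : x ≠ y := ((hx y).2 (by simp)).ne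
    have m2 : x ≠ z := ((hx z).2 (by simp)).ne
    exact nodup_append_of_isLeaf (T := T) (l := [z, x, y]) (l' := [a, b, c, d])
      (by simp [m1, m2.symm, hyz.symm]) hnd (by simp [lx, ly, lz]) (by simp [la, lb, lc, ld])
  · intro w; rw [gz, hz]
  · intro w; rw [gx]; tauto
  · intro w; rw [gy, hy]
  · intro w; rw [ga, h1, s4]
  · intro w; rw [gb, h2, s1]; tauto
  · intro w; rw [gc, h3, s2]; tauto
  · intro w; rw [gd, h4, s3]

/-- A vertex of degree two between two branch vertices occurs only in `H₅`. -/
lemma nonempty_iso_halinH5 (hpos : G.HasPositiveLLYCurvature) {x y z : V} (hyz : y ≠ z)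
    (hx : ∀ v, T.Adj x v ↔ v = y ∨ v = z) (by' : T.IsBranchVertex y) (bz' : T.IsBranchVertex z) :
    Nonempty (G ≃g halinH5) := by
  have lx := not_isLeaf_of_adj_iff hyz hx
  obtain ⟨a, b, hax, hbx, hba, hy, la, lb⟩ := H.exists_of_subdivided hpos hyz hx by' bz'.not_isLeaf
  obtain ⟨c, d, hcx, hdx, hdc, hz, lc, ld⟩ := H.exists_of_subdivided hpos hyz.symm
    (fun v => by rw [hx]; tauto) bz' by'.not_isLeaf
  have ly := by'.not_isLeaf
  have lz := bz'.not_isLeaf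
  have hxy : T.Adj x y := (hx y).2 (Or.inl rfl)
  have hxz : T.Adj x z := (hx z).2 (Or.inr rfl)
  have hya : T.Adj y a := (hy a).2 (by simp)
  have hyb : T.Adj y b := (hy b).2 (by simp)
  have hzc : T.Adj z c := (hz c).2 (by simp)
  have hzd : T.Adj z d := (hz d).2 (by simp)
  have Ba : a ∈ T.branch x y := H.isTree.branch_subset hxy hya hax (right_mem_branch hya)
  have Bb : b ∈ T.branch x y := H.isTree.branch_subset hxy hyb hbx (right_mem_branch hyb)
  have Bz : ∀ v, v ∈ T.branch x z → v ∉ T.branch x y := fun v h h' =>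
    hyz (H.isTree.branch_disjoint hxy hxz h' h)
  have Bc := Bz c (H.isTree.branch_subset hxz hzc hcx (right_mem_branch hzc))
  have Bd := Bz d (H.isTree.branch_subset hxz hzd hdx (right_mem_branch hzd))
  have hall : ∀ v, v = x ∨ v = y ∨ v = z ∨ v = a ∨ v = b ∨ v = c ∨ v = d := by
    refine H.isTree.1.forall_mem (S := {v | v = x ∨ v = y ∨ v = z ∨ v = a ∨ v = b ∨ v = c ∨ v = d})
      (x := x) (Or.inl rfl) ?_
    rintro u (rfl | rfl | rfl | rfl | rfl | rfl | rfl) v huv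
    · rcases (hx v).1 huv with rfl | rfl <;> simp
    · rcases (hy v).1 huv with rfl | rfl | rfl <;> simp
    · rcases (hz v).1 huv with rfl | rfl | rfl <;> simp
    · rw [la.eq huv hya.symm]; simp
    · rw [lb.eq huv hyb.symm]; simp
    · rw [lc.eq huv hzc.symm]; simp
    · rw [ld.eq huv hzd.symm]; simp
  have hleaf : ∀ v, T.IsLeaf v → v = a ∨ v = b ∨ v = c ∨ v = d := by
    intro v hv
    rcases hall v with rfl | rfl | rfl | h
    exacts [absurd hv lx, absurd hv ly, absurd hv lz, h]
  have hab : a ≠ b := hba.symm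
  have hac : a ≠ c := fun h => Bc (h ▸ Ba)
  have had : a ≠ d := fun h => Bd (h ▸ Ba)
  have hbc : b ≠ c := fun h => Bc (h ▸ Bb)
  have hbd : b ≠ d := fun h => Bd (h ▸ Bb)
  have hcd : c ≠ d := hdc.symm
  -- Otherwise both leaves of the branch behind `xy` have their successors outside.
  have hcut : σ a = b ∨ σ b = a := by
    by_contra hcon
    push Not at hcon
    have h1 : σ a ∉ T.branch x y := by
      have fa := H.apply_ne la
      rcases hleaf _ (H.apply_isLeaf a la) with h | h | h | h
      exacts [absurd h fa, absurd h hcon.1, h ▸ Bc, h ▸ Bd]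
    have h2 : σ b ∉ T.branch x y := by
      have fb := H.apply_ne lb
      rcases hleaf _ (H.apply_isLeaf b lb) with h | h | h | h
      exacts [absurd h hcon.2, absurd h fb, h ▸ Bc, h ▸ Bd]
    exact hab (H.eq_of_leave x y hxy a Ba b Bb la lb h1 h2)
  have hy' : ∀ v, T.Adj y v ↔ v = x ∨ v = b ∨ v = a := fun v => by
    rw [hy, or_comm (a := v = a)]
  have hz' : ∀ v, T.Adj z v ↔ v = x ∨ v = d ∨ v = c := fun v => by
    rw [hz, or_comm (a := v = c)]
  have hleaf' : ∀ v, T.IsLeaf v → v = b ∨ v = a ∨ v = c ∨ v = d := fun v hv => by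
    rcases hleaf v hv with h | h | h | h <;> simp [h]
  rcases hcut with h1 | h1
  · rcases H.apply_of_four la lb lc ld hac had hbc hbd hcd hleaf h1 with ⟨h2, h3, h4⟩ | ⟨h2, h3, h4⟩
    · exact H.nonempty_iso_halinH5_aux hyz hx hy hz la lb lc ld ly lz
        (by simp [hab, hac, had, hbc, hbd, hcd]) h1 h2 h3 h4
    · exact H.nonempty_iso_halinH5_aux hyz hx hy hz' la lb ld lc ly lz
        (by simp [hab, hac, had, hbc, hbd, hdc]) h1 h2 h3 h4
  · rcases H.apply_of_four lb la lc ld hbc hbd hac had hcd hleaf' h1 with ⟨h2, h3, h4⟩ |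
      ⟨h2, h3, h4⟩
    · exact H.nonempty_iso_halinH5_aux hyz hx hy' hz lb la lc ld ly lz
        (by simp [hba, hac, had, hbc, hbd, hcd]) h1 h2 h3 h4
    · exact H.nonempty_iso_halinH5_aux hyz hx hy' hz' lb la ld lc ly lz
        (by simp [hba, hac, had, hbc, hbd, hdc]) h1 h2 h3 h4

end IsHalin

end DegreeTwo

/-! ### The leaf cycle across a tree edge between branch vertices -/

section AdjacentBranchVertices

variable {V : Type*} [Fintype V] {G T : SimpleGraph V} {σ : Equiv.Perm V}

/-- A leg of the tree `T` at the vertex `c`: the neighbour `w` of `c` is the leaf `u`, or it has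
degree two and its other neighbour is the leaf `u`. -/
structure IsLeg (T : SimpleGraph V) (c w u : V) : Prop where
  adj : T.Adj c w
  isLeaf : T.IsLeaf u
  eq_or : w = u ∨ (c ≠ u ∧ ∀ v, T.Adj w v ↔ v = c ∨ v = u)

lemma IsLeg.not_isLeaf {c w u : V} (h : IsLeg T c w u) (hw : w ≠ u) : ¬ T.IsLeaf w :=
  not_isLeaf_of_adj_iff (h.eq_or.resolve_left hw).1 (h.eq_or.resolve_left hw).2

lemma IsLeg.adj_iff {c w u : V} (h : IsLeg T c w u) (hw : w ≠ u) (v : V) :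
    T.Adj w v ↔ v = c ∨ v = u := (h.eq_or.resolve_left hw).2 v

lemma IsLeg.adj_leaf {c w u : V} (h : IsLeg T c w u) (hw : w ≠ u) : T.Adj u w :=
  ((h.adj_iff hw u).2 (Or.inr rfl)).symm

lemma IsLeg.mem_branch (hT : T.IsTree) {c w u : V} (h : IsLeg T c w u) : u ∈ T.branch c w := by
  by_cases hw : w = u
  · subst hw; exact right_mem_branch h.adj
  · have h1 := (h.adj_leaf hw).symm
    exact hT.branch_subset h.adj h1 (h.eq_or.resolve_left hw).1.symm (right_mem_branch h1)

/-- A leaf is alone in its branch. -/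
lemma IsTree.eq_of_mem_branch (hT : T.IsTree) {c w v : V} (h : T.Adj c w) (hw : T.IsLeaf w)
    (hv : v ∈ T.branch c w) : v = w := by
  by_contra hne
  obtain ⟨z, hz, hvz⟩ := hT.1.exists_mem_branch (Ne.symm hne)
  obtain rfl := hw.eq hz h.symm
  exact (hT.mem_branch_swap h).1 hvz hv

/-- The situation at a tree edge between the branch vertices `x` and `y`: the leaf cycle passes from
the side of `x` to that of `y` along the edge from `p₁` to `q₁`, and back along the one from `q₂` to
`p₂`. -/
structure IsCrossing (T : SimpleGraph V) (σ : Equiv.Perm V) (x y p₁ q₁ q₂ p₂ : V) : Prop where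
  adj : T.Adj x y
  left : T.IsBranchVertex x
  right : T.IsBranchVertex y
  mem_p₁ : p₁ ∈ T.branch y x
  mem_p₂ : p₂ ∈ T.branch y x
  mem_q₁ : q₁ ∈ T.branch x y
  mem_q₂ : q₂ ∈ T.branch x y
  leaf_p₁ : T.IsLeaf p₁
  leaf_p₂ : T.IsLeaf p₂
  leaf_q₁ : T.IsLeaf q₁
  leaf_q₂ : T.IsLeaf q₂
  apply_p₁ : σ p₁ = q₁
  apply_q₂ : σ q₂ = p₂
  ne_p : p₁ ≠ p₂
  ne_q : q₁ ≠ q₂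

lemma IsCrossing.symm {x y p₁ q₁ q₂ p₂ : V} (C : IsCrossing T σ x y p₁ q₁ q₂ p₂) :
    IsCrossing T σ y x q₂ p₂ p₁ q₁ :=
  ⟨C.adj.symm, C.right, C.left, C.mem_q₂, C.mem_q₁, C.mem_p₂, C.mem_p₁, C.leaf_q₂, C.leaf_q₁,
    C.leaf_p₂, C.leaf_p₁, C.apply_q₂, C.apply_p₁, C.ne_q.symm, C.ne_p.symm⟩

namespace IsHalin

variable (H : IsHalin G T σ)
include H

lemma exists_leave {x y : V} (h : T.Adj x y) :
    ∃ u ∈ T.branch x y, T.IsLeaf u ∧ σ u ∉ T.branch x y := by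
  by_contra hcon
  push Not at hcon
  obtain ⟨u, hu, lu⟩ := H.isTree.exists_leaf_mem_branch h
  obtain ⟨v, hv, lv⟩ := H.isTree.exists_leaf_mem_branch h.symm
  exact (H.isTree.mem_branch_swap h).1 hv (H.forall_mem _ hcon u hu lu v lv)

/-- The leaf cycle enters and leaves a branch with several leaves at different leaves. Otherwise it
would circulate through the other leaves of the branch. -/
lemma leave_ne {x y p q : V} (h : T.Adj x y) (hy : T.IsBranchVertex y) (hp : p ∈ T.branch x y)
    (lp : T.IsLeaf p) (hσp : σ p ∉ T.branch x y) (hq : q ∉ T.branch x y) : p ≠ σ q := by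
  intro hpq
  obtain ⟨u, hu, lu, hup⟩ := H.isTree.exists_leaf_mem_branch_ne h hy p
  have := H.forall_mem {v | v ∈ T.branch x y ∧ v ≠ p} ?_ u ⟨hu, hup⟩ lu p lp
  · exact this.2 rfl
  · rintro v ⟨hv, hvp⟩ lv
    refine ⟨?_, ?_⟩
    · by_contra hσv
      exact hvp (H.eq_of_leave x y h v hv p hp lv lp hσv hσp)
    · intro h'
      rw [hpq] at h'
      exact hq (σ.injective h' ▸ hv)

lemma exists_isCrossing {x y : V} (h : T.Adj x y) (hx : T.IsBranchVertex x)
    (hy : T.IsBranchVertex y) : ∃ p₁ q₁ q₂ p₂, IsCrossing T σ x y p₁ q₁ q₂ p₂ := by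
  obtain ⟨p, hp, lp, hσp⟩ := H.exists_leave h.symm
  obtain ⟨q, hq, lq, hσq⟩ := H.exists_leave h
  have hp' := (H.isTree.mem_branch_swap h).1 hp
  have hq' := (H.isTree.mem_branch_swap h.symm).1 hq
  refine ⟨p, σ p, q, σ q, h, hx, hy, hp, (H.isTree.mem_branch_swap h).2 hσq,
    (H.isTree.mem_branch_swap h.symm).2 hσp, hq, lp, H.apply_isLeaf q lq, H.apply_isLeaf p lp, lq,
    rfl, rfl, H.leave_ne h.symm hx hp lp hσp hq', (H.leave_ne h hy hq lq hσq hp').symm⟩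

end IsHalin

section Crossing

variable {x y p₁ q₁ q₂ p₂ : V} (H : IsHalin G T σ) (C : IsCrossing T σ x y p₁ q₁ q₂ p₂)
include H C

namespace IsCrossing

lemma eq_p₁ {u : V} (hu : u ∈ T.branch y x) (lu : T.IsLeaf u) (h : σ u ∈ T.branch x y) :
    u = p₁ := by
  refine H.eq_of_leave y x C.adj.symm u hu p₁ C.mem_p₁ lu C.leaf_p₁
    ((H.isTree.mem_branch_swap C.adj.symm).1 h) ?_
  rw [C.apply_p₁]
  exact (H.isTree.mem_branch_swap C.adj.symm).1 C.mem_q₁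

/-- Only three edges of `G` connect the two sides. -/
lemma adj_cases {a b : V} (ha : a ∈ T.branch y x) (hb : b ∈ T.branch x y) (h : G.Adj a b) :
    (a = x ∧ b = y) ∨ (a = p₁ ∧ b = q₁) ∨ (a = p₂ ∧ b = q₂) := by
  rcases (H.adj_iff a b).1 h with h1 | ⟨-, la, lb, h1 | h1⟩
  · exact Or.inl (H.isTree.eq_of_leave_branch C.adj.symm h1 ha
      ((H.isTree.mem_branch_swap C.adj.symm).1 hb))
  · have := C.eq_p₁ H ha la (h1 ▸ hb)
    subst this
    exact Or.inr (Or.inl ⟨rfl, by rw [← h1, C.apply_p₁]⟩)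
  · have := C.symm.eq_p₁ H hb lb (h1 ▸ ha)
    subst this
    exact Or.inr (Or.inr ⟨by rw [← h1, C.apply_q₂], rfl⟩)

lemma ne_of_mem {a b : V} (ha : a ∈ T.branch y x) (hb : b ∈ T.branch x y) : a ≠ b := by
  rintro rfl
  exact (H.isTree.mem_branch_swap C.adj).1 ha hb

lemma mem_or (v : V) : v ∈ T.branch y x ∨ v ∈ T.branch x y := by
  rw [H.isTree.mem_branch_swap C.adj]; tauto

lemma apply_mem {u : V} (hu : u ∈ T.branch y x) (lu : T.IsLeaf u) (h : u ≠ p₁) :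
    σ u ∈ T.branch y x := by
  rcases C.mem_or H (σ u) with h1 | h1
  · exact h1
  · exact absurd (C.eq_p₁ H hu lu h1) h

lemma symm_mem : σ.symm p₁ ∈ T.branch y x := by
  rcases C.mem_or H (σ.symm p₁) with h1 | h1
  · exact h1
  · have := C.symm.eq_p₁ H h1 (H.isLeaf_symm C.leaf_p₁)
      (by rw [Equiv.apply_symm_apply]; exact C.mem_p₁)
    refine absurd ?_ C.ne_p
    rw [← C.apply_q₂, ← this, Equiv.apply_symm_apply]

lemma parent_mem {u p : V} (lu : T.IsLeaf u) (hu : u ∈ T.branch y x) (hp : T.Adj u p) :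
    p ∈ T.branch y x := by
  rcases C.mem_or H p with h1 | h1
  · exact h1
  · have := H.isTree.eq_of_leave_branch C.adj.symm hp hu
      ((H.isTree.mem_branch_swap C.adj.symm).1 h1)
    exact absurd (this.1 ▸ lu) C.left.not_isLeaf

/-- Positive curvature of the edge `p₁q₁` leaves room for at most one further leaf beyond the two
crossing edges, and then `p₁` and `q₁` are children of `x` and `y`. -/
lemma cases_of_pos (hpos : G.HasPositiveLLYCurvature) :
    (σ q₁ = q₂ ∧ σ p₂ = p₁) ∨
    (T.Adj p₁ x ∧ T.Adj q₁ y ∧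
      ((σ (σ q₁) = q₂ ∧ σ p₂ = p₁) ∨ (σ q₁ = q₂ ∧ σ (σ p₂) = p₁))) := by
  obtain ⟨p, hp⟩ := isLeaf_iff.1 C.leaf_p₁
  obtain ⟨q, hq⟩ := isLeaf_iff.1 C.leaf_q₁
  have hp' : T.Adj p₁ p := (hp p).2 rfl
  have hq' : T.Adj q₁ q := (hq q).2 rfl
  have np := H.not_isLeaf_of_adj C.leaf_p₁ hp'
  have nq := H.not_isLeaf_of_adj C.leaf_q₁ hq'
  have l1 := H.isLeaf_symm C.leaf_p₁
  have l2 := H.apply_isLeaf _ C.leaf_q₁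
  have m1 := C.symm_mem H
  have m2 : σ q₁ ∈ T.branch x y := C.symm.apply_mem H C.mem_q₁ C.leaf_q₁ C.ne_q
  have m3 : p ∈ T.branch y x := C.parent_mem H C.leaf_p₁ C.mem_p₁ hp'
  have m4 : q ∈ T.branch x y := C.symm.parent_mem H C.leaf_q₁ C.mem_q₁ hq'
  have hs : σ.symm q₁ = p₁ := by rw [← C.apply_p₁, Equiv.symm_apply_apply]
  have nx := C.left.not_isLeaf
  have ny := C.right.not_isLeaf
  have hcub := hpos.cubic H.connected (x := p₁) (y := q₁) (a₁ := p) (a₂ := σ.symm p₁) (b₁ := q)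
    (b₂ := σ q₁)
    (fun v => by rw [H.adj_of_isLeaf C.leaf_p₁ hp', C.apply_p₁]; tauto)
    (fun v => by rw [H.adj_of_isLeaf C.leaf_q₁ hq', hs]; tauto)
    (C.ne_of_mem H m3 C.mem_q₁).symm (C.ne_of_mem H m1 C.mem_q₁).symm
    (fun h => np (h ▸ l1)) (C.ne_of_mem H C.mem_p₁ m4) (C.ne_of_mem H C.mem_p₁ m2)
    (fun h => nq (h ▸ l2))
  have e1 : σ.symm p₁ = p₂ ↔ σ p₂ = p₁ := by
    rw [Equiv.symm_apply_eq]; exact eq_comm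
  have hlow : ∀ {a b : V}, a ∈ T.branch y x → b ∈ T.branch x y →
      ¬ ((a = x ∧ b = y) ∨ (a = p₁ ∧ b = q₁) ∨ (a = p₂ ∧ b = q₂)) → 2 ≤ G.dist3 a b :=
    fun ha hb h => two_le_dist3 (C.ne_of_mem H ha hb) fun hab => h (C.adj_cases H ha hb hab)
  have hlp₁ := C.leaf_p₁
  have hlp₂ := C.leaf_p₂
  have hlq₁ := C.leaf_q₁
  have hlq₂ := C.leaf_q₂
  have d1 : 2 ≤ G.dist3 p (σ q₁) := hlow m3 m2 (by
    rintro (⟨-, h⟩ | ⟨h, -⟩ | ⟨h, -⟩)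
    exacts [ny (h ▸ l2), np (h ▸ hlp₁), np (h ▸ hlp₂)])
  have d2 : 2 ≤ G.dist3 (σ.symm p₁) q := hlow m1 m4 (by
    rintro (⟨h, -⟩ | ⟨-, h⟩ | ⟨-, h⟩)
    exacts [nx (h ▸ l1), nq (h ▸ hlq₁), nq (h ▸ hlq₂)])
  have hcub := hcub.resolve_right (by omega)
  have d3 := one_le_dist3 (G := G) (C.ne_of_mem H m3 m4)
  have d4 := one_le_dist3 (G := G) (C.ne_of_mem H m1 m2)
  have n1 := H.apply_ne C.leaf_q₁
  have n2 := H.symm_ne C.leaf_p₁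
  by_cases hadj : G.Adj (σ.symm p₁) (σ q₁)
  · rcases C.adj_cases H m1 m2 hadj with ⟨h, -⟩ | ⟨h, -⟩ | ⟨h, h'⟩
    · exact absurd (h ▸ l1) nx
    · exact absurd h n2
    · exact Or.inl ⟨h', e1.1 h⟩
  have d5 := two_le_dist3 (C.ne_of_mem H m1 m2) hadj
  have hpq : G.dist3 p q = 1 := by omega
  obtain ⟨rfl, rfl⟩ : p = x ∧ q = y := by
    rcases C.adj_cases H m3 m4 (dist3_eq_one.1 hpq) with h | ⟨h, -⟩ | ⟨h, -⟩
    exacts [h, absurd (h ▸ hlp₁) np, absurd (h ▸ hlp₂) np]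
  refine Or.inr ⟨hp', hq', ?_⟩
  rcases dist3_le_two.1 (by omega : G.dist3 (σ.symm p₁) (σ q₁) ≤ 2) with h | h | ⟨w, hw, hw'⟩
  · exact absurd h (C.ne_of_mem H m1 m2)
  · exact absurd h hadj
  rcases C.mem_or H w with mw | mw
  · right
    rcases C.adj_cases H mw m2 hw' with ⟨-, h⟩ | ⟨-, h⟩ | ⟨rfl, h⟩
    · exact absurd (h ▸ l2) ny
    · exact absurd h n1
    · refine ⟨h, ?_⟩
      rcases (H.adj_iff _ _).1 hw with h1 | ⟨-, -, -, h1 | h1⟩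
      · exact absurd hlp₂ (H.not_isLeaf_of_adj l1 h1)
      · rw [Equiv.apply_symm_apply] at h1; exact absurd h1 C.ne_p
      · rw [h1, Equiv.apply_symm_apply]
  · left
    rcases C.adj_cases H m1 mw hw with ⟨h, -⟩ | ⟨h, -⟩ | ⟨h, rfl⟩
    · exact absurd (h ▸ l1) nx
    · exact absurd h n2
    · refine ⟨?_, e1.1 h⟩
      rcases (H.adj_iff _ _).1 hw' with h1 | ⟨-, -, -, h1 | h1⟩
      · exact absurd l2 (H.not_isLeaf_of_adj hlq₂ h1)
      · rw [C.apply_q₂] at h1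
        exact absurd h1 (C.ne_of_mem H C.mem_p₂ m2)
      · exact h1

end IsCrossing

end Crossing

end AdjacentBranchVertices

/-! ### Adjacent branch vertices -/

section FewLeaves

variable {V : Type*} [Fintype V] {G T : SimpleGraph V} {σ : Equiv.Perm V}

/-- The branches at a vertex of degree at least three are legs, or start at another such vertex. -/
def HasLegs (T : SimpleGraph V) : Prop :=
  ∀ c w, T.IsBranchVertex c → T.Adj c w → (∃ u, IsLeg T c w u) ∨ T.IsBranchVertex w

lemma IsHalin.hasLegs_or (H : IsHalin G T σ) (hpos : G.HasPositiveLLYCurvature) :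
    T.HasLegs ∨ Nonempty (G ≃g halinH2) ∨ Nonempty (G ≃g halinH5) := by
  by_contra hcon
  push Not at hcon
  obtain ⟨h, h2, h5⟩ := hcon
  refine h fun c w hc hcw => ?_
  rcases isLeaf_or hcw.symm with hl | ⟨a, b, hab, hw⟩ | hb
  · exact Or.inl ⟨w, hcw, hl, Or.inl rfl⟩
  · -- `u` denotes the neighbour of `w` other than `c`.
    obtain ⟨u, huc, hw⟩ : ∃ u, c ≠ u ∧ ∀ v, T.Adj w v ↔ v = c ∨ v = u := by
      rcases (hw c).1 hcw.symm with rfl | rfl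
      · exact ⟨b, hab, hw⟩
      · exact ⟨a, hab.symm, fun v => by rw [hw, or_comm]⟩
    have hwu : T.Adj w u := (hw u).2 (Or.inr rfl)
    rcases isLeaf_or hwu.symm with hl | ⟨a', b', hab', hu⟩ | hb
    · exact Or.inl ⟨u, hcw, hl, Or.inr ⟨huc, hw⟩⟩
    · exfalso
      obtain ⟨z, hzw, hu⟩ : ∃ z, z ≠ w ∧ ∀ v, T.Adj u v ↔ v = w ∨ v = z := by
        rcases (hu w).1 hwu.symm with rfl | rfl
        · exact ⟨b', hab'.symm, hu⟩
        · exact ⟨a', hab', fun v => by rw [hu, or_comm]⟩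
      exact not_isEmpty_iff.2 (H.nonempty_iso_halinH2 hpos huc hzw
        (fun v => by rw [hw, or_comm]) hu) h2
    · exact absurd (H.nonempty_iso_halinH5 hpos huc hw hc hb) (not_nonempty_iff.2 h5)
  · exact Or.inr hb

/-- If only two leaves lie on one side of the edge from `x` to the branch vertex `y`, they end the
two legs at `x`. -/
lemma IsTree.exists_two_legs (hT : T.IsTree) (hl : T.HasLegs) {x y p q : V}
    (h : T.Adj x y) (hx : T.IsBranchVertex x) (hp : p ∈ T.branch y x) (hq : q ∈ T.branch y x)
    (lp : T.IsLeaf p) (lq : T.IsLeaf q)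
    (hpq : ∀ v ∈ T.branch y x, T.IsLeaf v → v = p ∨ v = q) :
    ∃ a b, IsLeg T x a p ∧ IsLeg T x b q ∧ a ≠ b ∧ y ≠ a ∧ y ≠ b ∧
      ∀ v, T.Adj x v ↔ v = y ∨ v = a ∨ v = b := by
  have hne : ∀ {u}, T.IsLeaf u → x ≠ u := fun lu e => hx.not_isLeaf (e ▸ lu)
  have hnb : ∀ {u w}, u ∈ T.branch y x → u ∈ T.branch x w → y ≠ w := fun hu hu' e =>
    (hT.mem_branch_swap h).1 hu (e ▸ hu')
  obtain ⟨a, ha, hpa⟩ := hT.1.exists_mem_branch (hne lp)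
  obtain ⟨b, hb, hqb⟩ := hT.1.exists_mem_branch (hne lq)
  have hya := hnb hp hpa
  have hyb := hnb hq hqb
  have hN : ∀ v, T.Adj x v ↔ v = y ∨ v = a ∨ v = b := by
    intro v
    constructor
    · intro hv
      by_cases hvy : v = y
      · exact Or.inl hvy
      obtain ⟨u, hu, lu⟩ := hT.exists_leaf_mem_branch hv
      rcases hpq u (hT.branch_subset h.symm hv hvy hu) lu with rfl | rfl
      · exact Or.inr (Or.inl (hT.branch_disjoint hv ha hu hpa))
      · exact Or.inr (Or.inr (hT.branch_disjoint hv hb hu hqb))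
    · rintro (rfl | rfl | rfl) <;> assumption
  have hab : a ≠ b := by
    rintro rfl
    obtain ⟨z, hz, hzy, hza⟩ := hx y a
    rcases (hN z).1 hz with h1 | h1 | h1
    exacts [hzy h1, hza h1, hza h1]
  have key : ∀ {a b p q : V}, a ≠ b → y ≠ a → T.Adj x a → T.Adj x b → p ∈ T.branch x a →
      q ∈ T.branch x b → (∀ v ∈ T.branch y x, T.IsLeaf v → v = p ∨ v = q) → IsLeg T x a p := by
    intro a b p q hab hya ha hb hpa hqb hpq
    rcases hl x a hx ha with ⟨u, hu⟩ | hbr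
    · rcases hpq u (hT.branch_subset h.symm ha hya.symm (hu.mem_branch hT)) hu.isLeaf with rfl | rfl
      · exact hu
      · exact absurd (hT.branch_disjoint ha hb (hu.mem_branch hT) hqb) hab
    · obtain ⟨u, hu, lu, hup⟩ := hT.exists_leaf_mem_branch_ne ha hbr p
      have := (hpq u (hT.branch_subset h.symm ha hya.symm hu) lu).resolve_left hup
      subst this
      exact absurd (hT.branch_disjoint ha hb hu hqb) hab
  exact ⟨a, b, key hab hya ha hb hpa hqb hpq,
    key hab.symm hyb hb ha hqb hpa (fun v hv lv => (hpq v hv lv).symm), hab, hya, hyb, hN⟩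

namespace IsCrossing

variable {x y p₁ q₁ q₂ p₂ : V} (H : IsHalin G T σ) (C : IsCrossing T σ x y p₁ q₁ q₂ p₂)
include H C

lemma two_le_dist3 {a b : V} (ha : a ∈ T.branch y x) (hb : b ∈ T.branch x y)
    (h : ¬ ((a = x ∧ b = y) ∨ (a = p₁ ∧ b = q₁) ∨ (a = p₂ ∧ b = q₂))) : 2 ≤ G.dist3 a b :=
  SimpleGraph.two_le_dist3 (C.ne_of_mem H ha hb) fun hab => h (C.adj_cases H ha hb hab)

lemma mem_of_isLeg {a p : V} (ha : IsLeg T x a p) (hay : y ≠ a) : a ∈ T.branch y x :=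
  H.isTree.branch_subset C.adj.symm ha.adj hay.symm (right_mem_branch ha.adj)

open Classical in
/-- The distance of corresponding legs at `x` and `y` grows with each subdivided leg. -/
lemma dist3_legs {a b p q : V} (ha : IsLeg T x a p) (hb : IsLeg T y b q) (hay : y ≠ a)
    (hbx : x ≠ b) : 1 + (if a = p then 0 else 1) + (if b = q then 0 else 1) ≤ G.dist3 a b := by
  have ma := C.mem_of_isLeg H ha hay
  have mb := C.symm.mem_of_isLeg H hb hbx
  have hne := C.ne_of_mem H ma mb
  have hp₁ := C.leaf_p₁
  have hp₂ := C.leaf_p₂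
  have hq₁ := C.leaf_q₁
  have hq₂ := C.leaf_q₂
  have ka : a ≠ p → ∀ w ∈ T.branch x y, ¬ G.Adj a w := by
    intro hap w hw h
    have na := ha.not_isLeaf hap
    rcases C.adj_cases H ma hw h with ⟨rfl, -⟩ | ⟨rfl, -⟩ | ⟨rfl, -⟩
    exacts [ha.adj.ne rfl, na hp₁, na hp₂]
  have kb : b ≠ q → ∀ w ∈ T.branch y x, ¬ G.Adj w b := by
    intro hbq w hw h
    have nb := hb.not_isLeaf hbq
    rcases C.adj_cases H hw mb h with ⟨-, rfl⟩ | ⟨-, rfl⟩ | ⟨-, rfl⟩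
    exacts [hb.adj.ne rfl, nb hq₁, nb hq₂]
  split_ifs with h1 h2 h2
  · exact one_le_dist3 hne
  · exact SimpleGraph.two_le_dist3 hne (kb h2 a ma)
  · exact SimpleGraph.two_le_dist3 hne (ka h1 b mb)
  · refine three_le_dist3 hne (ka h1 b mb) fun w hw hw' => ?_
    rcases C.mem_or H w with h | h
    exacts [kb h2 w h hw', ka h1 w h hw]

set_option linter.unusedSimpArgs false in
open Classical in
/-- Two leaves on each side of `xy`. The curvature of `xy` allows at most one leg of length two. -/
lemma nonempty_iso_of_four (hpos : G.HasPositiveLLYCurvature) (hl : T.HasLegs) (hq : σ q₁ = q₂)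
    (hp : σ p₂ = p₁) : Nonempty (G ≃g halinH3) ∨ Nonempty (G ≃g halinH4) := by
  have hleaf : ∀ v, T.IsLeaf v → v = p₁ ∨ v = q₁ ∨ v = q₂ ∨ v = p₂ := by
    intro v lv
    refine H.forall_mem {v | v = p₁ ∨ v = q₁ ∨ v = q₂ ∨ v = p₂} ?_ p₁ (by simp) C.leaf_p₁ v lv
    rintro u (rfl | rfl | rfl | rfl) -
    · rw [C.apply_p₁]; simp
    · rw [hq]; simp
    · rw [C.apply_q₂]; simp
    · rw [hp]; simp
  have hx := C.left.not_isLeaf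
  have hy := C.right.not_isLeaf
  obtain ⟨a₁, a₂, la₁, la₂, ha, hya₁, hya₂, hNx⟩ := H.isTree.exists_two_legs hl C.adj C.left
    C.mem_p₁ C.mem_p₂ C.leaf_p₁ C.leaf_p₂ (fun v hv lv => by
      rcases hleaf v lv with h | h | h | h
      · exact Or.inl h
      · exact absurd h (C.ne_of_mem H hv C.mem_q₁)
      · exact absurd h (C.ne_of_mem H hv C.mem_q₂)
      · exact Or.inr h)
  obtain ⟨b₁, b₂, lb₁, lb₂, hb, hxb₁, hxb₂, hNy⟩ := H.isTree.exists_two_legs hl C.adj.symm C.right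
    C.mem_q₁ C.mem_q₂ C.leaf_q₁ C.leaf_q₂ (fun v hv lv => by
      rcases hleaf v lv with h | h | h | h
      · exact absurd h.symm (C.ne_of_mem H C.mem_p₁ hv)
      · exact Or.inl h
      · exact Or.inr h
      · exact absurd h.symm (C.ne_of_mem H C.mem_p₂ hv))
  have gx : ∀ v, G.Adj x v ↔ v = y ∨ v = a₁ ∨ v = a₂ := fun v => by
    rw [H.adj_of_not_isLeaf hx, hNx]
  have gy : ∀ v, G.Adj y v ↔ v = x ∨ v = b₁ ∨ v = b₂ := fun v => by
    rw [H.adj_of_not_isLeaf hy, hNy]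
  have hcub := hpos.cubic H.connected gx gy hya₁ hya₂ ha hxb₁ hxb₂ hb
  have ma₁ := C.mem_of_isLeg H la₁ hya₁
  have ma₂ := C.mem_of_isLeg H la₂ hya₂
  have mb₁ := C.symm.mem_of_isLeg H lb₁ hxb₁
  have mb₂ := C.symm.mem_of_isLeg H lb₂ hxb₂
  have hlp₁ := C.leaf_p₁
  have hlp₂ := C.leaf_p₂
  have hlq₁ := C.leaf_q₁
  have hlq₂ := C.leaf_q₂
  have hnq := C.ne_q
  have hnp := C.ne_p
  have na : ∀ {c w u v : V}, IsLeg T c w u → T.IsLeaf v → v ≠ u → w ≠ v := fun hw lv hvu e => by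
    subst e
    exact hw.not_isLeaf hvu lv
  have d12 := C.two_le_dist3 H ma₁ mb₂ (by
    rintro (⟨h, -⟩ | ⟨-, h⟩ | ⟨h, -⟩)
    exacts [la₁.adj.ne h.symm, na lb₂ hlq₁ hnq h, na la₁ hlp₂ hnp.symm h])
  have d21 := C.two_le_dist3 H ma₂ mb₁ (by
    rintro (⟨h, -⟩ | ⟨h, -⟩ | ⟨-, h⟩)
    exacts [la₂.adj.ne h.symm, na la₂ hlp₁ hnp h, na lb₁ hlq₂ hnq.symm h])
  have d11 := C.dist3_legs H la₁ lb₁ hya₁ hxb₁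
  have d22 := C.dist3_legs H la₂ lb₂ hya₂ hxb₂
  have hcub := hcub.resolve_right (by omega)
  have par : ∀ {c w u : V}, IsLeg T c w u → T.Adj u (if w = u then c else w) := by
    intro c w u hw
    split_ifs with h
    · subst h; exact hw.adj.symm
    · exact hw.adj_leaf h
  have mid : ∀ {c w u : V}, IsLeg T c w u → w ≠ u → ∀ v, G.Adj w v ↔ v = c ∨ v = u :=
    fun hw h v => by rw [H.adj_of_not_isLeaf (hw.not_isLeaf h), hw.adj_iff h]
  have e1 : σ.symm p₁ = p₂ := by rw [← hp, Equiv.symm_apply_apply]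
  have e2 : σ.symm q₁ = p₁ := by rw [← C.apply_p₁, Equiv.symm_apply_apply]
  have e3 : σ.symm q₂ = q₁ := by rw [← hq, Equiv.symm_apply_apply]
  have e4 : σ.symm p₂ = q₂ := by rw [← C.apply_q₂, Equiv.symm_apply_apply]
  have gp₁ := H.adj_of_isLeaf hlp₁ (par la₁)
  have gp₂ := H.adj_of_isLeaf hlp₂ (par la₂)
  have gq₁ := H.adj_of_isLeaf hlq₁ (par lb₁)
  have gq₂ := H.adj_of_isLeaf hlq₂ (par lb₂)
  rw [C.apply_p₁, e1] at gp₁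
  rw [hp, e4] at gp₂
  rw [hq, e2] at gq₁
  rw [C.apply_q₂, e3] at gq₂
  have hxy := C.adj.ne
  have n1 := C.ne_of_mem H C.mem_p₁ C.mem_q₁
  have n2 := C.ne_of_mem H C.mem_p₁ C.mem_q₂
  have n3 := C.ne_of_mem H C.mem_p₂ C.mem_q₁
  have n4 := C.ne_of_mem H C.mem_p₂ C.mem_q₂
  have mxa₁ := la₁.adj.ne
  have mxa₂ := la₂.adj.ne
  have myb₁ := lb₁.adj.ne
  have myb₂ := lb₂.adj.ne
  have hcases : (a₁ = p₁ ∧ a₂ = p₂ ∧ b₁ = q₁ ∧ b₂ = q₂) ∨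
      (a₁ ≠ p₁ ∧ a₂ = p₂ ∧ b₁ = q₁ ∧ b₂ = q₂) ∨ (a₁ = p₁ ∧ a₂ ≠ p₂ ∧ b₁ = q₁ ∧ b₂ = q₂) ∨
      (a₁ = p₁ ∧ a₂ = p₂ ∧ b₁ ≠ q₁ ∧ b₂ = q₂) ∨ (a₁ = p₁ ∧ a₂ = p₂ ∧ b₁ = q₁ ∧ b₂ ≠ q₂) := by
    by_cases h1 : a₁ = p₁ <;> by_cases h2 : a₂ = p₂ <;> by_cases h3 : b₁ = q₁ <;>
      by_cases h4 : b₂ = q₂ <;>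
      (simp only [h1, h2, h3, h4, if_true, if_false] at d11 d22
       try simp only [h1, h2, h3, h4] at hcub
       first
       | (exfalso; omega)
       | simp [h1, h2, h3, h4])
  rcases hcases with ⟨h1, h2, h3, h4⟩ | ⟨h1, h2, h3, h4⟩ | ⟨h1, h2, h3, h4⟩ | ⟨h1, h2, h3, h4⟩ |
    ⟨h1, h2, h3, h4⟩
  · rw [if_pos h1] at gp₁
    rw [if_pos h2] at gp₂
    rw [if_pos h3] at gq₁
    rw [if_pos h4] at gq₂
    rw [h1, h2] at gx
    rw [h3, h4] at gy
    refine Or.inl (H.connected.nonempty_iso_halinH3 (a := y) (b := x) (c := p₂) (d := p₁) (e := q₁)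
      (f := q₂) ?_ (fun w => ?_) (fun w => ?_) (fun w => ?_) (fun w => ?_) (fun w => ?_)
      (fun w => ?_))
    · exact nodup_append_of_isLeaf (T := T) (l := [y, x]) (l' := [p₂, p₁, q₁, q₂])
        (by simp [hxy.symm])
        (by simp [hnp, hnq, n1, n2, n3, n4, hnp.symm, hnq.symm, n1.symm, n2.symm,
        n3.symm, n4.symm])
        (by simp [hx, hy]) (by simp [hlp₁, hlp₂, hlq₁, hlq₂])
    · exact (gy w).trans (iff_of_eq (by ac_rfl))
    · exact (gx w).trans (iff_of_eq (by ac_rfl))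
    · exact (gp₂ w).trans (iff_of_eq (by ac_rfl))
    · exact (gp₁ w).trans (iff_of_eq (by ac_rfl))
    · exact (gq₁ w).trans (iff_of_eq (by ac_rfl))
    · exact (gq₂ w).trans (iff_of_eq (by ac_rfl))
  · rw [if_neg h1] at gp₁
    rw [if_pos h2] at gp₂
    rw [if_pos h3] at gq₁
    rw [if_pos h4] at gq₂
    rw [h2] at gx
    rw [h3, h4] at gy
    refine Or.inr (H.connected.nonempty_iso_halinH4 (a := y) (b := x) (c := p₂) (d := a₁) (e := p₁)
      (f := q₁) (g := q₂) ?_ (fun w => ?_) (fun w => ?_) (fun w => ?_) (fun w => ?_) (fun w => ?_)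
      (fun w => ?_) (fun w => ?_))
    · exact nodup_append_of_isLeaf (T := T) (l := [y, x, a₁]) (l' := [p₂, p₁, q₁, q₂])
        (by simp [hxy, hxy.symm, mxa₁, hya₁])
        (by simp [hnp, hnq, n1, n2, n3, n4, hnp.symm, hnq.symm, n1.symm, n2.symm,
        n3.symm, n4.symm])
        (by simp [hx, hy, la₁.not_isLeaf h1]) (by simp [hlp₁, hlp₂, hlq₁, hlq₂])
    · exact (gy w).trans (iff_of_eq (by ac_rfl))
    · exact (gx w).trans (iff_of_eq (by ac_rfl))
    · exact (gp₂ w).trans (iff_of_eq (by ac_rfl))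
    · exact mid la₁ h1 w
    · exact (gp₁ w).trans (iff_of_eq (by ac_rfl))
    · exact (gq₁ w).trans (iff_of_eq (by ac_rfl))
    · exact (gq₂ w).trans (iff_of_eq (by ac_rfl))
  · rw [if_pos h1] at gp₁
    rw [if_neg h2] at gp₂
    rw [if_pos h3] at gq₁
    rw [if_pos h4] at gq₂
    rw [h1] at gx
    rw [h3, h4] at gy
    refine Or.inr (H.connected.nonempty_iso_halinH4 (a := y) (b := x) (c := p₁) (d := a₂) (e := p₂)
      (f := q₂) (g := q₁) ?_ (fun w => ?_) (fun w => ?_) (fun w => ?_) (fun w => ?_) (fun w => ?_)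
      (fun w => ?_) (fun w => ?_))
    · exact nodup_append_of_isLeaf (T := T) (l := [y, x, a₂]) (l' := [p₁, p₂, q₂, q₁])
        (by simp [hxy, hxy.symm, mxa₂, hya₂])
        (by simp [hnp, hnq, n1, n2, n3, n4, hnp.symm, hnq.symm, n1.symm, n2.symm,
        n3.symm, n4.symm])
        (by simp [hx, hy, la₂.not_isLeaf h2]) (by simp [hlp₁, hlp₂, hlq₁, hlq₂])
    · exact (gy w).trans (iff_of_eq (by ac_rfl))
    · exact (gx w).trans (iff_of_eq (by ac_rfl))
    · exact (gp₁ w).trans (iff_of_eq (by ac_rfl))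
    · exact mid la₂ h2 w
    · exact (gp₂ w).trans (iff_of_eq (by ac_rfl))
    · exact (gq₂ w).trans (iff_of_eq (by ac_rfl))
    · exact (gq₁ w).trans (iff_of_eq (by ac_rfl))
  · rw [if_pos h1] at gp₁
    rw [if_pos h2] at gp₂
    rw [if_neg h3] at gq₁
    rw [if_pos h4] at gq₂
    rw [h1, h2] at gx
    rw [h4] at gy
    refine Or.inr (H.connected.nonempty_iso_halinH4 (a := x) (b := y) (c := q₂) (d := b₁) (e := q₁)
      (f := p₁) (g := p₂) ?_ (fun w => ?_) (fun w => ?_) (fun w => ?_) (fun w => ?_) (fun w => ?_)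
      (fun w => ?_) (fun w => ?_))
    · exact nodup_append_of_isLeaf (T := T) (l := [x, y, b₁]) (l' := [q₂, q₁, p₁, p₂])
        (by simp [hxy, hxy.symm, myb₁, hxb₁])
        (by simp [hnp, hnq, n1, n2, n3, n4, hnp.symm, hnq.symm, n1.symm, n2.symm,
        n3.symm, n4.symm])
        (by simp [hx, hy, lb₁.not_isLeaf h3]) (by simp [hlp₁, hlp₂, hlq₁, hlq₂])
    · exact (gx w).trans (iff_of_eq (by ac_rfl))
    · exact (gy w).trans (iff_of_eq (by ac_rfl))
    · exact (gq₂ w).trans (iff_of_eq (by ac_rfl))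
    · exact mid lb₁ h3 w
    · exact (gq₁ w).trans (iff_of_eq (by ac_rfl))
    · exact (gp₁ w).trans (iff_of_eq (by ac_rfl))
    · exact (gp₂ w).trans (iff_of_eq (by ac_rfl))
  · rw [if_pos h1] at gp₁
    rw [if_pos h2] at gp₂
    rw [if_pos h3] at gq₁
    rw [if_neg h4] at gq₂
    rw [h1, h2] at gx
    rw [h3] at gy
    refine Or.inr (H.connected.nonempty_iso_halinH4 (a := x) (b := y) (c := q₁) (d := b₂) (e := q₂)
      (f := p₂) (g := p₁) ?_ (fun w => ?_) (fun w => ?_) (fun w => ?_) (fun w => ?_) (fun w => ?_)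
      (fun w => ?_) (fun w => ?_))
    · exact nodup_append_of_isLeaf (T := T) (l := [x, y, b₂]) (l' := [q₁, q₂, p₂, p₁])
        (by simp [hxy, hxy.symm, myb₂, hxb₂])
        (by simp [hnp, hnq, n1, n2, n3, n4, hnp.symm, hnq.symm, n1.symm, n2.symm,
        n3.symm, n4.symm])
        (by simp [hx, hy, lb₂.not_isLeaf h4]) (by simp [hlp₁, hlp₂, hlq₁, hlq₂])
    · exact (gx w).trans (iff_of_eq (by ac_rfl))
    · exact (gy w).trans (iff_of_eq (by ac_rfl))
    · exact (gq₁ w).trans (iff_of_eq (by ac_rfl))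
    · exact mid lb₂ h4 w
    · exact (gq₂ w).trans (iff_of_eq (by ac_rfl))
    · exact (gp₂ w).trans (iff_of_eq (by ac_rfl))
    · exact (gp₁ w).trans (iff_of_eq (by ac_rfl))

/-- Two leaves on the side of `x` and three on that of `y`. -/
lemma nonempty_iso_of_five (hl : T.HasLegs) {q₃ : V} (hq : σ q₁ = q₃)
    (hq' : σ q₃ = q₂) (hp : σ p₂ = p₁) (ap₁ : T.Adj p₁ x) (ap₂ : T.Adj p₂ x) (aq₁ : T.Adj q₁ y)
    (aq₂ : T.Adj q₂ y) : Nonempty (G ≃g halinH7) ∨ Nonempty (G ≃g halinH8) := by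
  have hT := H.isTree
  have hlp₁ := C.leaf_p₁
  have hlp₂ := C.leaf_p₂
  have hlq₁ := C.leaf_q₁
  have hlq₂ := C.leaf_q₂
  have hlq₃ : T.IsLeaf q₃ := hq ▸ H.apply_isLeaf _ hlq₁
  have mq₃ : q₃ ∈ T.branch x y := hq ▸ C.symm.apply_mem H C.mem_q₁ hlq₁ C.ne_q
  have hleaf : ∀ v, T.IsLeaf v → v = p₁ ∨ v = q₁ ∨ v = q₃ ∨ v = q₂ ∨ v = p₂ := by
    intro v lv
    refine H.forall_mem {v | v = p₁ ∨ v = q₁ ∨ v = q₃ ∨ v = q₂ ∨ v = p₂} ?_ p₁ (by simp) hlp₁ v lv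
    rintro u (rfl | rfl | rfl | rfl | rfl) -
    · rw [C.apply_p₁]; simp
    · rw [hq]; simp
    · rw [hq']; simp
    · rw [C.apply_q₂]; simp
    · rw [hp]; simp
  have hx := C.left.not_isLeaf
  have hy := C.right.not_isLeaf
  have hxy := C.adj.ne
  have hnp := C.ne_p
  have hnq := C.ne_q
  have hnq₁ : q₁ ≠ q₃ := hq ▸ (H.apply_ne hlq₁).symm
  have hnq₂ : q₂ ≠ q₃ := hq' ▸ H.apply_ne hlq₃
  have hpq : ∀ {p q}, p ∈ T.branch y x → q ∈ T.branch x y → p ≠ q := C.ne_of_mem H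
  have hNx : ∀ v, T.Adj x v ↔ v = y ∨ v = p₁ ∨ v = p₂ := by
    intro v
    constructor
    · intro hv
      by_cases hvy : v = y
      · exact Or.inl hvy
      obtain ⟨u, hu, lu⟩ := hT.exists_leaf_mem_branch hv
      have mu := hT.branch_subset C.adj.symm hv hvy hu
      rcases hleaf u lu with rfl | rfl | rfl | rfl | rfl
      · exact Or.inr (Or.inl (hT.branch_disjoint hv ap₁.symm hu (right_mem_branch ap₁.symm)))
      · exact absurd rfl (hpq mu C.mem_q₁)
      · exact absurd rfl (hpq mu mq₃)
      · exact absurd rfl (hpq mu C.mem_q₂)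
      · exact Or.inr (Or.inr (hT.branch_disjoint hv ap₂.symm hu (right_mem_branch ap₂.symm)))
    · rintro (rfl | rfl | rfl)
      exacts [C.adj, ap₁.symm, ap₂.symm]
  obtain ⟨b, hb, mb⟩ := hT.1.exists_mem_branch (x := y) (v := q₃) (fun e => hy (e ▸ hlq₃))
  have hbx : x ≠ b := fun e => (hT.mem_branch_swap C.adj.symm).1 mq₃ (e ▸ mb)
  have hbq : ∀ {q}, T.IsLeaf q → T.Adj q y → q ≠ q₃ → b ≠ q := by
    rintro q lq aq hne rfl
    exact hne (hT.eq_of_mem_branch hb lq mb).symm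
  have hbq₁ := hbq hlq₁ aq₁ hnq₁
  have hbq₂ := hbq hlq₂ aq₂ hnq₂
  have hbranch : ∀ v, T.Adj y v → v ≠ x → ∀ u ∈ T.branch y v, T.IsLeaf u →
      (u = q₁ ∧ v = q₁) ∨ (u = q₂ ∧ v = q₂) ∨ (u = q₃ ∧ v = b) := by
    intro v hv hvx u hu lu
    have mu := hT.branch_subset C.adj hv hvx hu
    rcases hleaf u lu with rfl | rfl | rfl | rfl | rfl
    · exact absurd rfl (hpq C.mem_p₁ mu)
    · exact Or.inl ⟨rfl, hT.branch_disjoint hv aq₁.symm hu (right_mem_branch aq₁.symm)⟩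
    · exact Or.inr (Or.inr ⟨rfl, hT.branch_disjoint hv hb hu mb⟩)
    · exact Or.inr (Or.inl ⟨rfl, hT.branch_disjoint hv aq₂.symm hu (right_mem_branch aq₂.symm)⟩)
    · exact absurd rfl (hpq C.mem_p₂ mu)
  have hNy : ∀ v, T.Adj y v ↔ v = x ∨ v = q₁ ∨ v = q₂ ∨ v = b := by
    intro v
    constructor
    · intro hv
      by_cases hvx : v = x
      · exact Or.inl hvx
      obtain ⟨u, hu, lu⟩ := hT.exists_leaf_mem_branch hv
      rcases hbranch v hv hvx u hu lu with h | h | h <;> simp [h.2]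
    · rintro (rfl | rfl | rfl | rfl)
      exacts [C.adj.symm, aq₁.symm, aq₂.symm, hb]
  have hone : ∀ u ∈ T.branch y b, T.IsLeaf u → u = q₃ := by
    intro u hu lu
    rcases hbranch b hb hbx.symm u hu lu with h | h | h
    exacts [absurd h.2 hbq₁, absurd h.2 hbq₂, h.1]
  have hleg : IsLeg T y b q₃ := by
    rcases hl y b C.right hb with ⟨u, hu⟩ | hbr
    · rwa [← hone u (hu.mem_branch hT) hu.isLeaf]
    · obtain ⟨u, hu, lu, hne⟩ := hT.exists_leaf_mem_branch_ne hb hbr q₃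
      exact absurd (hone u hu lu) hne
  have gx : ∀ v, G.Adj x v ↔ v = y ∨ v = p₁ ∨ v = p₂ := fun v => by
    rw [H.adj_of_not_isLeaf hx, hNx]
  have gy : ∀ v, G.Adj y v ↔ v = x ∨ v = q₁ ∨ v = q₂ ∨ v = b := fun v => by
    rw [H.adj_of_not_isLeaf hy, hNy]
  have gp₁ := H.adj_of_isLeaf hlp₁ ap₁
  have gp₂ := H.adj_of_isLeaf hlp₂ ap₂
  have gq₁ := H.adj_of_isLeaf hlq₁ aq₁
  have gq₂ := H.adj_of_isLeaf hlq₂ aq₂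
  rw [C.apply_p₁, ← hp, Equiv.symm_apply_apply, hp] at gp₁
  rw [hp, ← C.apply_q₂, Equiv.symm_apply_apply, C.apply_q₂] at gp₂
  rw [hq, ← C.apply_p₁, Equiv.symm_apply_apply, C.apply_p₁] at gq₁
  rw [C.apply_q₂, ← hq', Equiv.symm_apply_apply, hq'] at gq₂
  have nd : [p₂, p₁, q₁, q₃, q₂].Nodup := by
    simp [hnp.symm, hnq, hnq₁, hnq₂.symm, hpq C.mem_p₁ C.mem_q₁, hpq C.mem_p₁ C.mem_q₂,
      hpq C.mem_p₂ C.mem_q₁, hpq C.mem_p₂ C.mem_q₂, hpq C.mem_p₁ mq₃, hpq C.mem_p₂ mq₃]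
  have ndl : ∀ v ∈ [p₂, p₁, q₁, q₃, q₂], T.IsLeaf v := by simp [hlp₁, hlp₂, hlq₁, hlq₂, hlq₃]
  by_cases hbq₃ : b = q₃
  · subst hbq₃
    have gb := H.adj_of_isLeaf hlq₃ hb.symm
    rw [hq', ← hq, Equiv.symm_apply_apply, hq] at gb
    refine Or.inl (H.connected.nonempty_iso_halinH7 (a := y) (b := x) (c := p₂) (d := p₁) (e := q₁)
      (f := b) (g := q₂)
      (nodup_append_of_isLeaf (T := T) (l := [y, x]) (by simp [hxy.symm]) nd (by simp [hx, hy]) ndl)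
      (fun w => ?_) (fun w => ?_) (fun w => ?_) (fun w => ?_) (fun w => ?_) (fun w => ?_)
      (fun w => ?_))
    · exact (gy w).trans (iff_of_eq (by ac_rfl))
    · exact (gx w).trans (iff_of_eq (by ac_rfl))
    · exact (gp₂ w).trans (iff_of_eq (by ac_rfl))
    · exact (gp₁ w).trans (iff_of_eq (by ac_rfl))
    · exact (gq₁ w).trans (iff_of_eq (by ac_rfl))
    · exact (gb w).trans (iff_of_eq (by ac_rfl))
    · exact (gq₂ w).trans (iff_of_eq (by ac_rfl))
  · have nb := hleg.not_isLeaf hbq₃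
    have gb : ∀ v, G.Adj b v ↔ v = y ∨ v = q₃ := fun v => by
      rw [H.adj_of_not_isLeaf nb, hleg.adj_iff hbq₃]
    have gq₃ := H.adj_of_isLeaf hlq₃ (hleg.adj_leaf hbq₃)
    rw [hq', ← hq, Equiv.symm_apply_apply, hq] at gq₃
    refine Or.inr (H.connected.nonempty_iso_halinH8 (a := y) (b := x) (c := p₂) (d := p₁) (e := q₁)
      (f := q₃) (g := q₂) (h := b)
      (nodup_append_of_isLeaf (T := T) (l := [y, x, b]) (by simp [hxy.symm, hbx, hb.ne]) nd
        (by simp [hx, hy, nb]) ndl)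
      (fun w => ?_) (fun w => ?_) (fun w => ?_) (fun w => ?_) (fun w => ?_) (fun w => ?_)
      (fun w => ?_) (fun w => ?_))
    · exact (gy w).trans (iff_of_eq (by ac_rfl))
    · exact (gx w).trans (iff_of_eq (by ac_rfl))
    · exact (gp₂ w).trans (iff_of_eq (by ac_rfl))
    · exact (gp₁ w).trans (iff_of_eq (by ac_rfl))
    · exact (gq₁ w).trans (iff_of_eq (by ac_rfl))
    · exact (gq₃ w).trans (iff_of_eq (by ac_rfl))
    · exact (gq₂ w).trans (iff_of_eq (by ac_rfl))
    · exact (gb w).trans (iff_of_eq (by ac_rfl))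

end IsCrossing

/-- Two adjacent vertices of degree at least three in the tree. -/
lemma IsHalin.nonempty_iso_of_adj (H : IsHalin G T σ) (hpos : G.HasPositiveLLYCurvature)
    (hl : T.HasLegs) {x y : V} (h : T.Adj x y) (hx : T.IsBranchVertex x) (hy : T.IsBranchVertex y) :
    Nonempty (G ≃g halinH3) ∨ Nonempty (G ≃g halinH4) ∨ Nonempty (G ≃g halinH7) ∨
      Nonempty (G ≃g halinH8) := by
  obtain ⟨p₁, q₁, q₂, p₂, C⟩ := H.exists_isCrossing h hx hy
  have five : ∀ {x y p₁ q₁ q₂ p₂ : V}, IsCrossing T σ x y p₁ q₁ q₂ p₂ → T.Adj p₁ x → T.Adj q₁ y →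
      σ (σ q₁) = q₂ → σ p₂ = p₁ → Nonempty (G ≃g halinH7) ∨ Nonempty (G ≃g halinH8) := by
    intro x y p₁ q₁ q₂ p₂ C h1 h2 h3 h4
    rcases C.symm.cases_of_pos H hpos with ⟨-, h⟩ | ⟨h5, h6, -⟩
    · rw [h] at h3
      exact absurd h3 (H.apply_ne C.leaf_q₂)
    · exact C.nonempty_iso_of_five H hl rfl h3 h4 h1 h6 h2 h5
  rcases C.cases_of_pos H hpos with ⟨h1, h2⟩ | ⟨h1, h2, ⟨h3, h4⟩ | ⟨h3, h4⟩⟩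
  · rcases C.nonempty_iso_of_four H hpos hl h1 h2 with h | h <;> simp [h]
  · rcases five C h1 h2 h3 h4 with h | h <;> simp [h]
  · have hC := C.symm.cases_of_pos H hpos
    rcases hC with ⟨h, -⟩ | ⟨h5, h6, -⟩
    · rw [h] at h4
      exact absurd h4 (H.apply_ne C.leaf_p₁)
    · rcases five C.symm h5 h6 h4 h3 with h | h <;> simp [h]

end FewLeaves

/-! ### Trees with legs at a single vertex -/

section Spider

variable {V : Type*} [Fintype V] {G T : SimpleGraph V} {σ : Equiv.Perm V}

/-- All branches of the tree at `c` are legs. The `k` legs are numbered by the integers modulo `k`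
in the order of the leaf cycle: `ℓ i` is the leaf at the end of the `i`-th leg and `m i` is the
neighbour of `c` on it. So the leg has length two if `m i ≠ ℓ i`, and length one otherwise. -/
structure IsSpider (T : SimpleGraph V) (σ : Equiv.Perm V) (c : V) (k : ℕ) (ℓ m : ℤ → V) :
    Prop where
  three_le : 3 ≤ k
  isLeg : ∀ i, IsLeg T c (m i) (ℓ i)
  eq_iff : ∀ i j, ℓ i = ℓ j ↔ (k : ℤ) ∣ i - j
  apply_eq : ∀ i, σ (ℓ i) = ℓ (i + 1)
  exists_eq : ∀ w, T.Adj c w → ∃ i, w = m i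
  mid_eq : ∀ i j, ℓ i = ℓ j → m i = m j
  not_isLeaf : ¬ T.IsLeaf c

/-- A leg has only one leaf. -/
lemma IsTree.eq_leaf_of_mem_branch (hT : T.IsTree) {c w u v : V} (h : IsLeg T c w u)
    (lv : T.IsLeaf v) (hv : v ∈ T.branch c w) : v = u := by
  by_cases hw : w = u
  · subst hw; exact hT.eq_of_mem_branch h.adj h.isLeaf hv
  · have hvw : w ≠ v := fun e => h.not_isLeaf hw (e ▸ lv)
    obtain ⟨z, hz, hvz⟩ := hT.1.exists_mem_branch hvw
    rcases (h.adj_iff hw z).1 hz with rfl | rfl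
    · exact absurd hv ((hT.mem_branch_swap h.adj).1 hvz)
    · exact hT.eq_of_mem_branch hz h.isLeaf hvz

lemma IsHalin.exists_isSpider (H : IsHalin G T σ) {c : V} (hc : T.IsBranchVertex c)
    (hl : ∀ w, T.Adj c w → ∃ u, IsLeg T c w u) : ∃ k ℓ m, IsSpider T σ c k ℓ m := by
  classical
  have hleg : ∀ u, ∃ w, T.IsLeaf u → IsLeg T c w u := by
    intro u
    by_cases lu : T.IsLeaf u
    · obtain ⟨w, hw, hu⟩ := H.isTree.1.exists_mem_branch (x := c) (v := u)
        (fun e => hc.not_isLeaf (e ▸ lu))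
      obtain ⟨u', hu'⟩ := hl w hw
      obtain rfl := H.isTree.eq_leaf_of_mem_branch hu' lu hu
      exact ⟨w, fun _ => hu'⟩
    · exact ⟨u, fun h => absurd h lu⟩
  choose f hf using hleg
  set L : Finset V := Finset.univ.filter T.IsLeaf with hL
  have hmem : ∀ v, v ∈ L ↔ T.IsLeaf v := fun v => by simp [hL]
  have hcyc : σ.IsCycleOn (L : Set V) := by
    refine ⟨⟨fun u hu => ?_, σ.injective.injOn, fun u hu => ?_⟩, fun u hu v hv => ?_⟩
    · simp only [Finset.mem_coe, hmem] at hu ⊢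
      exact H.apply_isLeaf u hu
    · simp only [Finset.mem_coe, hmem] at hu
      exact ⟨σ.symm u, by simpa [hmem] using H.isLeaf_symm hu, by simp⟩
    · simp only [Finset.mem_coe, hmem] at hu hv
      exact H.forall_mem {v | σ.SameCycle u v} (fun a ha _ => ha.apply_right) u
        (Equiv.Perm.SameCycle.refl σ u) hu v hv
  obtain ⟨u₀, l₀, -⟩ := H.isTree.exists_leaf_ne hc c c
  have hm₀ : u₀ ∈ L := (hmem u₀).2 l₀
  have hleaf : ∀ i : ℤ, T.IsLeaf ((σ ^ i) u₀) := fun i => by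
    rw [← hmem, ← Finset.mem_coe]
    exact (hcyc.1.perm_zpow i).mapsTo hm₀
  refine ⟨L.card, fun i => (σ ^ i) u₀, fun i => f ((σ ^ i) u₀), ?_, fun i => hf _ (hleaf i), ?_, ?_,
    ?_, fun i j h => congrArg f h, hc.not_isLeaf⟩
  · by_contra hlt
    obtain ⟨u₁, l₁, h₁, -⟩ := H.isTree.exists_leaf_ne hc u₀ u₀
    obtain ⟨u₂, l₂, h₂, h₂'⟩ := H.isTree.exists_leaf_ne hc u₀ u₁
    have hsub : ({u₀, u₁, u₂} : Finset V) ⊆ L := by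
      intro v hv
      simp only [Finset.mem_insert, Finset.mem_singleton] at hv
      rcases hv with rfl | rfl | rfl <;> rwa [hmem]
    have h3 : ({u₀, u₁, u₂} : Finset V).card = 3 :=
      Finset.card_eq_three.2 ⟨_, _, _, h₁.symm, h₂.symm, h₂'.symm, rfl⟩
    have := Finset.card_le_card hsub
    omega
  · intro i j
    rw [hcyc.zpow_apply_eq_zpow_apply hm₀, Int.modEq_comm, Int.modEq_iff_dvd]
  · intro i
    rw [add_comm, zpow_add, zpow_one, Equiv.Perm.mul_apply]
  · intro w hw
    obtain ⟨u, hu⟩ := hl w hw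
    obtain ⟨n, -, hn⟩ := hcyc.exists_pow_eq hm₀ ((hmem u).2 hu.isLeaf)
    refine ⟨n, ?_⟩
    have e : (σ ^ (n : ℤ)) u₀ = u := by rw [zpow_natCast, hn]
    change w = f ((σ ^ (n : ℤ)) u₀)
    rw [e]
    have h1 := hf u hu.isLeaf
    exact H.isTree.branch_disjoint hw h1.adj (hu.mem_branch H.isTree) (h1.mem_branch H.isTree)

namespace IsSpider

variable {c : V} {k : ℕ} {ℓ m : ℤ → V} (S : IsSpider T σ c k ℓ m)
include S

/-- Renumbering of the legs. -/
lemma shift (a : ℤ) : IsSpider T σ c k (fun i => ℓ (i + a)) (fun i => m (i + a)) := by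
  refine ⟨S.three_le, fun i => S.isLeg _, fun i j => ?_, fun i => ?_, fun w hw => ?_,
    fun i j h => S.mid_eq _ _ h, S.not_isLeaf⟩
  · rw [S.eq_iff]; congr! 1; ring
  · rw [S.apply_eq]; congr 1; ring
  · obtain ⟨i, rfl⟩ := S.exists_eq w hw
    exact ⟨i - a, by simp⟩

lemma leaf (i : ℤ) : T.IsLeaf (ℓ i) := (S.isLeg i).isLeaf

lemma leaf_ne {i j : ℤ} (h : i < j) (h' : j < i + k) : ℓ i ≠ ℓ j := fun e => by
  have := Int.le_of_dvd (by omega) ((S.eq_iff j i).1 e.symm)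
  omega

lemma periodic (i : ℤ) : ℓ (i + k) = ℓ i := (S.eq_iff _ _).2 (by simp)

lemma mid_periodic (i : ℤ) : m (i + k) = m i := S.mid_eq _ _ (S.periodic i)

lemma ne_leaf (i : ℤ) : c ≠ ℓ i := fun e => S.not_isLeaf (e ▸ S.leaf i)

lemma ne_mid (i : ℤ) : c ≠ m i := (S.isLeg i).adj.ne

lemma mid_inj {i j : ℤ} (h : m i = m j) : ℓ i = ℓ j := by
  by_cases hi : m i = ℓ i <;> by_cases hj : m j = ℓ j
  · rw [← hi, h, hj]
  · exact absurd (h ▸ hi ▸ S.leaf i) ((S.isLeg j).not_isLeaf hj)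
  · exact absurd (h ▸ hj ▸ S.leaf j) ((S.isLeg i).not_isLeaf hi)
  · have := ((S.isLeg j).adj_leaf hj).symm
    rw [← h, (S.isLeg i).adj_iff hi] at this
    exact (this.resolve_left (S.ne_leaf j).symm).symm

lemma mid_ne_leaf {i : ℤ} (hi : m i ≠ ℓ i) (j : ℤ) : m i ≠ ℓ j := fun e =>
  (S.isLeg i).not_isLeaf hi (e ▸ S.leaf j)

lemma symm_eq (i : ℤ) : σ.symm (ℓ i) = ℓ (i - 1) := by
  rw [Equiv.symm_apply_eq, S.apply_eq, sub_add_cancel]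

section Graph

variable (H : IsHalin G T σ)
include H

lemma adj_centre (v : V) : G.Adj c v ↔ ∃ i, v = m i := by
  rw [H.adj_of_not_isLeaf S.not_isLeaf]
  exact ⟨S.exists_eq v, fun ⟨i, h⟩ => h ▸ (S.isLeg i).adj⟩

lemma adj_mid {i : ℤ} (hi : m i ≠ ℓ i) (v : V) : G.Adj (m i) v ↔ v = c ∨ v = ℓ i := by
  rw [H.adj_of_not_isLeaf ((S.isLeg i).not_isLeaf hi), (S.isLeg i).adj_iff hi]

lemma adj_short {i : ℤ} (hi : m i = ℓ i) (v : V) :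
    G.Adj (ℓ i) v ↔ v = c ∨ v = ℓ (i + 1) ∨ v = ℓ (i - 1) := by
  rw [H.adj_of_isLeaf (S.leaf i) (hi ▸ (S.isLeg i).adj.symm), S.apply_eq, S.symm_eq]

lemma adj_long {i : ℤ} (hi : m i ≠ ℓ i) (v : V) :
    G.Adj (ℓ i) v ↔ v = m i ∨ v = ℓ (i + 1) ∨ v = ℓ (i - 1) := by
  rw [H.adj_of_isLeaf (S.leaf i) ((S.isLeg i).adj_leaf hi), S.apply_eq, S.symm_eq]

lemma adj_leaf_leaf (i j : ℤ) : G.Adj (ℓ i) (ℓ j) ↔ ℓ j = ℓ (i + 1) ∨ ℓ j = ℓ (i - 1) := by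
  by_cases hi : m i = ℓ i
  · rw [S.adj_short H hi]
    simp [(S.ne_leaf j).symm]
  · rw [S.adj_long H hi]
    simp [(S.mid_ne_leaf hi j).symm]

lemma not_adj_leaf {i j : ℤ} (h : i + 1 < j) (h' : j + 1 < i + k) : ¬ G.Adj (ℓ i) (ℓ j) := by
  rw [S.adj_leaf_leaf H]
  rintro (e | e)
  · exact S.leaf_ne (by omega) (by omega) e.symm
  · exact S.leaf_ne (by omega) (by omega) e.symm

lemma not_adj_mid_leaf {i j : ℤ} (hi : m i ≠ ℓ i) (h : ℓ i ≠ ℓ j) : ¬ G.Adj (m i) (ℓ j) := by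
  rw [S.adj_mid H hi]
  rintro (e | e)
  exacts [S.ne_leaf j e.symm, h e.symm]

lemma not_adj_mid_mid {i : ℤ} (hi : m i ≠ ℓ i) (j : ℤ) (h : ℓ i ≠ ℓ j) : ¬ G.Adj (m i) (m j) := by
  rw [S.adj_mid H hi]
  rintro (e | e)
  · exact S.ne_mid j e.symm
  · by_cases hj : m j = ℓ j
    · exact h (e ▸ hj)
    · exact S.mid_ne_leaf hj i e

/-- The neighbours of the centre. -/
lemma exists_finset : ∃ Y : Finset V, Y.card = k ∧ (∀ v, v ∈ Y ↔ G.Adj c v) ∧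
    ∀ g : V → ℤ, ∑ v ∈ Y, g v = ∑ i ∈ Finset.range k, g (m i) := by
  classical
  have hinj : Set.InjOn (fun i : ℕ => m i) (Finset.range k : Set ℕ) := by
    intro i hi j hj h
    simp only [Finset.coe_range, Set.mem_Iio] at hi hj
    have h := S.mid_inj h
    by_contra hne
    rcases Nat.lt_or_gt_of_ne hne with h1 | h1
    · exact S.leaf_ne (by omega) (by omega) h
    · exact S.leaf_ne (by omega) (by omega) h.symm
  refine ⟨(Finset.range k).image fun i : ℕ => m i, ?_, fun v => ?_, fun g => ?_⟩
  · rw [Finset.card_image_of_injOn hinj, Finset.card_range]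
  · rw [S.adj_centre H]
    simp only [Finset.mem_image, Finset.mem_range]
    constructor
    · rintro ⟨i, -, rfl⟩
      exact ⟨i, rfl⟩
    · rintro ⟨i, rfl⟩
      have hk : (0 : ℤ) < k := by have := S.three_le; omega
      have h0 := Int.emod_nonneg i hk.ne'
      have h1 := Int.emod_lt_of_pos i hk
      refine ⟨(i % k).toNat, by omega, S.mid_eq _ _ ?_⟩
      rw [S.eq_iff, Int.toNat_of_nonneg h0]
      exact dvd_sub_comm.1 Int.dvd_self_sub_emod
  · rw [Finset.sum_image hinj]

variable (hpos : G.HasPositiveLLYCurvature)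
include hpos

/-- Two consecutive legs of length two. -/
lemma le_four {i : ℤ} (h : m i ≠ ℓ i) (h' : m (i + 1) ≠ ℓ (i + 1)) : k ≤ 4 := by
  by_contra hk
  have e1 : i + 1 - 1 = i := by ring
  have e2 : i + 1 + 1 = i + 2 := by ring
  have n1 : ℓ i ≠ ℓ (i + 1) := S.leaf_ne (by omega) (by omega)
  have n2 : ℓ (i - 1) ≠ ℓ i := S.leaf_ne (by omega) (by omega)
  have n3 : ℓ (i - 1) ≠ ℓ (i + 1) := S.leaf_ne (by omega) (by omega)
  have n4 : ℓ (i - 1) ≠ ℓ (i + 2) := S.leaf_ne (by omega) (by omega)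
  have n5 : ℓ i ≠ ℓ (i + 2) := S.leaf_ne (by omega) (by omega)
  have n6 : ℓ (i + 1) ≠ ℓ (i + 2) := S.leaf_ne (by omega) (by omega)
  have d11 : 2 ≤ G.dist3 (m i) (m (i + 1)) :=
    two_le_dist3 (fun e => n1 (S.mid_inj e)) (S.not_adj_mid_mid H h _ n1)
  have d22 : 2 ≤ G.dist3 (ℓ (i - 1)) (ℓ (i + 2)) :=
    two_le_dist3 n4 (S.not_adj_leaf H (by omega) (by omega))
  have d12 : 2 ≤ G.dist3 (m i) (ℓ (i + 2)) :=
    two_le_dist3 (S.mid_ne_leaf h _) (S.not_adj_mid_leaf H h n5)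
  have d21 : 2 ≤ G.dist3 (ℓ (i - 1)) (m (i + 1)) := by
    rw [dist3_comm]
    exact two_le_dist3 (S.mid_ne_leaf h' _) (S.not_adj_mid_leaf H h' n3.symm)
  have := hpos.cubic H.connected (x := ℓ i) (y := ℓ (i + 1)) (a₁ := m i) (a₂ := ℓ (i - 1))
    (b₁ := m (i + 1)) (b₂ := ℓ (i + 2))
    (fun v => (S.adj_long H h v).trans (iff_of_eq (by ac_rfl)))
    (fun v => by rw [S.adj_long H h', e1, e2]; exact iff_of_eq (by ac_rfl))
    (S.mid_ne_leaf h _).symm n3.symm (S.mid_ne_leaf h _) (S.mid_ne_leaf h' _).symm n5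
    (S.mid_ne_leaf h' _)
  omega

/-- Two legs of length two with a single leg of length one between them. -/
lemma le_five {i : ℤ} (h : m i ≠ ℓ i) (h' : m (i + 1) = ℓ (i + 1))
    (h'' : m (i + 2) ≠ ℓ (i + 2)) : k ≤ 5 := by
  by_contra hk
  have e1 : i + 1 - 1 = i := by ring
  have e2 : i + 1 + 1 = i + 2 := by ring
  have e3 : i + 2 - 1 = i + 1 := by ring
  have e4 : i + 2 + 1 = i + 3 := by ring
  have n0 : ℓ i ≠ ℓ (i + 1) := S.leaf_ne (by omega) (by omega)
  have n1 : ℓ i ≠ ℓ (i + 2) := S.leaf_ne (by omega) (by omega)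
  have n2 : ℓ (i - 1) ≠ ℓ (i + 1) := S.leaf_ne (by omega) (by omega)
  have n3 : ℓ (i - 1) ≠ ℓ (i + 2) := S.leaf_ne (by omega) (by omega)
  have n4 : ℓ i ≠ ℓ (i + 3) := S.leaf_ne (by omega) (by omega)
  have d12 : 1 ≤ G.dist3 c (ℓ (i - 1)) := one_le_dist3 (S.ne_leaf _)
  have d11 : 1 ≤ G.dist3 c (m i) := one_le_dist3 (S.ne_mid _)
  have a1 : ¬ G.Adj (ℓ (i - 1)) (ℓ (i + 2)) := S.not_adj_leaf H (by omega) (by omega)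
  have d22 : 3 ≤ G.dist3 (ℓ (i + 2)) (ℓ (i - 1)) := by
    refine three_le_dist3 n3.symm (fun h => a1 h.symm) fun w hw => ?_
    rw [S.adj_long H h'', e3, e4] at hw
    rcases hw with rfl | rfl | rfl
    · exact S.not_adj_mid_leaf H h'' n3.symm
    · exact fun h => S.not_adj_leaf H (by omega) (by omega) h.symm
    · exact fun h => S.not_adj_leaf H (by omega) (by omega) h.symm
  have d21 : 3 ≤ G.dist3 (m i) (ℓ (i + 2)) := by
    refine three_le_dist3 (S.mid_ne_leaf h _) (S.not_adj_mid_leaf H h n1) fun w hw => ?_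
    rcases (S.adj_mid H h w).1 hw with rfl | rfl
    · rw [G.adj_comm, S.adj_long H h'']
      rintro (e | e | e)
      exacts [S.ne_mid _ e, S.ne_leaf _ e, S.ne_leaf _ e]
    · exact S.not_adj_leaf H (by omega) (by omega)
  have := hpos.cubic H.connected (x := ℓ (i + 1)) (y := ℓ i) (a₁ := c) (a₂ := ℓ (i + 2))
    (b₁ := m i) (b₂ := ℓ (i - 1))
    (fun v => by rw [S.adj_short H h', e1, e2]; exact iff_of_eq (by ac_rfl))
    (fun v => (S.adj_long H h v).trans (iff_of_eq (by ac_rfl)))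
    (S.ne_leaf _).symm n1 (S.ne_leaf _) (S.mid_ne_leaf h _).symm n2.symm (S.mid_ne_leaf h _)
  rw [G.dist3_comm (ℓ (i + 2)) (m i)] at this
  omega

/-- With a leg of length two, `k` is bounded through the number of legs of length one next to it. -/
lemma lt_of_long {i : ℤ} (h : m i ≠ ℓ i) {Z : Finset V}
    (hZ : ∀ j, m j = ℓ j → (ℓ j = ℓ (i + 1) ∨ ℓ j = ℓ (i - 1)) → ℓ j ∈ Z) :
    k < 4 + 2 * Z.card := by
  obtain ⟨Y, hY, hYc, -⟩ := S.exists_finset H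
  rw [← hY]
  refine hpos.card_lt H.connected (S.adj_mid H h) (S.ne_leaf i).symm ?_ hYc fun v hv hv' hvi => ?_
  · rw [S.adj_long H h]
    rintro (e | e | e)
    exacts [S.ne_mid _ e, S.ne_leaf _ e, S.ne_leaf _ e]
  · obtain ⟨j, rfl⟩ := (S.adj_centre H v).1 hv
    have hlv := ((S.adj_long H h _).1 hv').resolve_left hvi
    have hj : m j = ℓ j := by
      by_contra hj
      rcases hlv with e | e <;> exact S.mid_ne_leaf hj _ e
    rw [hj] at hlv ⊢
    exact hZ j hj hlv

lemma lt_eight {i : ℤ} (h : m i ≠ ℓ i) : k < 8 := by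
  classical
  have := S.lt_of_long H hpos h (Z := {ℓ (i + 1), ℓ (i - 1)}) (fun j _ hj => by simpa using hj)
  have h2 : ({ℓ (i + 1), ℓ (i - 1)} : Finset V).card ≤ 2 := Finset.card_le_two
  omega

/-- Three consecutive legs of length two. -/
lemma lt_four {i : ℤ} (h : m i ≠ ℓ i) (h' : m (i + 1) ≠ ℓ (i + 1))
    (h'' : m (i + 2) ≠ ℓ (i + 2)) : k < 4 := by
  refine S.lt_of_long H hpos h' (Z := ∅) fun j hj hj' => ?_
  exfalso
  rw [add_sub_cancel_right, add_assoc] at hj'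
  rcases hj' with e | e
  · exact h'' ((S.mid_eq _ _ e).symm.trans (hj.trans e))
  · exact h ((S.mid_eq _ _ e).symm.trans (hj.trans e))

/-- A wheel of positive curvature has fewer than twelve spokes. -/
lemma lt_twelve (h : ∀ i, m i = ℓ i) : k < 12 := by
  classical
  by_contra hk
  obtain ⟨Y, hY, hYc, hYs⟩ := S.exists_finset H
  have n1 : ℓ 0 ≠ ℓ 1 := S.leaf_ne (by omega) (by omega)
  have n2 : ℓ (-1) ≠ ℓ 1 := S.leaf_ne (by omega) (by omega)
  have hX : ∀ v, v ∈ ({c, ℓ 1, ℓ (-1)} : Finset V) ↔ G.Adj (ℓ 0) v := fun v => by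
    rw [S.adj_short H (h 0)]; simp
  have hcX : ({c, ℓ 1, ℓ (-1)} : Finset V).card = 3 :=
    Finset.card_eq_three.2 ⟨_, _, _, S.ne_leaf 1, S.ne_leaf (-1), n2.symm, rfl⟩
  -- The potential is the distance to the set formed by the leaf `ℓ 0` and its two neighbours on
  -- the rim.
  set g : V → ℤ := fun v =>
    min (G.dist3 (ℓ 0) v : ℤ) (min (G.dist3 (ℓ 1) v) (G.dist3 (ℓ (-1)) v)) with hg
  have hadj : ∀ i, G.Adj (ℓ i) c := fun i => (S.adj_short H (h i) c).2 (Or.inl rfl)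
  have g0 : g (ℓ 0) = 0 := by simp [hg, dist3_self]
  have g1 : g (ℓ 1) = 0 := by simp [hg, dist3_self]
  have g2 : g (ℓ (-1)) = 0 := by simp [hg, dist3_self]
  have gc : g c = 1 := by simp [hg, dist3_eq_one.2 (hadj _)]
  have key := hpos.sum_lt H.connected (hadj 0) hX hYc g (fun a b _ _ => by
    have h1 := G.dist3_triangle (ℓ 0) a b
    have h2 := G.dist3_triangle (ℓ 1) a b
    have h3 := G.dist3_triangle (ℓ (-1)) a b
    simp only [hg]
    omega) (by rw [gc, g0]; norm_num)
  rw [hcX, hY, hYs, Finset.sum_insert (by simp [S.ne_leaf]), Finset.sum_pair n2.symm, gc, g1,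
    g2] at key
  -- The potential is `2` at all but five leaves: it vanishes at `ℓ 0`, `ℓ 1` and `ℓ (k - 1)`, and
  -- it is `1` next to them.
  have hlow : ∀ i ∈ Finset.range k, (2 : ℤ) - (if i = 0 then 2 else 0) - (if i = 1 then 2 else 0)
      - (if i = k - 1 then 2 else 0) - (if i = 2 then 1 else 0) - (if i = k - 2 then 1 else 0)
      ≤ g (m i) := by
    intro i hi
    have hik := Finset.mem_range.1 hi
    rw [h]
    have hd : ∀ a : ℤ, a + 1 < i → (i : ℤ) + 1 < a + k → 2 ≤ G.dist3 (ℓ a) (ℓ i) := fun a h1 h2 =>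
      two_le_dist3 (S.leaf_ne (by omega) (by omega)) (S.not_adj_leaf H h1 h2)
    have hd' : ∀ a : ℤ, a < i → (i : ℤ) < a + k → 1 ≤ G.dist3 (ℓ a) (ℓ i) := fun a h1 h2 =>
      one_le_dist3 (S.leaf_ne (by omega) (by omega))
    have hnn : 0 ≤ g (ℓ i) := by simp only [hg]; omega
    by_cases c1 : i = 0 ∨ i = 1 ∨ i = k - 1
    · rcases c1 with rfl | rfl | rfl
      · simp only [if_true]; split_ifs <;> omega
      · simp only [if_true]; split_ifs <;> omega
      · simp only [if_true]; split_ifs <;> omega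
    · have a1 := hd' 0 (by omega) (by omega)
      have a2 := hd' 1 (by omega) (by omega)
      have a3 := hd' (-1) (by omega) (by omega)
      by_cases c2 : i = 2 ∨ i = k - 2
      · have : 1 ≤ g (ℓ i) := by simp only [hg]; omega
        rcases c2 with rfl | rfl
        · simp only [if_true]; split_ifs <;> omega
        · simp only [if_true]; split_ifs <;> omega
      · have b1 := hd 0 (by omega) (by omega)
        have b2 := hd 1 (by omega) (by omega)
        have b3 := hd (-1) (by omega) (by omega)
        have : 2 ≤ g (ℓ i) := by simp only [hg]; omega
        split_ifs <;> omega
  have hs := Finset.sum_le_sum hlow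
  simp only [Finset.sum_sub_distrib, Finset.sum_const, Finset.card_range, nsmul_eq_mul,
    Finset.sum_ite_eq', Finset.mem_range] at hs
  rw [if_pos (by omega), if_pos (by omega), if_pos (by omega), if_pos (by omega),
    if_pos (by omega)] at hs
  push_cast at key
  omega

end Graph

end IsSpider

end Spider

/-! ### Wheels with subdivided spokes -/

section Wheels

lemma subdivide_adj_some_some {W : Type*} (H : SimpleGraph W) (e : Sym2 W) (u v : W) :
    (H.subdivide e).Adj (some u) (some v) ↔ H.Adj u v ∧ s(u, v) ≠ e := by
  simp only [subdivide, fromRel_adj, ne_eq, Option.some.injEq]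
  rw [H.adj_comm v u, Sym2.eq_swap (a := v), or_self]
  exact ⟨And.right, fun h => ⟨h.1.ne, h⟩⟩

lemma subdivide_adj_none_some {W : Type*} (H : SimpleGraph W) (e : Sym2 W) (v : W) :
    (H.subdivide e).Adj none (some v) ↔ v ∈ e := by
  simp [subdivide, fromRel_adj]

lemma wheel_adj {n : ℕ} (i j : Fin n) : (wheel n).Adj i j ↔ i ≠ j ∧ (i.val = 0 ∨ j.val = 0 ∨
    j.val = i.val + 1 ∨ i.val = j.val + 1 ∨ (i.val = 1 ∧ j.val = n - 1) ∨
    (j.val = 1 ∧ i.val = n - 1)) := by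
  rw [wheel, fromRel_adj]
  tauto

variable {V : Type*} [Fintype V] {G T : SimpleGraph V} {σ : Equiv.Perm V}

namespace IsSpider

variable {c : V} {k : ℕ} {ℓ m : ℤ → V} (S : IsSpider T σ c k ℓ m) (H : IsHalin G T σ)
include S

/-- The legs are numbered from `1` to `k`, as the rim of a wheel is. -/
lemma exists_natCast (i : ℤ) : ∃ j : ℕ, 1 ≤ j ∧ j ≤ k ∧ ℓ i = ℓ j ∧ m i = m j := by
  have hk : (0 : ℤ) < k := by have := S.three_le; omega
  have h0 := Int.emod_nonneg (i - 1) hk.ne'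
  have h1 := Int.emod_lt_of_pos (i - 1) hk
  have e : ℓ i = ℓ (((i - 1) % k).toNat + 1 : ℕ) := by
    rw [S.eq_iff]
    push_cast
    rw [Int.toNat_of_nonneg h0]
    have := Int.dvd_self_sub_emod (x := i - 1) (m := k)
    rwa [show i - ((i - 1) % k + 1) = i - 1 - (i - 1) % k by ring]
  exact ⟨_, by omega, by omega, e, S.mid_eq _ _ e⟩

lemma leaf_eq_iff {i j : ℕ} (hi : 1 ≤ i) (hik : i ≤ k) (hj : 1 ≤ j) (hjk : j ≤ k) :
    ℓ i = ℓ j ↔ i = j := by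
  refine ⟨fun h => ?_, fun h => h ▸ rfl⟩
  by_contra hne
  rcases Nat.lt_or_gt_of_ne hne with h1 | h1
  · exact S.leaf_ne (by omega) (by omega) h
  · exact S.leaf_ne (by omega) (by omega) h.symm

/-- The centre and the leaves as the vertices of a wheel. -/
def rim (c : V) (k : ℕ) (ℓ : ℤ → V) (i : Fin (k + 1)) : V := if i.val = 0 then c else ℓ i.val

lemma rim_injective : Function.Injective (rim c k ℓ) := by
  intro i j h
  unfold rim at h
  split_ifs at h with h1 h2 h2
  · exact Fin.ext (h1.trans h2.symm)
  · exact absurd h (S.ne_leaf _)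
  · exact absurd h.symm (S.ne_leaf _)
  · exact Fin.ext ((S.leaf_eq_iff (by omega) (by omega) (by omega) (by omega)).1 h)

lemma mid_ne_rim {i : ℤ} (hi : m i ≠ ℓ i) (j : Fin (k + 1)) : m i ≠ rim c k ℓ j := by
  unfold rim
  split_ifs
  exacts [(S.ne_mid i).symm, S.mid_ne_leaf hi _]

include H

/-- The vertices of the graph. -/
lemma eq_or (v : V) : v = c ∨ (∃ j : ℕ, 1 ≤ j ∧ j ≤ k ∧ v = ℓ j) ∨
    ∃ j : ℕ, 1 ≤ j ∧ j ≤ k ∧ m j ≠ ℓ j ∧ v = m j := by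
  have : v = c ∨ (∃ i, v = ℓ i) ∨ ∃ i, v = m i := by
    refine H.connected.forall_mem (S := {v | v = c ∨ (∃ i, v = ℓ i) ∨ ∃ i, v = m i})
      (x := c) (Or.inl rfl) ?_ v
    have hl : ∀ i w, G.Adj (ℓ i) w → w = c ∨ (∃ i, w = ℓ i) ∨ ∃ i, w = m i := by
      intro i w hw
      by_cases hi : m i = ℓ i
      · rcases (S.adj_short H hi w).1 hw with e | e | e
        exacts [Or.inl e, Or.inr (Or.inl ⟨_, e⟩), Or.inr (Or.inl ⟨_, e⟩)]
      · rcases (S.adj_long H hi w).1 hw with e | e | e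
        exacts [Or.inr (Or.inr ⟨_, e⟩), Or.inr (Or.inl ⟨_, e⟩), Or.inr (Or.inl ⟨_, e⟩)]
    rintro v (rfl | ⟨i, rfl⟩ | ⟨i, rfl⟩) w hw
    · exact Or.inr (Or.inr ((S.adj_centre H w).1 hw))
    · exact hl i w hw
    · by_cases hi : m i = ℓ i
      · exact hl i w (hi ▸ hw)
      · rcases (S.adj_mid H hi w).1 hw with e | e
        exacts [Or.inl e, Or.inr (Or.inl ⟨_, e⟩)]
  rcases this with h | ⟨i, h⟩ | ⟨i, h⟩
  · exact Or.inl h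
  · obtain ⟨j, h1, h2, e, -⟩ := S.exists_natCast i
    exact Or.inr (Or.inl ⟨j, h1, h2, h.trans e⟩)
  · obtain ⟨j, h1, h2, -, e⟩ := S.exists_natCast i
    by_cases hj : m j = ℓ j
    · exact Or.inr (Or.inl ⟨j, h1, h2, (h.trans e).trans hj⟩)
    · exact Or.inr (Or.inr ⟨j, h1, h2, hj, h.trans e⟩)

lemma adj_leaf_iff {i j : ℕ} (hi : 1 ≤ i) (hik : i ≤ k) (hj : 1 ≤ j) (hjk : j ≤ k) :
    G.Adj (ℓ i) (ℓ j) ↔ j = i + 1 ∨ i = j + 1 ∨ (i = 1 ∧ j = k) ∨ (j = 1 ∧ i = k) := by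
  have hk := S.three_le
  rw [S.adj_leaf_leaf H, S.eq_iff, S.eq_iff]
  constructor
  · rintro (⟨d, hd⟩ | ⟨d, hd⟩)
    · have : -2 < d := by nlinarith
      have : d < 1 := by nlinarith
      interval_cases d <;> omega
    · have : -1 < d := by nlinarith
      have : d < 2 := by nlinarith
      interval_cases d <;> omega
  · rintro (h | h | ⟨h, h'⟩ | ⟨h, h'⟩)
    · exact Or.inl ⟨0, by omega⟩
    · exact Or.inr ⟨0, by omega⟩
    · exact Or.inr ⟨1, by omega⟩
    · exact Or.inl ⟨-1, by omega⟩

lemma adj_centre_leaf (i : ℤ) : G.Adj c (ℓ i) ↔ m i = ℓ i := by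
  rw [S.adj_centre H]
  constructor
  · rintro ⟨j, hj⟩
    have h : m j = ℓ j := by
      by_contra h
      exact S.mid_ne_leaf h i hj.symm
    exact (S.mid_eq _ _ (hj.trans h)).trans hj.symm
  · exact fun h => ⟨i, h.symm⟩

/-- The graph induced on the centre and the leaves is the wheel without the subdivided spokes. These
are described by `P`. -/
lemma adj_rim {P : ℕ → Prop} (h : ∀ j : ℕ, 1 ≤ j → j ≤ k → (m j ≠ ℓ j ↔ P j))
    (i j : Fin (k + 1)) : G.Adj (rim c k ℓ i) (rim c k ℓ j) ↔ (wheel (k + 1)).Adj i j ∧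
      (i.val = 0 → ¬ P j.val) ∧ (j.val = 0 → ¬ P i.val) := by
  rw [wheel_adj, ne_eq, Fin.ext_iff]
  unfold rim
  split_ifs with h1 h2 h2
  · simp [h1, h2]
  · have := h j.val (by omega) (by omega)
    rw [S.adj_centre_leaf H, ← this]
    simp [h1, h2, Ne.symm h2]
  · have := h i.val (by omega) (by omega)
    rw [G.adj_comm, S.adj_centre_leaf H, ← this]
    simp [h1, h2]
  · rw [S.adj_leaf_iff H (by omega) (by omega) (by omega) (by omega)]
    simp only [h1, h2, false_or, false_imp_iff, and_true, Nat.add_sub_cancel]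
    have := S.three_le
    constructor
    · intro h
      exact ⟨by omega, by tauto⟩
    · rintro ⟨-, h⟩
      tauto

lemma adj_mid_rim {i : ℕ} (hi : 1 ≤ i) (hik : i ≤ k) (h : m i ≠ ℓ i) (j : Fin (k + 1)) :
    G.Adj (m i) (rim c k ℓ j) ↔ j.val = 0 ∨ j.val = i := by
  rw [S.adj_mid H h]
  unfold rim
  split_ifs with h1
  · simp [h1]
  · simp only [(S.ne_leaf _).symm, h1, false_or]
    exact S.leaf_eq_iff (by omega) (by omega) hi hik

lemma nonempty_iso_wheel (h : ∀ i, m i = ℓ i) : Nonempty (G ≃g wheel (k + 1)) := by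
  have hsurj : Function.Surjective (rim c k ℓ) := by
    intro v
    rcases S.eq_or H v with rfl | ⟨j, h1, h2, rfl⟩ | ⟨j, h1, h2, h3, rfl⟩
    · exact ⟨0, by simp [rim]⟩
    · exact ⟨⟨j, by omega⟩, by rw [rim, if_neg (by simp; omega)]⟩
    · exact absurd (h j) h3
  have hadj : ∀ i j, G.Adj (rim c k ℓ i) (rim c k ℓ j) ↔ (wheel (k + 1)).Adj i j := fun i j => by
    simpa using S.adj_rim H (P := fun _ => False) (fun j _ _ => by simp [h]) i j
  exact ⟨Iso.symm ⟨Equiv.ofBijective _ ⟨S.rim_injective, hsurj⟩, fun {i j} => hadj i j⟩⟩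

/-- One subdivided spoke. -/
lemma nonempty_iso_wheel' (h : ∀ j : ℕ, 1 ≤ j → j ≤ k → (m j ≠ ℓ j ↔ j = 1)) :
    Nonempty (G ≃g wheel' (k + 2) (by have := S.three_le; omega)) := by
  have hk := S.three_le
  have l1 : m (1 : ℕ) ≠ ℓ (1 : ℕ) := (h 1 le_rfl (by omega)).2 rfl
  set φ : Option (Fin (k + 1)) → V := fun o => o.elim (m (1 : ℕ)) (rim c k ℓ) with hφ
  have hinj : Function.Injective φ := by
    rintro (_ | i) (_ | j) e
    · rfl
    · exact absurd e (S.mid_ne_rim l1 j)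
    · exact absurd e.symm (S.mid_ne_rim l1 i)
    · exact congrArg some (S.rim_injective e)
  have hsurj : Function.Surjective φ := by
    intro v
    rcases S.eq_or H v with rfl | ⟨j, h1, h2, rfl⟩ | ⟨j, h1, h2, h3, rfl⟩
    · exact ⟨some 0, by simp [φ, rim]⟩
    · exact ⟨some ⟨j, by omega⟩, by simp only [φ, Option.elim, rim]; rw [if_neg (by omega)]⟩
    · obtain rfl := (h j h1 h2).1 h3
      exact ⟨none, rfl⟩
  have hadj : ∀ a b, G.Adj (φ a) (φ b) ↔ (wheel' (k + 2) (by omega)).Adj a b := by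
    have hmid : ∀ j, G.Adj (m (1 : ℕ)) (rim c k ℓ j) ↔
        (wheel' (k + 2) (by omega)).Adj none (some j) := fun j => by
      rw [S.adj_mid_rim H le_rfl (by omega) l1, wheel', subdivide_adj_none_some, Sym2.mem_iff,
        Fin.ext_iff, Fin.ext_iff]
    rintro (_ | i) (_ | j)
    · simp
    · exact hmid j
    · exact (G.adj_comm _ _).trans ((hmid i).trans (SimpleGraph.adj_comm _ _ _))
    · refine (S.adj_rim H h i j).trans ?_
      rw [wheel', subdivide_adj_some_some]
      refine and_congr_right fun ha => ?_
      rw [ne_eq, Sym2.eq_iff, Fin.ext_iff, Fin.ext_iff, Fin.ext_iff, Fin.ext_iff]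
      dsimp only
      omega
  exact ⟨Iso.symm ⟨Equiv.ofBijective φ ⟨hinj, hsurj⟩, fun {a b} => hadj a b⟩⟩

/-- Two subdivided spokes. -/
lemma nonempty_iso_wheel'' (h : ∀ j : ℕ, 1 ≤ j → j ≤ k → (m j ≠ ℓ j ↔ j = 1 ∨ j = (k + 2) / 2)) :
    Nonempty (G ≃g wheel'' (k + 3) (by have := S.three_le; omega)) := by
  have hk := S.three_le
  set q : ℕ := (k + 2) / 2 with hq
  have l1 : m (1 : ℕ) ≠ ℓ (1 : ℕ) := (h 1 le_rfl (by omega)).2 (Or.inl rfl)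
  have lq : m q ≠ ℓ q := (h q (by omega) (by omega)).2 (Or.inr rfl)
  have hne : ℓ q ≠ ℓ (1 : ℕ) := fun e => by
    have := (S.leaf_eq_iff (by omega) (by omega) (by omega) (by omega)).1 e
    omega
  have hne' : m q ≠ m (1 : ℕ) := fun e => hne (S.mid_inj e)
  set φ : Option (Option (Fin (k + 1))) → V :=
    fun o => o.elim (m q) fun o => o.elim (m (1 : ℕ)) (rim c k ℓ) with hφ
  have hinj : Function.Injective φ := by
    rintro (_ | _ | i) (_ | _ | j) e
    · rfl
    · exact absurd e hne'
    · exact absurd e (S.mid_ne_rim lq j)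
    · exact absurd e.symm hne'
    · rfl
    · exact absurd e (S.mid_ne_rim l1 j)
    · exact absurd e.symm (S.mid_ne_rim lq i)
    · exact absurd e.symm (S.mid_ne_rim l1 i)
    · exact congrArg (some ∘ some) (S.rim_injective e)
  have hsurj : Function.Surjective φ := by
    intro v
    rcases S.eq_or H v with rfl | ⟨j, h1, h2, rfl⟩ | ⟨j, h1, h2, h3, rfl⟩
    · exact ⟨some (some 0), by simp [φ, rim]⟩
    · exact ⟨some (some ⟨j, by omega⟩), by
        simp only [φ, Option.elim, rim]; rw [if_neg (by omega)]⟩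
    · rcases (h j h1 h2).1 h3 with rfl | rfl
      exacts [⟨some none, rfl⟩, ⟨none, rfl⟩]
  have hadj : ∀ a b, G.Adj (φ a) (φ b) ↔ (wheel'' (k + 3) (by omega)).Adj a b := by
    have hmid : ∀ j, G.Adj (m (1 : ℕ)) (rim c k ℓ j) ↔
        (wheel'' (k + 3) (by omega)).Adj (some none) (some (some j)) := fun j => by
      rw [S.adj_mid_rim H le_rfl (by omega) l1, wheel'', subdivide_adj_some_some,
        subdivide_adj_none_some, Sym2.mem_iff, Fin.ext_iff, Fin.ext_iff]
      refine ⟨fun h => ⟨h, fun e => ?_⟩, And.left⟩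
      rw [Sym2.eq_iff] at e
      simp at e
    have hmidq : ∀ j, G.Adj (m q) (rim c k ℓ j) ↔
        (wheel'' (k + 3) (by omega)).Adj none (some (some j)) := fun j => by
      rw [S.adj_mid_rim H (by omega) (by omega) lq, wheel'', subdivide_adj_none_some, Sym2.mem_iff,
        Option.some_inj, Option.some_inj, Fin.ext_iff, Fin.ext_iff]
      rfl
    have hmm : G.Adj (m q) (m (1 : ℕ)) ↔ (wheel'' (k + 3) (by omega)).Adj none (some none) := by
      rw [wheel'', subdivide_adj_none_some, Sym2.mem_iff]
      simpa using S.not_adj_mid_mid H lq _ hne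
    rintro (_ | _ | i) (_ | _ | j)
    · simp
    · exact hmm
    · exact hmidq j
    · exact (G.adj_comm _ _).trans (hmm.trans (SimpleGraph.adj_comm _ _ _))
    · simp
    · exact hmid j
    · exact (G.adj_comm _ _).trans ((hmidq i).trans (SimpleGraph.adj_comm _ _ _))
    · exact (G.adj_comm _ _).trans ((hmid i).trans (SimpleGraph.adj_comm _ _ _))
    · refine (S.adj_rim H h i j).trans ?_
      rw [wheel'', subdivide_adj_some_some, subdivide_adj_some_some, and_assoc]
      refine and_congr_right fun ha => ?_
      rw [ne_eq, ne_eq, Sym2.eq_iff, Sym2.eq_iff, Option.some_inj, Option.some_inj, Option.some_inj,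
        Option.some_inj, Fin.ext_iff, Fin.ext_iff, Fin.ext_iff, Fin.ext_iff, Fin.ext_iff,
        Fin.ext_iff]
      dsimp only
      omega
  exact ⟨Iso.symm ⟨Equiv.ofBijective φ ⟨hinj, hsurj⟩, fun {a b} => hadj a b⟩⟩

end IsSpider

end Wheels

/-! ### Patterns of subdivided spokes -/

section Spokes

/-- The cyclic patterns of subdivided spokes that the curvature conditions leave, up to a rotation
by `a`. -/
lemma exists_pattern {k : ℕ} (hk : 3 ≤ k) (hk8 : k < 8) {P : ℤ → Prop}
    (per : ∀ i, P (i + k) ↔ P i) (h₂ : ∀ i, P i → P (i + 1) → k ≤ 4)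
    (h₁ : ∀ i, P i → ¬ P (i + 1) → P (i + 2) → k ≤ 5)
    (h₃ : ∀ i, P i → P (i + 1) → P (i + 2) → k < 4) (h : P 1) :
    ∃ a : ℤ, (∀ j : ℕ, 1 ≤ j → j ≤ k → (P (j + a) ↔ j = 1)) ∨
      (∀ j : ℕ, 1 ≤ j → j ≤ k → (P (j + a) ↔ j = 1 ∨ j = (k + 2) / 2)) ∨
      (k = 3 ∧ P 1 ∧ P 2 ∧ P 3) ∨
      k = 4 ∧ P (1 + a) ∧ P (2 + a) ∧ ¬ P (3 + a) ∧ ¬ P (4 + a) := by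
  by_cases hne : ∃ j : ℕ, 2 ≤ j ∧ j ≤ k ∧ P j
  swap
  · refine ⟨0, Or.inl fun j h1 hj => ?_⟩
    rw [add_zero]
    refine ⟨fun hP => ?_, fun e => by rw [e]; exact_mod_cast h⟩
    by_contra hj1
    exact hne ⟨j, by omega, hj, hP⟩
  obtain ⟨j, hj2, hjk, hj⟩ := hne
  -- The consequences of the hypotheses for `k ≥ 5` and `k ≥ 6`.
  have h₂' : 5 ≤ k → ∀ i, P i → ¬ P (i + 1) := fun hk5 i h h' => by have := h₂ i h h'; omega
  have h₁' : 6 ≤ k → ∀ i, P i → ¬ P (i + 2) := fun hk6 i h h' => by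
    have := h₁ i h (h₂' (by omega) i h) h'
    omega
  clear h₁ h₂
  have p1 := per 1
  have p2 := per 2
  have p3 := per 3
  have p4 := per 4
  interval_cases k
  · clear h₁' h₂' h₃
    norm_num at p1 p2 p3 p4
    by_cases h2 : P 2 <;> by_cases h3 : P 3
    · exact ⟨0, Or.inr (Or.inr (Or.inl ⟨rfl, h, h2, h3⟩))⟩
    · refine ⟨0, Or.inr (Or.inl fun i _ _ => ?_)⟩
      interval_cases i <;> norm_num [h, h2, h3]
    · refine ⟨2, Or.inr (Or.inl fun i _ _ => ?_)⟩
      interval_cases i <;> norm_num [h, h2, h3, p1, p2]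
    · interval_cases j <;> contradiction
  · have c1 : ¬ (P 1 ∧ P 2 ∧ P 3) := fun h => absurd (h₃ 1 h.1 h.2.1 h.2.2) (by norm_num)
    have c3 : ¬ (P 3 ∧ P 4 ∧ P 5) := fun h => absurd (h₃ 3 h.1 h.2.1 h.2.2) (by norm_num)
    have c4 : ¬ (P 4 ∧ P 5 ∧ P 6) := fun h => absurd (h₃ 4 h.1 h.2.1 h.2.2) (by norm_num)
    clear h₁' h₂' h₃
    norm_num at p1 p2 p3
    rw [p1] at c3 c4
    rw [p2] at c4
    interval_cases j
    · have h3 : ¬ P 3 := fun h3 => c1 ⟨h, hj, h3⟩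
      have h4 : ¬ P 4 := fun h4 => c4 ⟨h4, h, hj⟩
      exact ⟨0, Or.inr (Or.inr (Or.inr ⟨rfl, by norm_num [h, h3, h4]; exact hj⟩))⟩
    · have h2 : ¬ P 2 := fun h2 => c1 ⟨h, h2, hj⟩
      have h4 : ¬ P 4 := fun h4 => c3 ⟨hj, h4, h⟩
      replace hj : P 3 := hj
      refine ⟨0, Or.inr (Or.inl fun i _ _ => ?_)⟩
      interval_cases i <;> norm_num [h, h2, h4, hj]
    · have h2 : ¬ P 2 := fun h2 => c4 ⟨hj, h, h2⟩
      have h3 : ¬ P 3 := fun h3 => c3 ⟨h3, hj, h⟩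
      replace hj : P 4 := hj
      exact ⟨3, Or.inr (Or.inr (Or.inr ⟨rfl, by norm_num [p1, p2, p3, h, h2, h3, hj]⟩))⟩
  · have h2' := h₂' (by norm_num)
    have h2 := h2' 1 h
    clear h₁' h₂' h₃
    norm_num at p1 p2 p3 h2
    interval_cases j
    · exact absurd hj h2
    · have h4 := h2' 3 hj
      have h5 : ¬ P 5 := fun h5 => h2' 5 h5 (p1.2 h)
      replace hj : P 3 := hj
      norm_num at h4
      refine ⟨0, Or.inr (Or.inl fun i _ _ => ?_)⟩
      interval_cases i <;> norm_num [h, h2, h4, h5, hj]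
    · have h3 : ¬ P 3 := fun h3 => h2' 3 h3 hj
      have h5 := h2' 4 hj
      replace hj : P 4 := hj
      norm_num at h5
      refine ⟨3, Or.inr (Or.inl fun i _ _ => ?_)⟩
      interval_cases i <;> norm_num [p1, p2, p3, h, h2, h3, h5, hj]
    · exact absurd (p1.2 h) (h2' 5 hj)
  · have h2' := h₂' (by norm_num)
    have h1' := h₁' (by norm_num)
    have h2 := h2' 1 h
    have h3 := h1' 1 h
    clear h₁' h₂' h₃
    norm_num at p1 p2 p3 h2 h3
    interval_cases j
    · exact absurd hj h2
    · exact absurd hj h3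
    · have h5 := h2' 4 hj
      have h6 := h1' 4 hj
      replace hj : P 4 := hj
      norm_num at h5 h6
      refine ⟨0, Or.inr (Or.inl fun i _ _ => ?_)⟩
      interval_cases i <;> norm_num [h, h2, h3, h5, h6, hj]
    · exact absurd (p1.2 h) (h1' 5 hj)
    · exact absurd (p1.2 h) (h2' 6 hj)
  · have h2' := h₂' (by norm_num)
    have h1' := h₁' (by norm_num)
    have h2 := h2' 1 h
    have h3 := h1' 1 h
    clear h₁' h₂' h₃
    norm_num at p1 p2 p3 p4 h2 h3
    have h7 : ¬ P 7 := fun h7 => h2' 7 h7 (p1.2 h)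
    have h6 : ¬ P 6 := fun h6 => h1' 6 h6 (p1.2 h)
    interval_cases j
    · exact absurd hj h2
    · exact absurd hj h3
    · have h5 := h2' 4 hj
      replace hj : P 4 := hj
      norm_num at h5
      refine ⟨0, Or.inr (Or.inl fun i _ _ => ?_)⟩
      interval_cases i <;> norm_num [h, h2, h3, h5, h6, h7, hj]
    · have h4 : ¬ P 4 := fun h4 => h2' 4 h4 hj
      replace hj : P 5 := hj
      refine ⟨4, Or.inr (Or.inl fun i _ _ => ?_)⟩
      interval_cases i <;> norm_num [p1, p2, p3, p4, h, h2, h3, h4, h6, h7, hj]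
    · exact absurd hj h6
    · exact absurd hj h7

end Spokes

variable {V : Type*} [Fintype V] {G T : SimpleGraph V} {σ : Equiv.Perm V}

namespace IsSpider

variable {c : V} {k : ℕ} {ℓ m : ℤ → V}

lemma nonempty_iso_halinH1 (H : IsHalin G T σ) (S : IsSpider T σ c 3 ℓ m) (h1 : m 1 ≠ ℓ 1)
    (h2 : m 2 ≠ ℓ 2) (h3 : m 3 ≠ ℓ 3) : Nonempty (G ≃g halinH1) := by
  have p3 : ℓ 4 = ℓ 1 := S.periodic 1
  have p0 : ℓ 0 = ℓ 3 := (S.periodic 0).symm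
  have n12 : ℓ 1 ≠ ℓ 2 := S.leaf_ne (by norm_num) (by norm_num)
  have n13 : ℓ 1 ≠ ℓ 3 := S.leaf_ne (by norm_num) (by norm_num)
  have n23 : ℓ 2 ≠ ℓ 3 := S.leaf_ne (by norm_num) (by norm_num)
  have mn : ∀ {i j}, ℓ i ≠ ℓ j → m i ≠ m j := fun h e => h (S.mid_inj e)
  have g1 := S.adj_long H h1
  have g2 := S.adj_long H h2
  have g3 := S.adj_long H h3
  norm_num [p3, p0] at g1 g2 g3
  refine H.connected.nonempty_iso_halinH1 (a := c) (b := m 1) (c := m 2) (d := m 3) (e := ℓ 1)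
    (f := ℓ 2) (g := ℓ 3) ?_ (fun w => ?_) (S.adj_mid H h1) (S.adj_mid H h2)
    (S.adj_mid H h3) g1 (fun w => (g2 w).trans (iff_of_eq (by ac_rfl)))
    (fun w => (g3 w).trans (iff_of_eq (by ac_rfl)))
  · exact nodup_append_of_isLeaf (T := T) (l := [c, m 1, m 2, m 3]) (l' := [ℓ 1, ℓ 2, ℓ 3])
      (by simp [S.ne_mid, mn n12, mn n13, mn n23]) (by simp [n12, n13, n23])
      (by simp [S.not_isLeaf, (S.isLeg _).not_isLeaf h1, (S.isLeg _).not_isLeaf h2,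
        (S.isLeg _).not_isLeaf h3]) (by simp [S.leaf])
  · rw [S.adj_centre H]
    constructor
    · rintro ⟨i, rfl⟩
      obtain ⟨j, h1, h2, -, e⟩ := S.exists_natCast i
      rw [e]
      interval_cases j <;> simp
    · rintro (e | e | e)
      exacts [⟨1, e⟩, ⟨2, e⟩, ⟨3, e⟩]

lemma nonempty_iso_halinH6 (H : IsHalin G T σ) (S : IsSpider T σ c 4 ℓ m) (h1 : m 1 ≠ ℓ 1)
    (h2 : m 2 ≠ ℓ 2) (h3 : m 3 = ℓ 3) (h4 : m 4 = ℓ 4) : Nonempty (G ≃g halinH6) := by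
  have p5 : ℓ 5 = ℓ 1 := S.periodic 1
  have p0 : ℓ 0 = ℓ 4 := (S.periodic 0).symm
  have n12 : ℓ 1 ≠ ℓ 2 := S.leaf_ne (by norm_num) (by norm_num)
  have n13 : ℓ 1 ≠ ℓ 3 := S.leaf_ne (by norm_num) (by norm_num)
  have n14 : ℓ 1 ≠ ℓ 4 := S.leaf_ne (by norm_num) (by norm_num)
  have n23 : ℓ 2 ≠ ℓ 3 := S.leaf_ne (by norm_num) (by norm_num)
  have n24 : ℓ 2 ≠ ℓ 4 := S.leaf_ne (by norm_num) (by norm_num)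
  have n34 : ℓ 3 ≠ ℓ 4 := S.leaf_ne (by norm_num) (by norm_num)
  have m12 : m 1 ≠ m 2 := fun e => n12 (S.mid_inj e)
  have g1 := S.adj_long H h1
  have g2 := S.adj_long H h2
  have g3 := S.adj_short H h3
  have g4 := S.adj_short H h4
  norm_num [p5, p0] at g1 g2 g3 g4
  refine H.connected.nonempty_iso_halinH6 (a := c) (b := m 1) (c := m 2) (d := ℓ 1) (e := ℓ 2)
    (f := ℓ 3) (g := ℓ 4) ?_ (fun w => ?_) (S.adj_mid H h1) (S.adj_mid H h2)
    g1 (fun w => (g2 w).trans (iff_of_eq (by ac_rfl)))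
    (fun w => (g3 w).trans (iff_of_eq (by ac_rfl))) (fun w => (g4 w).trans (iff_of_eq (by ac_rfl)))
  · exact nodup_append_of_isLeaf (T := T) (l := [c, m 1, m 2]) (l' := [ℓ 1, ℓ 2, ℓ 3, ℓ 4])
      (by simp [S.ne_mid, m12]) (by simp [n12, n13, n14, n23, n24, n34])
      (by simp [S.not_isLeaf, (S.isLeg _).not_isLeaf h1, (S.isLeg _).not_isLeaf h2])
      (by simp [S.leaf])
  · rw [S.adj_centre H]
    constructor
    · rintro ⟨i, rfl⟩
      obtain ⟨j, h1, h2, -, e⟩ := S.exists_natCast i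
      rw [e]
      interval_cases j <;> simp [h3, h4]
    · rintro (e | e | e | e)
      exacts [⟨1, e⟩, ⟨2, e⟩, ⟨3, e.trans h3.symm⟩, ⟨4, e.trans h4.symm⟩]

lemma classification (S : IsSpider T σ c k ℓ m) (H : IsHalin G T σ)
    (hpos : G.HasPositiveLLYCurvature) :
    (∃ n, 4 ≤ n ∧ n ≤ 12 ∧ Nonempty (G ≃g wheel n)) ∨
    (∃ n, ∃ h : 5 ≤ n, n ≤ 9 ∧ Nonempty (G ≃g wheel' n h)) ∨
    (∃ n, ∃ h : 6 ≤ n, n ≤ 10 ∧ Nonempty (G ≃g wheel'' n h)) ∨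
    Nonempty (G ≃g halinH1) ∨ Nonempty (G ≃g halinH6) := by
  have hk := S.three_le
  by_cases hs : ∀ i, m i = ℓ i
  · have := S.lt_twelve H hpos hs
    exact Or.inl ⟨k + 1, by omega, by omega, S.nonempty_iso_wheel H hs⟩
  push Not at hs
  obtain ⟨b, hb⟩ := hs
  -- Renumber so that the first leg has length two.
  have S' := S.shift (b - 1)
  obtain ⟨a, ha | ha | ⟨rfl, ha1, ha2, ha3⟩ | ⟨rfl, ha1, ha2, ha3, ha4⟩⟩ :=
    exists_pattern hk (S'.lt_eight H hpos (i := 1) (by simpa using hb))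
      (P := fun i => m (i + (b - 1)) ≠ ℓ (i + (b - 1)))
      (fun i => by rw [S'.periodic, S'.mid_periodic])
      (fun i => S'.le_four H hpos) (fun i h h' => S'.le_five H hpos h (not_not.1 h'))
      (fun i => S'.lt_four H hpos) (by simpa using hb)
  · have := (S'.shift a).lt_eight H hpos (i := 1) ((ha 1 le_rfl (by omega)).2 rfl)
    exact Or.inr (Or.inl ⟨k + 2, by omega, by omega, (S'.shift a).nonempty_iso_wheel' H ha⟩)
  · have := (S'.shift a).lt_eight H hpos (i := 1) ((ha 1 le_rfl (by omega)).2 (Or.inl rfl))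
    exact Or.inr (Or.inr (Or.inl ⟨k + 3, by omega, by omega,
      (S'.shift a).nonempty_iso_wheel'' H ha⟩))
  · exact Or.inr (Or.inr (Or.inr (Or.inl (nonempty_iso_halinH1 H S' ha1 ha2 ha3))))
  · exact Or.inr (Or.inr (Or.inr (Or.inr (nonempty_iso_halinH6 H (S'.shift a) ha1 ha2
      (not_not.1 ha3) (not_not.1 ha4)))))

end IsSpider

/-! ### The classification -/

section Classification

variable {V : Type*} [Fintype V] {G T : SimpleGraph V} {σ : Equiv.Perm V}

lemma IsHalin.classification (H : IsHalin G T σ) (hpos : G.HasPositiveLLYCurvature) :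
    (∃ n, 4 ≤ n ∧ n ≤ 12 ∧ Nonempty (G ≃g wheel n)) ∨
    (∃ n, ∃ h : 5 ≤ n, n ≤ 9 ∧ Nonempty (G ≃g wheel' n h)) ∨
    (∃ n, ∃ h : 6 ≤ n, n ≤ 10 ∧ Nonempty (G ≃g wheel'' n h)) ∨
    Nonempty (G ≃g halinH1) ∨ Nonempty (G ≃g halinH2) ∨ Nonempty (G ≃g halinH3) ∨
    Nonempty (G ≃g halinH4) ∨ Nonempty (G ≃g halinH5) ∨ Nonempty (G ≃g halinH6) ∨
    Nonempty (G ≃g halinH7) ∨ Nonempty (G ≃g halinH8) := by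
  rcases H.hasLegs_or hpos with hl | h | h
  · by_cases hadj : ∃ x y, T.Adj x y ∧ T.IsBranchVertex x ∧ T.IsBranchVertex y
    · obtain ⟨x, y, h, hx, hy⟩ := hadj
      rcases H.nonempty_iso_of_adj hpos hl h hx hy with h | h | h | h <;> simp [h]
    · obtain ⟨c, hc⟩ := H.exists_isBranchVertex
      obtain ⟨k, ℓ, m, S⟩ := H.exists_isSpider hc fun w hw =>
        (hl c w hc hw).resolve_right fun hb => hadj ⟨c, w, hw, hc, hb⟩
      rcases S.classification H hpos with h | h | h | h | h
      · exact Or.inl h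
      · exact Or.inr (Or.inl h)
      · exact Or.inr (Or.inr (Or.inl h))
      · simp [h]
      · simp [h]
  · simp [h]
  · simp [h]

end Classification

end SimpleGraph

theorem theorem1p3 {V : Type*} [Fintype V] (G : SimpleGraph V)
    (hG : G.IsGeneralizedHalin) (hpos : G.HasPositiveLLYCurvature) :
    Fintype.card V ≤ 12 ∧
      ((∃ n, 4 ≤ n ∧ n ≤ 12 ∧ Nonempty (G ≃g SimpleGraph.wheel n)) ∨
       (∃ n, ∃ h : 5 ≤ n, n ≤ 9 ∧ Nonempty (G ≃g SimpleGraph.wheel' n h)) ∨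
       (∃ n, ∃ h : 6 ≤ n, n ≤ 10 ∧ Nonempty (G ≃g SimpleGraph.wheel'' n h)) ∨
       Nonempty (G ≃g SimpleGraph.halinH1) ∨
       Nonempty (G ≃g SimpleGraph.halinH2) ∨
       Nonempty (G ≃g SimpleGraph.halinH3) ∨
       Nonempty (G ≃g SimpleGraph.halinH4) ∨
       Nonempty (G ≃g SimpleGraph.halinH5) ∨
       Nonempty (G ≃g SimpleGraph.halinH6) ∨
       Nonempty (G ≃g SimpleGraph.halinH7) ∨
       Nonempty (G ≃g SimpleGraph.halinH8)) := by
  obtain ⟨T, σ, H⟩ := hG.exists_isHalin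
  have hclass := H.classification hpos
  refine ⟨?_, hclass⟩
  have hfin : ∀ {n : ℕ} {K : SimpleGraph (Fin n)}, n ≤ 12 → Nonempty (G ≃g K) →
      Fintype.card V ≤ 12 := fun hn ⟨e⟩ => by
    rw [Fintype.card_congr e.toEquiv, Fintype.card_fin]
    exact hn
  rcases hclass with ⟨n, -, hn, h⟩ | ⟨n, hn, hn', ⟨e⟩⟩ | ⟨n, hn, hn', ⟨e⟩⟩ | h | h | h | h | h | h |
    h | h
  · exact hfin hn h
  · rw [Fintype.card_congr e.toEquiv, Fintype.card_option, Fintype.card_fin]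
    omega
  · rw [Fintype.card_congr e.toEquiv, Fintype.card_option, Fintype.card_option, Fintype.card_fin]
    omega
  all_goals exact hfin (by norm_num) h
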